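/- Let $b>1$. On $T^*S^3=\{(x,y)\in\mathbb R^4\times\mathbb R^4: x\cdot x=1,\ x\cdot y=0\}$ with the Dirac bracket, whose structure matrix is $$\begin{pmatrix}0& I-xx^t|x|^{-2}\\ -I+xx^t|x|^{-2}& -(xy^t-yx^t)|x|^{-2}\end{pmatrix},$$ put $\ell_{ij}=x_iy_j-x_jy_i$, $H=\tfrac12|y|^2$ and $G=b\,\ell_{12}^2+b\,\ell_{13}^2+\ell_{14}^2$. The prolate fibration is $F=(H,\ell_{23},G)$. For $h>0$ the functions $(\ell_{23},G)$ also define the reduced prolate system on $$S^2\times S^2=\{(\ell_{12}\pm\ell_{34})^2+(\ell_{13}\mp\ell_{24})^2+(\ell_{14}\pm\ell_{23})^2=2h\}\subset\mathbb R^6$$ with the Lie–Poisson bracket of the $\ell_{ij}$ (that of $\mathfrak{so}(4)^*$). For a value $c$ of a system $F=(F_1,\dots,F_n)$, the period lattice at $c$ is the set of $T\in\mathbb R^n$ for which the time-one Hamiltonian flow of $\sum_k T_kF_k$ is the identity on the fibre $F^{-1}(c)$. Smooth action variables on an open set $U$ of values are $C^\infty$ functions $I_1,\dots,I_n$ on $U$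 with linearly independent differentials such that $2\pi\,dI_1,\dots,2\pi\,dI_n$ is a $\mathbb Z$-basis of the period lattice at each point of $U$. A regular value means a value in the image of $F$ whose fibre contains no critical point. Along a closed curve of regular values, action variables $A$ given near the initial point have monodromy matrix $M$ if they can be continued along the curve through locally agreeing smooth action variables, and every such continuation arrives as $MA$. The monodromy along the curve is non-trivial if no neighbourhood of the curve carries single-valued smooth action variables. Let $$p(s)=\sqrt{\frac{-2hs^2+(g+2h+(b-1)l^2)s-g}{4s(s-b)(s-1)^2}},$$ let $r_1\le r_2$ be the roots of the numerator, and let $$J_1(h,l,g)=\frac2\pi\int_0^{\min(r_1,1)}p\,ds,\qquad J_2=l,\qquad J_3(h,l,g)=\frac2\pi\int_{\max(1,r_2)}^{b}p\,ds .$$ **Lemma.** (i) The regular values $(h,l,g)$ of $(H,\ell_{23},G)$ on $T^*S^3$ are those with $0<g<b(2h-l^2)$ and $(l,g)\ne(0,2h)$. Over the regular values with $l\neq0$ the functions $(J_1,J_2,J_3)$ are smooth action variables. Let $\gamma$ be a closed curve of regular values that winds once clockwise, in the $(l,g)$-plane ($l$ horizontal, $g$ vertical), around the line $(l,g)=(0,2h)$.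 Then the monodromy along $\gamma$ is non-trivial, and if $l\ne0$ at the initial point of $\gamma$, the actions $(J_1,J_2,J_3)^t$ have monodromy matrix $$\mathfrak M=\begin{pmatrix}1&2&0\\0&1&0\\0&-2&1\end{pmatrix}.$$ (ii) For each $h>0$ the regular values $(l,g)$ of the reduced prolate system $(\ell_{23},G)$ on $S^2\times S^2$ are those with $0<g<b(2h-l^2)$ and $(l,g)\neq(0,2h)$. Over those with $l\ne0$ the functions $(J_1(h,\cdot,\cdot),\,l)$ are smooth action variables. Let $\gamma$ be a closed curve of regular values that winds once clockwise around $(0,2h)$. Then the monodromy along $\gamma$ is non-trivial, and if $l\ne0$ at the initial point, the actions $(J_1,\ell_{23})^t$ have monodromy matrix $\begin{pmatrix}1&2\\0&1\end{pmatrix}$, the top-left block of $\mathfrak M$. -/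

import Mathlib

open Set Filter Topology
open scoped ContDiff

/-!
### Integrable systems on a symplectic leaf of a Poisson structure

`B : (ι → ℝ) → Matrix ι ι ℝ` is the structure matrix of a Poisson bracket
`{f, g} = (∇f)ᵀ B ∇g`, the phase space `P` is one of its symplectic leaves and
`F = (F₁, …, Fₙ)` is a family of `n` functions, `2 n` being the dimension of `P`.
-/

section General

variable {ι : Type*} [Fintype ι] [DecidableEq ι] {n : ℕ}

/-- The Hamiltonian vector field `B ∇f`. -/
noncomputable def hamVF (B : (ι → ℝ) → Matrix ι ι ℝ) (f : (ι → ℝ) → ℝ) (z : ι → ℝ) : ι → ℝ :=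
  (B z).mulVec (fun i => fderiv ℝ f z (Pi.single i 1))

/-- The regular values of `F` that lie in the image of `P`: all points of the (nonempty) fibre
are points at which the Hamiltonian vector fields of `F₁, …, Fₙ` are linearly independent. -/
def regularValues (B : (ι → ℝ) → Matrix ι ι ℝ) (P : Set (ι → ℝ))
    (F : (ι → ℝ) → Fin n → ℝ) : Set (Fin n → ℝ) :=
  {c | (∃ z ∈ P, F z = c) ∧
    ∀ z ∈ P, F z = c → LinearIndependent ℝ (fun k => hamVF B (fun w => F w k) z)}

/-- The period lattice over the value `c`: all `T = (T₁, …, Tₙ)` such that the time-one map of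
the Hamiltonian flow of `T₁ F₁ + ⋯ + Tₙ Fₙ` is the identity on the fibre `F = c`. -/
def periodLattice (B : (ι → ℝ) → Matrix ι ι ℝ) (P : Set (ι → ℝ))
    (F : (ι → ℝ) → Fin n → ℝ) (c : Fin n → ℝ) : Set (Fin n → ℝ) :=
  {T | ∀ z ∈ P, F z = c → ∃ γ : ℝ → ι → ℝ, γ 0 = z ∧ γ 1 = z ∧
    ∀ t, HasDerivAt γ (hamVF B (fun w => ∑ k, T k * F w k) (γ t)) t}

/-- The gradient at `c` of the `k`-th component of `I`. -/
noncomputable def actionGrad (I : (Fin n → ℝ) → Fin n → ℝ) (c : Fin n → ℝ) (k : Fin n) :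
    Fin n → ℝ :=
  fun j => fderiv ℝ I c (Pi.single j 1) k

/-- `I = (I₁, …, Iₙ)` are smooth action variables over the open set `U` of values of `F`:
they are smooth local coordinates on `U`, and `2π dI₁, …, 2π dIₙ` is at each point of `U` a
`ℤ`-basis of the period lattice. (So the `I_k ∘ F` generate `2π`-periodic flows, which combine to
an effective action of the `n`-torus on the fibres.) -/
def IsActionVariables (B : (ι → ℝ) → Matrix ι ι ℝ) (P : Set (ι → ℝ))
    (F : (ι → ℝ) → Fin n → ℝ) (U : Set (Fin n → ℝ)) (I : (Fin n → ℝ) → Fin n → ℝ) : Prop :=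
  IsOpen U ∧ ContDiffOn ℝ ∞ I U ∧ ∀ c ∈ U, LinearIndependent ℝ (actionGrad I c) ∧
    ∀ T : Fin n → ℝ, T ∈ periodLattice B P F c ↔
      ∃ m : Fin n → ℤ, T = (2 * Real.pi) • ∑ k, (m k : ℝ) • actionGrad I c k

/-- `I t`, `t ∈ [0, 1]`, is a continuation of smooth action variables along the curve `γ` in the
space of values of `F`: each `I t` is a system of action variables near `γ t`, and for `s` close
to `t` the functions `I s` and `I t` agree near `γ s`. -/
def IsActionContinuation (B : (ι → ℝ) → Matrix ι ι ℝ) (P : Set (ι → ℝ))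
    (F : (ι → ℝ) → Fin n → ℝ) (γ : ℝ → Fin n → ℝ)
    (I : ℝ → (Fin n → ℝ) → Fin n → ℝ) : Prop :=
  (∀ t ∈ Icc (0 : ℝ) 1, ∃ U, γ t ∈ U ∧ IsActionVariables B P F U (I t)) ∧
    ∀ t ∈ Icc (0 : ℝ) 1, ∀ᶠ s in 𝓝[Icc 0 1] t, I s =ᶠ[𝓝 (γ s)] I t

/-- The action variables `A`, given near `γ 0`, have monodromy matrix `M` along the closed
curve `γ`: they can be continued along `γ`, and every continuation turns `A` into `M A`. -/
def HasActionMonodromy (B : (ι → ℝ) → Matrix ι ι ℝ) (P : Set (ι → ℝ))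
    (F : (ι → ℝ) → Fin n → ℝ) (γ : ℝ → Fin n → ℝ) (A : (Fin n → ℝ) → Fin n → ℝ)
    (M : Matrix (Fin n) (Fin n) ℤ) : Prop :=
  (∃ I, IsActionContinuation B P F γ I ∧ I 0 =ᶠ[𝓝 (γ 0)] A) ∧
    ∀ I, IsActionContinuation B P F γ I → I 0 =ᶠ[𝓝 (γ 0)] A →
      I 1 =ᶠ[𝓝 (γ 1)] fun c => (M.map (Int.cast : ℤ → ℝ)).mulVec (A c)

/-- The monodromy along the closed curve `γ` is non-trivial: there are no single-valued smooth
action variables over a neighbourhood of `γ`. -/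
def HasNontrivialMonodromy (B : (ι → ℝ) → Matrix ι ι ℝ) (P : Set (ι → ℝ))
    (F : (ι → ℝ) → Fin n → ℝ) (γ : ℝ → Fin n → ℝ) : Prop :=
  ¬ ∃ U I, γ '' Icc 0 1 ⊆ U ∧ IsActionVariables B P F U I

end General

/-! ### The cotangent bundle of the three-sphere

A point `(x, y)` of `T*ℝ⁴` is a function on `Fin 4 ⊕ Fin 4`, with indices counted from `0`. -/

/-- Structure matrix of the Dirac bracket that enforces `x · x = 1` and `x · y = 0`. -/
noncomputable def diracMatrix (z : Fin 4 ⊕ Fin 4 → ℝ) :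
    Matrix (Fin 4 ⊕ Fin 4) (Fin 4 ⊕ Fin 4) ℝ :=
  let x : Fin 4 → ℝ := fun i => z (Sum.inl i)
  let y : Fin 4 → ℝ := fun i => z (Sum.inr i)
  let N : ℝ := ∑ i, x i ^ 2
  let Q : Matrix (Fin 4) (Fin 4) ℝ := 1 - N⁻¹ • Matrix.vecMulVec x x
  Matrix.fromBlocks 0 Q (-Q) (-(N⁻¹ • (Matrix.vecMulVec x y - Matrix.vecMulVec y x)))

/-- `T*S³ = {(x, y) : x · x = 1, x · y = 0}`. -/
def cotangentS3 : Set (Fin 4 ⊕ Fin 4 → ℝ) :=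
  {z | ∑ i, z (Sum.inl i) ^ 2 = 1 ∧ ∑ i, z (Sum.inl i) * z (Sum.inr i) = 0}

/-- The angular momentum `x i * y j - x j * y i`. -/
def angMom (z : Fin 4 ⊕ Fin 4 → ℝ) (i j : Fin 4) : ℝ :=
  z (Sum.inl i) * z (Sum.inr j) - z (Sum.inl j) * z (Sum.inr i)

/-- The prolate fibration `(H, ℓ₂₃, G)` with
`H = |y|² / 2` and `G = b ℓ₁₂² + b ℓ₁₃² + ℓ₁₄²`. -/
noncomputable def prolateMap (b : ℝ) (z : Fin 4 ⊕ Fin 4 → ℝ) : Fin 3 → ℝ :=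
  ![(∑ i, z (Sum.inr i) ^ 2) / 2, angMom z 1 2,
    b * angMom z 0 1 ^ 2 + b * angMom z 0 2 ^ 2 + angMom z 0 3 ^ 2]

/-! ### The reduced phase space

Coordinates on `ℝ⁶` are `(ℓ₁₂, ℓ₁₃, ℓ₁₄, ℓ₂₃, ℓ₂₄, ℓ₃₄)`. -/

/-- Structure matrix of the Lie–Poisson bracket of the angular momenta. -/
def liePoissonMatrix (L : Fin 6 → ℝ) : Matrix (Fin 6) (Fin 6) ℝ :=
  let l12 := L 0
  let l13 := L 1
  let l14 := L 2
  let l23 := L 3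
  let l24 := L 4
  let l34 := L 5
  !![0, l23, l24, -l13, -l14, 0;
     -l23, 0, l34, l12, 0, -l14;
     -l24, -l34, 0, 0, l12, l13;
     l13, -l12, 0, 0, l34, -l24;
     l14, 0, -l12, -l34, 0, l23;
     0, l14, -l13, l24, -l23, 0]

/-- The reduced phase space `S² × S²` at energy `h`. The two spheres are
`(ℓ₁₂ ± ℓ₃₄)² + (ℓ₁₃ ∓ ℓ₂₄)² + (ℓ₁₄ ± ℓ₂₃)² = 2h`. -/
def reducedSpace (h : ℝ) : Set (Fin 6 → ℝ) :=
  {L | (L 0 + L 5) ^ 2 + (L 1 - L 4) ^ 2 + (L 2 + L 3) ^ 2 = 2 * h ∧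
    (L 0 - L 5) ^ 2 + (L 1 + L 4) ^ 2 + (L 2 - L 3) ^ 2 = 2 * h}

/-- The reduced prolate system `(ℓ₂₃, G)`. -/
noncomputable def reducedProlateMap (b : ℝ) (L : Fin 6 → ℝ) : Fin 2 → ℝ :=
  ![L 3, b * L 0 ^ 2 + b * L 1 ^ 2 + L 2 ^ 2]

/-! ### The actions -/

/-- The common numerator `-2 h s² + (g + 2 h + (b - 1) l²) s - g` of the squares of the separated
momenta has the roots `r₁ ≤ r₂`; this is `r₁`. -/
noncomputable def prolateRoot₁ (b h l g : ℝ) : ℝ :=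
  ((g + 2 * h + (b - 1) * l ^ 2)
    - √((g + 2 * h + (b - 1) * l ^ 2) ^ 2 - 8 * h * g)) / (4 * h)

/-- The larger root `r₂`. -/
noncomputable def prolateRoot₂ (b h l g : ℝ) : ℝ :=
  ((g + 2 * h + (b - 1) * l ^ 2)
    + √((g + 2 * h + (b - 1) * l ^ 2) ^ 2 - 8 * h * g)) / (4 * h)

/-- The separated momentum `p(s)`, for `s = s₁` and for `s = s₃`. -/
noncomputable def prolateMomentum (b h l g s : ℝ) : ℝ :=
  √((-2 * h * s ^ 2 + (g + 2 * h + (b - 1) * l ^ 2) * s - g) /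
    (4 * s * (s - b) * (s - 1) ^ 2))

/-- `J₁ = (2/π) ∫₀^{min(r₁, 1)} p(s) ds`. -/
noncomputable def prolateJ₁ (b h l g : ℝ) : ℝ :=
  2 / Real.pi * ∫ s in (0 : ℝ)..(min (prolateRoot₁ b h l g) 1), prolateMomentum b h l g s

/-- `J₃ = (2/π) ∫_{max(1, r₂)}^b p(s) ds`. -/
noncomputable def prolateJ₃ (b h l g : ℝ) : ℝ :=
  2 / Real.pi * ∫ s in (max 1 (prolateRoot₂ b h l g))..b, prolateMomentum b h l g s

/-- The actions `(J₁, J₂ = ℓ₂₃, J₃)` as functions of the value `(h, l, g)` of `(H, ℓ₂₃, G)`. -/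
noncomputable def prolateActions (b : ℝ) (c : Fin 3 → ℝ) : Fin 3 → ℝ :=
  ![prolateJ₁ b (c 0) (c 1) (c 2), c 1, prolateJ₃ b (c 0) (c 1) (c 2)]

/-- The actions `(J₁, ℓ₂₃)` of the reduced system at energy `h` as functions of the value
`(l, g)` of `(ℓ₂₃, G)`. -/
noncomputable def reducedProlateActions (b h : ℝ) (c : Fin 2 → ℝ) : Fin 2 → ℝ :=
  ![prolateJ₁ b h (c 0) (c 1), c 0]

/-! ### Loops around the critical value `(l, g) = (0, 2h)` -/

/-- A closed curve in `(h, l, g)`-space that winds once, clockwise in the `(l, g)`-plane, around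
the line `(l, g) = (0, 2h)`. -/
def IsClockwiseLoop (γ : ℝ → Fin 3 → ℝ) : Prop :=
  ∃ h r θ : ℝ → ℝ, ContinuousOn h (Icc 0 1) ∧ ContinuousOn r (Icc 0 1) ∧
    ContinuousOn θ (Icc 0 1) ∧
    (∀ t ∈ Icc (0 : ℝ) 1, 0 < r t ∧
      γ t = ![h t, r t * Real.cos (θ t), 2 * h t + r t * Real.sin (θ t)]) ∧
    h 1 = h 0 ∧ r 1 = r 0 ∧ θ 1 = θ 0 - 2 * Real.pi

/-- A closed curve in the `(l, g)`-plane that winds once clockwise around `(0, 2h)`. -/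
def IsReducedClockwiseLoop (h : ℝ) (γ : ℝ → Fin 2 → ℝ) : Prop :=
  ∃ r θ : ℝ → ℝ, ContinuousOn r (Icc 0 1) ∧ ContinuousOn θ (Icc 0 1) ∧
    (∀ t ∈ Icc (0 : ℝ) 1, 0 < r t ∧
      γ t = ![r t * Real.cos (θ t), 2 * h + r t * Real.sin (θ t)]) ∧
    r 1 = r 0 ∧ θ 1 = θ 0 - 2 * Real.pi

/-! ### Ordinary differential equations -/

section ODEs

/-! The period lattice is computed explicitly, the differentials of the actions are recognized as a
basis of it, and the monodromy is read off from one identity between J₁ and J₃.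

Lattice. Put u = ℓ₁₄, w = ℓ₁₂ℓ₂₄ + ℓ₁₃ℓ₃₄ and k = b(2h - l²) - g. Along the flow of any combination
of the integrals, the separation variable s = bu²/(k + u²) oscillates in [0, r₁]. It equals r₁ sin²
Φ for an angle Φ that moves with speed `phaseSpeed` times the coefficient of G, and Φ modulo 2π
determines (u, w) and is determined by it (`exists_orbit_angle`). The rest of the orbit is carried
by complex scalars that satisfy z' = (α + iβ)z with β a function of Φ: ℓ₂₄ + iℓ₃₄ (or ℓ₁₂ + iℓ₁₃
where the former may vanish) for the reduced motion, and x₄ + iy₄/√(2h) for the lift to T*S³. An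
orbit closes after unit time exactly when Φ and these phases advance by multiples of 2π. The phase
advances are integrals over the cycle of Φ that depend only on the value of the fibration, which
gives the lattice (`reduced_return_iff`, `prolate_return_iff`).

Actions. With s = r₁ sin² θ the integral J₁ runs over a fixed interval and is smooth wherever r₁ <
1. Up to an exact term its derivative is the integrand of the periods, so 2π dJ₁ is the lattice
vector belonging to one turn of Φ (`fderiv_prolateJ₁`). In the same way J₃ is smooth wherever r₂ >
1. Thus J₁ is smooth across the ray l = 0, g < 2h and J₃ across the ray l = 0, g > 2h.

Gluing. For l ≠ 0, J₁ + J₃ = √(2h) - |l| (`prolateJ₁_add_prolateJ₃`), the right side coming from the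
residues of p ds at infinity and at s = 1. Hence J₁ = √(2h) - J₃ + l for l < 0. The right side is
smooth across l = 0, g > 2h and equals J₁ + 2l for l > 0. A clockwise turn therefore sends J₁ to J₁
+ 2l, and the third action √(2h) - ql - J₁, with q constant along the loop, loses 2l.

Rigidity. Two systems of action variables differ locally by an affine map with integer linear part,
and such a relation persists along the curve (`IsActionContinuation.affine_relation`). So one
continuation determines all others, and single-valued action variables would force the monodromy
matrix to be the identity. -/

theorem exists_integralCurve_of_lipschitz_of_bounded {E : Type*} [NormedAddCommGroup E]
    [NormedSpace ℝ E] [CompleteSpace E] {X : E → E} {K C : NNReal} (hX : LipschitzWith K X)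
    (hC : ∀ z, ‖X z‖ ≤ C) (z₀ : E) :
    ∃ γ : ℝ → E, γ 0 = z₀ ∧ ∀ t, HasDerivAt γ (X (γ t)) t := by
  have key : ∀ n : ℕ, ∃ α : ℝ → E, α 0 = z₀ ∧ ∀ t ∈ Icc (-(n + 1 : ℝ)) (n + 1),
      HasDerivWithinAt α (X (α t)) (Icc (-(n + 1 : ℝ)) (n + 1)) t := by
    intro n
    have h0 : (0 : ℝ) ∈ Icc (-(n + 1 : ℝ)) (n + 1) := by constructor <;> linarith [n.cast_nonneg (α := ℝ)]
    -- The radius C(n + 1) is the distance that a field bounded by C can cover in time n + 1, so the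
    -- solution never leaves the ball.
    have hP : IsPicardLindelof (fun _ => X) ⟨0, h0⟩ z₀ (C * (n + 1)) 0 C K :=
      ⟨fun _ _ => hX.lipschitzOnWith, fun _ _ => continuousOn_const, fun _ _ x _ => hC x, by simp⟩
    exact hP.exists_eq_forall_mem_Icc_hasDerivWithinAt₀
  choose α hα0 hα using key
  have hmono : ∀ m n : ℕ, n ≤ m → EqOn (α m) (α n) (Icc (-(n + 1 : ℝ)) (n + 1)) := by
    intro m n hmn
    have hmn' : (n : ℝ) ≤ m := by exact_mod_cast hmn
    have hn := n.cast_nonneg (α := ℝ)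
    have hd : ∀ k : ℕ, n ≤ k → ∀ t ∈ Ioo (-(n + 1 : ℝ)) (n + 1),
        HasDerivAt (α k) (X (α k t)) t := by
      intro k hk t ht
      have hk' : (n : ℝ) ≤ k := by exact_mod_cast hk
      exact (hα k t ⟨by linarith [ht.1], by linarith [ht.2]⟩).hasDerivAt
        (Icc_mem_nhds (by linarith [ht.1]) (by linarith [ht.2]))
    have hc : ∀ k : ℕ, n ≤ k → ContinuousOn (α k) (Icc (-(n + 1 : ℝ)) (n + 1)) := by
      intro k hk t ht
      have hk' : (n : ℝ) ≤ k := by exact_mod_cast hk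
      exact ((hα k t ⟨by linarith [ht.1], by linarith [ht.2]⟩).continuousWithinAt).mono
        (Icc_subset_Icc (by linarith) (by linarith))
    exact ODE_solution_unique_of_mem_Icc (v := fun _ => X) (s := fun _ => univ) (K := K) (t₀ := 0)
      (fun _ _ => hX.lipschitzOnWith) ⟨by linarith, by linarith⟩ (hc m hmn) (hd m hmn)
      (fun _ _ => trivial) (hc n le_rfl) (hd n le_rfl) (fun _ _ => trivial)
      ((hα0 m).trans (hα0 n).symm)
  have hγ : ∀ (n : ℕ) (t : ℝ), |t| < n + 1 → α ⌈|t|⌉₊ t = α n t := by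
    intro n t ht
    have h1 : |t| ≤ ⌈|t|⌉₊ := Nat.le_ceil _
    rcases le_total n ⌈|t|⌉₊ with h | h
    · exact hmono _ _ h ⟨by linarith [neg_abs_le t], by linarith [le_abs_self t]⟩
    · exact (hmono _ _ h ⟨by linarith [neg_abs_le t], by linarith [le_abs_self t]⟩).symm
  -- The solution with index ⌈|t|⌉ lives on an interval that exceeds |t| by at least one, so t is an
  -- interior point and the glued curve agrees with one solution near t.
  refine ⟨fun t => α ⌈|t|⌉₊ t, by simpa using hα0 0, fun t => ?_⟩
  have h1 : |t| < (⌈|t|⌉₊ : ℝ) + 1 := (Nat.le_ceil _).trans_lt (lt_add_one _)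
  have hev : (fun t => α ⌈|t|⌉₊ t) =ᶠ[𝓝 t] α ⌈|t|⌉₊ := by
    filter_upwards [continuous_abs.continuousAt.eventually_lt_const h1] with s hs
    exact hγ _ s hs
  refine HasDerivAt.congr_of_eventuallyEq ?_ hev
  exact (hα _ t ⟨by linarith [neg_abs_le t], by linarith [le_abs_self t]⟩).hasDerivAt
    (Icc_mem_nhds (by linarith [neg_abs_le t]) (by linarith [le_abs_self t]))

theorem norm_le_one_add_sum_sq {ι : Type*} [Fintype ι] (z : ι → ℝ) :
    ‖z‖ ≤ 1 + ∑ i, z i ^ 2 := by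
  have hs : 0 ≤ ∑ i, z i ^ 2 := Finset.sum_nonneg fun i _ => sq_nonneg _
  refine (pi_norm_le_iff_of_nonneg (by linarith)).2 fun i => ?_
  have h1 : z i ^ 2 ≤ ∑ i, z i ^ 2 :=
    Finset.single_le_sum (f := fun i => z i ^ 2) (fun i _ => sq_nonneg _) (Finset.mem_univ i)
  rw [Real.norm_eq_abs, abs_le]
  constructor <;> nlinarith [sq_nonneg (z i - 1), sq_nonneg (z i + 1)]

/-- A `C¹` vector field on `ℝ^ι` that is tangent to all spheres around the origin is complete. -/
theorem exists_integralCurve_of_tangent_spheres {ι : Type*} [Fintype ι] {X : (ι → ℝ) → ι → ℝ}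
    (hX : ContDiff ℝ 1 X) (ht : ∀ z, ∑ i, z i * X z i = 0) (z₀ : ι → ℝ) :
    ∃ γ : ℝ → ι → ℝ, γ 0 = z₀ ∧ ∀ t, HasDerivAt γ (X (γ t)) t := by
  set R : ℝ := 1 + ∑ i, z₀ i ^ 2 with hR
  have hs : 0 ≤ ∑ i, z₀ i ^ 2 := Finset.sum_nonneg fun i _ => sq_nonneg _
  -- The sphere through z₀ lies in the sup-norm ball of radius R, on which χ = 1. The cut-off field
  -- is globally Lipschitz, bounded and still tangent to all spheres, so its integral curve stays on
  -- that sphere and never meets the cut-off.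
  let χ : ContDiffBump (0 : ι → ℝ) := ⟨R, R + 1, by linarith, by linarith⟩
  have hY : ContDiff ℝ 1 fun z => χ z • X z := χ.contDiff.smul hX
  have hsupp : HasCompactSupport fun z => χ z • X z := χ.hasCompactSupport.smul_right
  obtain ⟨K, hK⟩ := ContDiff.lipschitzWith_of_hasCompactSupport hsupp hY one_ne_zero
  obtain ⟨C, hC⟩ := hsupp.exists_bound_of_continuous hY.continuous
  obtain ⟨γ, h0, hγ⟩ := exists_integralCurve_of_lipschitz_of_bounded (C := C.toNNReal) hK
    (fun z => (hC z).trans (Real.le_coe_toNNReal C)) z₀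
  refine ⟨γ, h0, fun t => ?_⟩
  have hcons : ∀ t, ∑ i, γ t i ^ 2 = ∑ i, z₀ i ^ 2 := by
    have hd : ∀ t, HasDerivAt (fun t => ∑ i, γ t i ^ 2) 0 t := by
      intro t
      have h2 : HasDerivAt (fun t => ∑ i, γ t i ^ 2)
          (∑ i, (2 : ℕ) * γ t i ^ (2 - 1) * (χ (γ t) • X (γ t)) i) t :=
        HasDerivAt.fun_sum fun i _ => (hasDerivAt_pi.1 (hγ t) i).pow 2
      convert! h2 using 1
      have : ∑ i, ((2 : ℕ) : ℝ) * γ t i ^ (2 - 1) * (χ (γ t) • X (γ t)) i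
          = 2 * χ (γ t) * ∑ i, γ t i * X (γ t) i := by
        rw [Finset.mul_sum]
        refine Finset.sum_congr rfl fun i _ => ?_
        simp; ring
      rw [this, ht, mul_zero]
    intro t
    rw [← h0]
    exact is_const_of_deriv_eq_zero (fun t => (hd t).differentiableAt) (fun t => (hd t).deriv) t 0
  have hmem : γ t ∈ Metric.closedBall (0 : ι → ℝ) R := by
    rw [mem_closedBall_zero_iff]
    refine (norm_le_one_add_sum_sq (γ t)).trans ?_
    rw [hcons]
  have h1 : χ (γ t) = 1 := χ.one_of_mem_closedBall hmem
  simpa [h1] using hγ t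

/-- The solution of a scalar complex linear equation. -/
theorem eq_mul_exp_of_hasDerivAt {z : ℝ → ℂ} {α β : ℝ → ℝ} (hα : Continuous α) {B : ℝ → ℝ}
    (hB : ∀ t, HasDerivAt B (β t) t)
    (hz : ∀ t, HasDerivAt z ((α t + Complex.I * β t) * z t) t) (t : ℝ) :
    z t = z 0 * (Real.exp (∫ s in (0 : ℝ)..t, α s) : ℝ) *
      Complex.exp (Complex.I * (B t - B 0 : ℝ)) := by
  have hA : ∀ t, HasDerivAt (fun t => ∫ s in (0 : ℝ)..t, α s) (α t) t := fun t =>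
    intervalIntegral.integral_hasDerivAt_right (hα.intervalIntegrable _ _)
      (hα.stronglyMeasurableAtFilter _ _) hα.continuousAt
  have hd : ∀ t, HasDerivAt (fun t => z t * Complex.exp (-((∫ s in (0 : ℝ)..t, α s : ℝ)
      + Complex.I * (B t - B 0 : ℝ)))) 0 t := by
    intro t
    have h1 := ((hA t).ofReal_comp.add
      ((((hB t).sub_const (B 0)).ofReal_comp).const_mul Complex.I)).neg.cexp
    convert! (hz t).mul h1 using 1
    simp only [Pi.neg_apply, Pi.add_apply]
    ring
  have hconst := is_const_of_deriv_eq_zero (fun t => (hd t).differentiableAt)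
    (fun t => (hd t).deriv) t 0
  simp only [intervalIntegral.integral_same, Complex.ofReal_zero, sub_self, mul_zero, add_zero,
    neg_zero, Complex.exp_zero, mul_one] at hconst
  rw [← hconst, Complex.ofReal_exp, mul_assoc, mul_assoc, ← Complex.exp_add, ← Complex.exp_add]
  simp

end ODEs

/-! ### Integrals depending smoothly on a parameter -/

section ParametricIntegrals

variable {E G : Type} [NormedAddCommGroup E] [NormedSpace ℝ E]
  [NormedAddCommGroup G] [NormedSpace ℝ G]

theorem hasFDerivAt_intervalIntegral_of_contDiffOn {F : E × ℝ → G} {U : Set E}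
    (hU : IsOpen U) (hF : ContDiffOn ℝ 1 F (U ×ˢ univ)) (a b : ℝ) {c : E} (hc : c ∈ U) :
    HasFDerivAt (fun c => ∫ θ in a..b, F (c, θ))
      (∫ θ in a..b, (fderiv ℝ F (c, θ)).comp (ContinuousLinearMap.inl ℝ E ℝ)) c := by
  have hO : IsOpen (U ×ˢ (univ : Set ℝ)) := hU.prod isOpen_univ
  have hFd : ∀ c ∈ U, ∀ θ, HasFDerivAt F (fderiv ℝ F (c, θ)) (c, θ) := fun c hc θ =>
    ((hF.contDiffAt (hO.mem_nhds ⟨hc, trivial⟩)).differentiableAt one_ne_zero).hasFDerivAt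
  have hcont : ContinuousOn (fun p : E × ℝ => (fderiv ℝ F p).comp (ContinuousLinearMap.inl ℝ E ℝ))
      (U ×ˢ univ) :=
    (hF.continuousOn_fderiv_of_isOpen hO le_rfl).clm_comp continuousOn_const
  have hsec : ∀ c ∈ U, Continuous fun θ : ℝ =>
      (fderiv ℝ F (c, θ)).comp (ContinuousLinearMap.inl ℝ E ℝ) := fun c hc =>
    hcont.comp_continuous (by fun_prop) fun θ => ⟨hc, trivial⟩
  have hsec' : ∀ c ∈ U, Continuous fun θ : ℝ => F (c, θ) := fun c hc =>
    hF.continuousOn.comp_continuous (by fun_prop) fun θ => ⟨hc, trivial⟩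
  -- a neighbourhood of `c` on which the derivative is bounded
  obtain ⟨C, hC⟩ := (isCompact_uIcc (a := a) (b := b)).exists_bound_of_continuousOn
    (hsec c hc).continuousOn
  have hnear : ∀ᶠ x in 𝓝 c, ∀ θ ∈ uIcc a b,
      ‖(fderiv ℝ F (x, θ)).comp (ContinuousLinearMap.inl ℝ E ℝ)‖ < C + 1 := by
    refine (isCompact_uIcc (a := a) (b := b)).eventually_forall_of_forall_eventually fun θ hθ => ?_
    have h1 : ContinuousAt (fun p : E × ℝ => ‖(fderiv ℝ F p).comp (ContinuousLinearMap.inl ℝ E ℝ)‖)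
        (c, θ) := (hcont.continuousAt (hO.mem_nhds ⟨hc, trivial⟩)).norm
    exact h1.eventually_lt_const ((hC θ hθ).trans_lt (lt_add_one C))
  have hs := hnear.and (hU.mem_nhds hc)
  refine intervalIntegral.hasFDerivAt_integral_of_dominated_of_fderiv_le (𝕜 := ℝ)
    (F := fun c θ => F (c, θ))
    (F' := fun c θ => (fderiv ℝ F (c, θ)).comp (ContinuousLinearMap.inl ℝ E ℝ))
    (bound := fun _ => C + 1) hs ?_ ((hsec' c hc).intervalIntegrable _ _)
    ((hsec c hc).aestronglyMeasurable) ?_ intervalIntegrable_const ?_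
  · filter_upwards [hU.mem_nhds hc] with x hx using (hsec' x hx).aestronglyMeasurable
  · exact Eventually.of_forall fun θ hθ x hx => (hx.1 θ (uIoc_subset_uIcc hθ)).le
  · refine Eventually.of_forall fun θ _ x hx => ?_
    exact (hFd x hx.2 θ).comp x (hasFDerivAt_prodMk_left x θ)

/-- The codomain is quantified inside the induction because the derivative of the integral is again
such an integral, with values in the continuous linear maps from E to G. -/
theorem contDiffOn_intervalIntegral_nat {E : Type} [NormedAddCommGroup E] [NormedSpace ℝ E]
    {U : Set E} (hU : IsOpen U) (a b : ℝ) (n : ℕ) :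
    ∀ {G : Type} [NormedAddCommGroup G] [NormedSpace ℝ G] {F : E × ℝ → G},
      ContDiffOn ℝ ∞ F (U ×ˢ univ) → ContDiffOn ℝ n (fun c => ∫ θ in a..b, F (c, θ)) U := by
  have hO : IsOpen (U ×ˢ (univ : Set ℝ)) := hU.prod isOpen_univ
  induction n with
  | zero =>
    intro G _ _ F hF
    refine contDiffOn_zero.2 fun c hc => ?_
    exact (hasFDerivAt_intervalIntegral_of_contDiffOn hU (hF.of_le (by simp)) a b
      hc).continuousAt.continuousWithinAt
  | succ n ih =>
    intro G _ _ F hF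
    have hd := fun c hc => hasFDerivAt_intervalIntegral_of_contDiffOn hU
      (hF.of_le (by simp)) a b (c := c) hc
    push_cast
    refine (contDiffOn_succ_iff_fderiv_of_isOpen hU).2
      ⟨fun c hc => (hd c hc).differentiableAt.differentiableWithinAt, by simp, ?_⟩
    refine ContDiffOn.congr (ih (F := fun p =>
      (fderiv ℝ F p).comp (ContinuousLinearMap.inl ℝ E ℝ)) ?_) fun c hc => (hd c hc).fderiv
    exact (hF.fderiv_of_isOpen hO (by simp)).clm_comp contDiffOn_const

theorem contDiffOn_intervalIntegral {F : E × ℝ → G} {U : Set E}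
    (hU : IsOpen U) (hF : ContDiffOn ℝ ∞ F (U ×ˢ univ)) (a b : ℝ) :
    ContDiffOn ℝ ∞ (fun c => ∫ θ in a..b, F (c, θ)) U :=
  contDiffOn_infty.2 fun n => contDiffOn_intervalIntegral_nat hU a b n hF

/-- The derivative of a parametric integral in the direction `e`, given the directional
derivatives of the integrand. -/
theorem fderiv_intervalIntegral_apply {F : E × ℝ → ℝ} {U : Set E}
    (hU : IsOpen U) (hF : ContDiffOn ℝ ∞ F (U ×ˢ univ)) (a b : ℝ) {c : E} (hc : c ∈ U) (e : E)
    {F' : ℝ → ℝ} (hF' : ∀ θ, HasDerivAt (fun t : ℝ => F (c + t • e, θ)) (F' θ) 0) :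
    fderiv ℝ (fun c => ∫ θ in a..b, F (c, θ)) c e = ∫ θ in a..b, F' θ := by
  have hO : IsOpen (U ×ˢ (univ : Set ℝ)) := hU.prod isOpen_univ
  have hF1 : ContDiffOn ℝ 1 F (U ×ˢ univ) := hF.of_le (by simp)
  rw [(hasFDerivAt_intervalIntegral_of_contDiffOn hU hF1 a b hc).fderiv]
  have hcont : Continuous fun θ : ℝ => (fderiv ℝ F (c, θ)).comp (ContinuousLinearMap.inl ℝ E ℝ) :=
    ((hF1.continuousOn_fderiv_of_isOpen hO le_rfl).comp_continuous (by fun_prop)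
      fun θ => ⟨hc, trivial⟩).clm_comp continuous_const
  rw [ContinuousLinearMap.intervalIntegral_apply (hcont.intervalIntegrable _ _)]
  refine intervalIntegral.integral_congr fun θ _ => ?_
  have h1 : HasFDerivAt F (fderiv ℝ F (c, θ)) (c + (0 : ℝ) • e, θ) := by
    simpa using ((hF1.contDiffAt (hO.mem_nhds (show (c, θ) ∈ _ from ⟨hc, trivial⟩))).differentiableAt
      one_ne_zero).hasFDerivAt
  have h2 : HasDerivAt (fun t : ℝ => (c + t • e, θ)) ((1 : ℝ) • e, (0 : ℝ)) 0 :=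
    (((hasDerivAt_id (0 : ℝ)).smul_const e).const_add c).prodMk (hasDerivAt_const _ _)
  simpa using (h1.comp_hasDerivAt (0 : ℝ) h2).unique (hF' θ)

end ParametricIntegrals

/-! ### The Hamiltonian vector fields -/

section HamiltonianFields

/-- The Hamiltonian vector field of `T₀ ℓ₂₃ + T₁ G` for the Lie–Poisson bracket. -/
def reducedField (b : ℝ) (T : Fin 2 → ℝ) (L : Fin 6 → ℝ) : Fin 6 → ℝ :=
  ![2 * b * T 1 * L 3 * L 1 + 2 * T 1 * L 4 * L 2 - T 0 * L 1,
    -(2 * b * T 1 * L 3 * L 0) + 2 * T 1 * L 5 * L 2 + T 0 * L 0,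
    -(2 * b * T 1 * (L 4 * L 0 + L 5 * L 1)),
    0,
    2 * (b - 1) * T 1 * L 2 * L 0 - T 0 * L 5,
    2 * (b - 1) * T 1 * L 2 * L 1 + T 0 * L 4]

theorem hamVF_reducedProlate (b : ℝ) (T : Fin 2 → ℝ) (L : Fin 6 → ℝ) :
    hamVF liePoissonMatrix (fun w => ∑ k, T k * reducedProlateMap b w k) L
      = reducedField b T L := by
  have hx : ∀ i, HasFDerivAt (fun w : Fin 6 → ℝ => w i)
      (ContinuousLinearMap.proj (R := ℝ) (φ := fun _ : Fin 6 => ℝ) i) L :=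
    fun i => hasFDerivAt_apply i L
  have h := ((hx 3).const_mul (T 0)).add
      ((((((hx 0).pow 2).const_mul b).add (((hx 1).pow 2).const_mul b)).add ((hx 2).pow 2)).const_mul
        (T 1))
  have hf := h.congr_of_eventuallyEq (f₁ := fun w => ∑ k, T k * reducedProlateMap b w k)
    (Eventually.of_forall fun w => by simp [reducedProlateMap, Fin.sum_univ_two])
  have hg : (fun i => fderiv ℝ (fun w => ∑ k, T k * reducedProlateMap b w k) L (Pi.single i 1))
      = ![2 * b * T 1 * L 0, 2 * b * T 1 * L 1, 2 * T 1 * L 2, T 0, 0, 0] := by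
    rw [hf.fderiv]
    funext i
    fin_cases i <;> simp <;> ring
  rw [hamVF, hg]
  funext i
  fin_cases i <;>
    simp [liePoissonMatrix, reducedField, Matrix.mulVec, dotProduct, Fin.sum_univ_succ] <;> ring

/-- The Hamiltonian vector field of `T₀ H + T₁ ℓ₂₃ + T₂ G` on `T*S³`, extended polynomially:
`H` is replaced by `(|x|²|y|² - (x · y)²) / 2`. -/
def prolateField (b : ℝ) (T : Fin 3 → ℝ) (z : Fin 4 ⊕ Fin 4 → ℝ) : Fin 4 ⊕ Fin 4 → ℝ :=
  let x : Fin 4 → ℝ := fun i => z (Sum.inl i)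
  let y : Fin 4 → ℝ := fun i => z (Sum.inr i)
  let Ω : (Fin 4 → ℝ) → Fin 4 → ℝ := fun v =>
    ![-(2 * T 2 * (b * angMom z 0 1 * v 1 + b * angMom z 0 2 * v 2 + angMom z 0 3 * v 3)),
      2 * T 2 * b * angMom z 0 1 * v 0 - T 1 * v 2,
      2 * T 2 * b * angMom z 0 2 * v 0 + T 1 * v 1,
      2 * T 2 * angMom z 0 3 * v 0]
  Sum.elim (fun i => T 0 * (y i * ∑ j, x j ^ 2 - x i * ∑ j, x j * y j) + Ω x i)
    (fun i => T 0 * (y i * ∑ j, x j * y j - x i * ∑ j, y j ^ 2) + Ω y i)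

theorem hasFDerivAt_angMom (z : Fin 4 ⊕ Fin 4 → ℝ) (i j : Fin 4) :
    HasFDerivAt (fun w => angMom w i j)
      (z (Sum.inl i) • ContinuousLinearMap.proj (R := ℝ) (φ := fun _ : Fin 4 ⊕ Fin 4 => ℝ) (Sum.inr j)
        + z (Sum.inr j) • ContinuousLinearMap.proj (R := ℝ) (φ := fun _ : Fin 4 ⊕ Fin 4 => ℝ) (Sum.inl i)
        - (z (Sum.inl j) • ContinuousLinearMap.proj (R := ℝ) (φ := fun _ : Fin 4 ⊕ Fin 4 => ℝ) (Sum.inr i)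
        + z (Sum.inr i) • ContinuousLinearMap.proj (R := ℝ) (φ := fun _ : Fin 4 ⊕ Fin 4 => ℝ) (Sum.inl j)))
      z := by
  have hx : ∀ i, HasFDerivAt (fun w : Fin 4 ⊕ Fin 4 → ℝ => w i)
      (ContinuousLinearMap.proj (R := ℝ) (φ := fun _ : Fin 4 ⊕ Fin 4 => ℝ) i) z :=
    fun i => hasFDerivAt_apply i z
  exact ((hx _).mul (hx _)).sub ((hx _).mul (hx _))

theorem hamVF_prolate (b : ℝ) (T : Fin 3 → ℝ) {z : Fin 4 ⊕ Fin 4 → ℝ} (hz : z ∈ cotangentS3) :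
    hamVF diracMatrix (fun w => ∑ k, T k * prolateMap b w k) z = prolateField b T z := by
  obtain ⟨h1, h2⟩ := hz
  have hx : ∀ i, HasFDerivAt (fun w : Fin 4 ⊕ Fin 4 → ℝ => w i)
      (ContinuousLinearMap.proj (R := ℝ) (φ := fun _ : Fin 4 ⊕ Fin 4 => ℝ) i) z :=
    fun i => hasFDerivAt_apply i z
  have h := ((((hx (Sum.inr 0)).pow 2).add (((hx (Sum.inr 1)).pow 2).add
      (((hx (Sum.inr 2)).pow 2).add ((hx (Sum.inr 3)).pow 2)))).const_mul (T 0 / 2)).add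
      (((hasFDerivAt_angMom z 1 2).const_mul (T 1)).add
      ((((((hasFDerivAt_angMom z 0 1).pow 2).const_mul b).add
        (((hasFDerivAt_angMom z 0 2).pow 2).const_mul b)).add
        ((hasFDerivAt_angMom z 0 3).pow 2)).const_mul (T 2)))
  have hf := h.congr_of_eventuallyEq (f₁ := fun w => ∑ k, T k * prolateMap b w k)
    (Eventually.of_forall fun w => by simp [prolateMap, Fin.sum_univ_succ]; ring)
  have hg : (fun i => fderiv ℝ (fun w => ∑ k, T k * prolateMap b w k) z (Pi.single i 1))
      = Sum.elim
        ![2 * T 2 * (b * angMom z 0 1 * z (Sum.inr 1) + b * angMom z 0 2 * z (Sum.inr 2)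
            + angMom z 0 3 * z (Sum.inr 3)),
          -(2 * T 2 * b * angMom z 0 1 * z (Sum.inr 0)) + T 1 * z (Sum.inr 2),
          -(2 * T 2 * b * angMom z 0 2 * z (Sum.inr 0)) - T 1 * z (Sum.inr 1),
          -(2 * T 2 * angMom z 0 3 * z (Sum.inr 0))]
        ![T 0 * z (Sum.inr 0) - 2 * T 2 * (b * angMom z 0 1 * z (Sum.inl 1)
            + b * angMom z 0 2 * z (Sum.inl 2) + angMom z 0 3 * z (Sum.inl 3)),
          T 0 * z (Sum.inr 1) + 2 * T 2 * b * angMom z 0 1 * z (Sum.inl 0) - T 1 * z (Sum.inl 2),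
          T 0 * z (Sum.inr 2) + 2 * T 2 * b * angMom z 0 2 * z (Sum.inl 0) + T 1 * z (Sum.inl 1),
          T 0 * z (Sum.inr 3) + 2 * T 2 * angMom z 0 3 * z (Sum.inl 0)] := by
    rw [hf.fderiv]
    funext i
    rcases i with i | i <;> fin_cases i <;> simp <;> ring
  rw [hamVF, hg, diracMatrix]
  simp only [h1, inv_one, one_smul]
  simp only [Fin.sum_univ_four] at h1 h2
  funext i
  rcases i with i | i
  · fin_cases i <;>
      simp [prolateField, Matrix.mulVec, dotProduct, Fin.sum_univ_four, Matrix.vecMulVec_apply,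
        Matrix.one_apply, angMom]
    · linear_combination (-(T 0 * z (Sum.inr 0))) * h1
    · linear_combination (-(T 0 * z (Sum.inr 1))) * h1
    · linear_combination (-(T 0 * z (Sum.inr 2))) * h1
    · linear_combination (-(T 0 * z (Sum.inr 3))) * h1
  · fin_cases i <;>
      simp [prolateField, Matrix.mulVec, dotProduct, Fin.sum_univ_four, Matrix.vecMulVec_apply,
        Matrix.one_apply, angMom] <;> ring

end HamiltonianFields

/-! ### Conserved quantities and existence of the flows -/

section Flows

theorem eq_of_hasDerivAt_zero {E : Type*} [NormedAddCommGroup E] [NormedSpace ℝ E] {f : ℝ → E}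
    (hf : ∀ t, HasDerivAt f 0 t) (s t : ℝ) : f s = f t :=
  is_const_of_deriv_eq_zero (fun t => (hf t).differentiableAt) (fun t => (hf t).deriv) s t

/-- The projection orthogonal to x annihilates x. This is needed off T*S³ as well, since the period
lattice speaks of integral curves in the ambient space that are not assumed to stay on the leaf. -/
theorem hamVF_dirac_tangent_sphere (f : (Fin 4 ⊕ Fin 4 → ℝ) → ℝ) (z : Fin 4 ⊕ Fin 4 → ℝ) :
    ∑ i, z (Sum.inl i) * hamVF diracMatrix f z (Sum.inl i) = 0 := by
  set v := fun i => fderiv ℝ f z (Pi.single i 1) with hv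
  -- The inverse of |x|² has a meaningless value at x = 0, but there every summand vanishes.
  by_cases hN : ∑ i, z (Sum.inl i) ^ 2 = 0
  · have hx : ∀ i, z (Sum.inl i) = 0 := fun i => by
      have := (Finset.sum_eq_zero_iff_of_nonneg (fun i _ => sq_nonneg (z (Sum.inl i)))).1 hN i
        (Finset.mem_univ i)
      exact pow_eq_zero_iff two_ne_zero |>.1 this
    simp [hx]
  · have h1 : (∑ i, z (Sum.inl i) ^ 2)⁻¹ * ∑ i, z (Sum.inl i) ^ 2 = 1 := inv_mul_cancel₀ hN
    simp only [hamVF, diracMatrix]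
    set n := (∑ i, z (Sum.inl i) ^ 2)⁻¹
    simp only [Fin.sum_univ_four] at h1
    simp [Matrix.mulVec, dotProduct, Fin.sum_univ_four, Matrix.vecMulVec_apply, Matrix.one_apply]
    simp only [hv] at *
    linear_combination (-(z (Sum.inl 0) * fderiv ℝ f z (Pi.single (Sum.inr 0) 1)
      + z (Sum.inl 1) * fderiv ℝ f z (Pi.single (Sum.inr 1) 1)
      + z (Sum.inl 2) * fderiv ℝ f z (Pi.single (Sum.inr 2) 1)
      + z (Sum.inl 3) * fderiv ℝ f z (Pi.single (Sum.inr 3) 1))) * h1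

theorem hamVF_dirac_tangent_orthogonal (f : (Fin 4 ⊕ Fin 4 → ℝ) → ℝ) {z : Fin 4 ⊕ Fin 4 → ℝ}
    (hz : ∑ i, z (Sum.inl i) ^ 2 = 1) :
    ∑ i, (hamVF diracMatrix f z (Sum.inl i) * z (Sum.inr i)
      + z (Sum.inl i) * hamVF diracMatrix f z (Sum.inr i)) = 0 := by
  simp only [hamVF, diracMatrix]
  simp only [hz, inv_one, one_smul]
  simp only [Fin.sum_univ_four] at hz
  simp [Matrix.mulVec, dotProduct, Fin.sum_univ_four, Matrix.vecMulVec_apply, Matrix.one_apply]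
  generalize fderiv ℝ f z (Pi.single (Sum.inr 0) 1) = v0
  generalize fderiv ℝ f z (Pi.single (Sum.inr 1) 1) = v1
  generalize fderiv ℝ f z (Pi.single (Sum.inr 2) 1) = v2
  generalize fderiv ℝ f z (Pi.single (Sum.inr 3) 1) = v3
  generalize fderiv ℝ f z (Pi.single (Sum.inl 0) 1) = p0
  generalize fderiv ℝ f z (Pi.single (Sum.inl 1) 1) = p1
  generalize fderiv ℝ f z (Pi.single (Sum.inl 2) 1) = p2
  generalize fderiv ℝ f z (Pi.single (Sum.inl 3) 1) = p3
  linear_combination (z (Sum.inl 0) * p0 + z (Sum.inl 1) * p1 + z (Sum.inl 2) * p2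
    + z (Sum.inl 3) * p3 - (z (Sum.inr 0) * v0 + z (Sum.inr 1) * v1 + z (Sum.inr 2) * v2
    + z (Sum.inr 3) * v3)) * hz

/-- The constraints are conserved one after the other: |x|² first, and with |x|² = 1 known along the
whole curve also x · y. -/
theorem mem_cotangentS3_of_tangent {γ X : ℝ → Fin 4 ⊕ Fin 4 → ℝ} (hγ : ∀ t, HasDerivAt γ (X t) t)
    (h0 : γ 0 ∈ cotangentS3) (h1 : ∀ t, ∑ i, γ t (Sum.inl i) * X t (Sum.inl i) = 0)
    (h2 : ∀ t, ∑ i, γ t (Sum.inl i) ^ 2 = 1 →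
      ∑ i, (X t (Sum.inl i) * γ t (Sum.inr i) + γ t (Sum.inl i) * X t (Sum.inr i)) = 0) (t : ℝ) :
    γ t ∈ cotangentS3 := by
  have hi : ∀ i t, HasDerivAt (fun t => γ t i) (X t i) t := fun i t => hasDerivAt_pi.1 (hγ t) i
  have hN : ∀ t, ∑ i, γ t (Sum.inl i) ^ 2 = 1 := by
    intro t
    rw [← h0.1]
    refine eq_of_hasDerivAt_zero (f := fun t => ∑ i, γ t (Sum.inl i) ^ 2) (fun t => ?_) t 0
    have := HasDerivAt.fun_sum (u := Finset.univ) fun i _ => (hi (Sum.inl i) t).pow 2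
    convert! this using 1
    have h := h1 t
    simp only [Fin.sum_univ_four] at h ⊢
    push_cast
    linear_combination -2 * h
  refine ⟨hN t, ?_⟩
  rw [← h0.2]
  refine eq_of_hasDerivAt_zero (f := fun t => ∑ i, γ t (Sum.inl i) * γ t (Sum.inr i))
    (fun t => ?_) t 0
  have := HasDerivAt.fun_sum (u := Finset.univ) fun i _ => (hi (Sum.inl i) t).mul (hi (Sum.inr i) t)
  rw [h2 t (hN t)] at this
  exact this

/-- These identities hold on all of ℝ⁸. The first and the last make the field tangent to the spheres
around the origin, which gives completeness; the first two keep T*S³ invariant. This is the purpose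
of the polynomial extension. -/
theorem prolateField_tangent (b : ℝ) (T : Fin 3 → ℝ) (z : Fin 4 ⊕ Fin 4 → ℝ) :
    ∑ i, z (Sum.inl i) * prolateField b T z (Sum.inl i) = 0 ∧
    ∑ i, (prolateField b T z (Sum.inl i) * z (Sum.inr i)
      + z (Sum.inl i) * prolateField b T z (Sum.inr i)) = 0 ∧
    ∑ i, z (Sum.inr i) * prolateField b T z (Sum.inr i) = 0 := by
  refine ⟨?_, ?_, ?_⟩ <;> simp [prolateField, Fin.sum_univ_four] <;> ring

theorem contDiff_prolateField (b : ℝ) (T : Fin 3 → ℝ) : ContDiff ℝ 1 (prolateField b T) := by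
  refine contDiff_pi.2 fun i => ?_
  rcases i with i | i <;> fin_cases i <;>
    simp [prolateField, Fin.sum_univ_four, angMom] <;> fun_prop

theorem exists_prolateFlow (b : ℝ) (T : Fin 3 → ℝ) {z : Fin 4 ⊕ Fin 4 → ℝ} (hz : z ∈ cotangentS3) :
    ∃ γ : ℝ → Fin 4 ⊕ Fin 4 → ℝ, γ 0 = z ∧ (∀ t, γ t ∈ cotangentS3) ∧
      ∀ t, HasDerivAt γ (prolateField b T (γ t)) t := by
  obtain ⟨γ, h0, hγ⟩ := exists_integralCurve_of_tangent_spheres (contDiff_prolateField b T)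
    (fun z => by
      rw [Fintype.sum_sum_type]
      rw [(prolateField_tangent b T z).1, (prolateField_tangent b T z).2.2, add_zero]) z
  exact ⟨γ, h0, mem_cotangentS3_of_tangent hγ (h0 ▸ hz) (fun t => (prolateField_tangent b T _).1)
    fun t _ => (prolateField_tangent b T _).2.1, hγ⟩

/-- The Dirac field and the polynomial field agree on T*S³ and both preserve it, so integral curves
starting there are the same for both. -/
theorem mem_periodLattice_prolate {b : ℝ} {T c : Fin 3 → ℝ} :
    T ∈ periodLattice diracMatrix cotangentS3 (prolateMap b) c ↔
      ∀ z ∈ cotangentS3, prolateMap b z = c → ∃ γ : ℝ → Fin 4 ⊕ Fin 4 → ℝ, γ 0 = z ∧ γ 1 = z ∧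
        (∀ t, γ t ∈ cotangentS3) ∧ ∀ t, HasDerivAt γ (prolateField b T (γ t)) t := by
  refine forall₃_congr fun z hz _ => exists_congr fun γ => ?_
  constructor
  · rintro ⟨h0, h1, hγ⟩
    have hmem : ∀ t, γ t ∈ cotangentS3 := mem_cotangentS3_of_tangent hγ (h0 ▸ hz)
      (fun t => hamVF_dirac_tangent_sphere _ _) fun t ht => hamVF_dirac_tangent_orthogonal _ ht
    exact ⟨h0, h1, hmem, fun t => hamVF_prolate b T (hmem t) ▸ hγ t⟩
  · rintro ⟨h0, h1, hmem, hγ⟩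
    exact ⟨h0, h1, fun t => (hamVF_prolate b T (hmem t)).symm ▸ hγ t⟩

theorem exists_reducedFlow (b : ℝ) (T : Fin 2 → ℝ) (L₀ : Fin 6 → ℝ) :
    ∃ γ : ℝ → Fin 6 → ℝ, γ 0 = L₀ ∧ ∀ t, HasDerivAt γ (reducedField b T (γ t)) t := by
  refine exists_integralCurve_of_tangent_spheres (contDiff_pi.2 fun i => ?_) (fun z => ?_) L₀
  · fin_cases i <;> simp [reducedField] <;> fun_prop
  · simp [reducedField, Fin.sum_univ_succ]; ring

theorem mem_periodLattice_reduced {b h : ℝ} {T c : Fin 2 → ℝ} :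
    T ∈ periodLattice liePoissonMatrix (reducedSpace h) (reducedProlateMap b) c ↔
      ∀ z ∈ reducedSpace h, reducedProlateMap b z = c → ∃ γ : ℝ → Fin 6 → ℝ, γ 0 = z ∧ γ 1 = z ∧
        ∀ t, HasDerivAt γ (reducedField b T (γ t)) t := by
  simp only [periodLattice, hamVF_reducedProlate, mem_ofPred_eq]

/-- The vector of angular momenta. -/
def angularMomenta (z : Fin 4 ⊕ Fin 4 → ℝ) : Fin 6 → ℝ :=
  ![angMom z 0 1, angMom z 0 2, angMom z 0 3, angMom z 1 2, angMom z 1 3, angMom z 2 3]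

/-- The coefficient of H drops out: the geodesic flow preserves every angular momentum. -/
theorem hasDerivAt_angularMomenta {b : ℝ} {T : Fin 3 → ℝ} {γ : ℝ → Fin 4 ⊕ Fin 4 → ℝ} {t : ℝ}
    (hγ : HasDerivAt γ (prolateField b T (γ t)) t) :
    HasDerivAt (fun t => angularMomenta (γ t))
      (reducedField b ![T 1, T 2] (angularMomenta (γ t))) t := by
  have hi : ∀ i, HasDerivAt (fun t => γ t i) (prolateField b T (γ t) i) t := hasDerivAt_pi.1 hγ
  have hm : ∀ i j, HasDerivAt (fun t => angMom (γ t) i j) _ t := fun i j =>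
    ((hi (Sum.inl i)).mul (hi (Sum.inr j))).sub ((hi (Sum.inl j)).mul (hi (Sum.inr i)))
  refine hasDerivAt_pi.2 fun i => ?_
  fin_cases i
  · convert! hm 0 1 using 1
    simp [reducedField, angularMomenta, prolateField, Fin.sum_univ_four, angMom]; ring
  · convert! hm 0 2 using 1
    simp [reducedField, angularMomenta, prolateField, Fin.sum_univ_four, angMom]; ring
  · convert! hm 0 3 using 1
    simp [reducedField, angularMomenta, prolateField, Fin.sum_univ_four, angMom]; ring
  · convert! hm 1 2 using 1
    simp [reducedField, angularMomenta, prolateField, Fin.sum_univ_four, angMom]; ring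
  · convert! hm 1 3 using 1
    simp [reducedField, angularMomenta, prolateField, Fin.sum_univ_four, angMom]; ring
  · convert! hm 2 3 using 1
    simp [reducedField, angularMomenta, prolateField, Fin.sum_univ_four, angMom]; ring

/-- Lagrange's identity for Σ ℓᵢⱼ² combined with the Plücker relation ℓ₁₂ℓ₃₄ - ℓ₁₃ℓ₂₄ + ℓ₁₄ℓ₂₃ = 0
gives both spheres. -/
theorem angularMomenta_mem {b : ℝ} {z : Fin 4 ⊕ Fin 4 → ℝ} (hz : z ∈ cotangentS3) :
    angularMomenta z ∈ reducedSpace (prolateMap b z 0) := by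
  obtain ⟨h1, h2⟩ := hz
  simp only [Fin.sum_univ_four] at h1 h2
  constructor <;> simp [angularMomenta, prolateMap, Fin.sum_univ_four, angMom]
  · linear_combination (z (Sum.inr 0) ^ 2 + z (Sum.inr 1) ^ 2 + z (Sum.inr 2) ^ 2
      + z (Sum.inr 3) ^ 2) * h1 - (z (Sum.inl 0) * z (Sum.inr 0) + z (Sum.inl 1) * z (Sum.inr 1)
      + z (Sum.inl 2) * z (Sum.inr 2) + z (Sum.inl 3) * z (Sum.inr 3)) * h2
  · linear_combination (z (Sum.inr 0) ^ 2 + z (Sum.inr 1) ^ 2 + z (Sum.inr 2) ^ 2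
      + z (Sum.inr 3) ^ 2) * h1 - (z (Sum.inl 0) * z (Sum.inr 0) + z (Sum.inl 1) * z (Sum.inr 1)
      + z (Sum.inl 2) * z (Sum.inr 2) + z (Sum.inl 3) * z (Sum.inr 3)) * h2

theorem reducedProlateMap_angularMomenta (b : ℝ) (z : Fin 4 ⊕ Fin 4 → ℝ) :
    reducedProlateMap b (angularMomenta z) = ![prolateMap b z 1, prolateMap b z 2] := by
  simp [reducedProlateMap, angularMomenta, prolateMap]

end Flows

/-! ### Values of the prolate fibration in terms of the roots -/

section Roots

/-- The roots `r₁ < r₂` belonging to a regular value `(h, l, g)`. -/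
structure ProlateRoots (b h l g r₁ r₂ : ℝ) : Prop where
  one_lt_b : 1 < b
  h_pos : 0 < h
  r₁_pos : 0 < r₁
  r₁_le : r₁ ≤ 1
  le_r₂ : 1 ≤ r₂
  r₂_lt : r₂ < b
  r₁_lt_r₂ : r₁ < r₂
  g_eq : g = 2 * h * r₁ * r₂
  l_eq : (b - 1) * l ^ 2 = 2 * h * (1 - r₁) * (r₂ - 1)

variable {b h l g r₁ r₂ : ℝ}

theorem ProlateRoots.l_sq (R : ProlateRoots b h l g r₁ r₂) :
    l ^ 2 = 2 * h * (1 - r₁) * (r₂ - 1) / (b - 1) := by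
  have : b - 1 ≠ 0 := by linarith [R.one_lt_b]
  rw [eq_div_iff this]; linarith [R.l_eq]

theorem ProlateRoots.k_eq (R : ProlateRoots b h l g r₁ r₂) :
    b * (2 * h - l ^ 2) - g = 2 * h * (b - r₁) * (b - r₂) / (b - 1) := by
  have : b - 1 ≠ 0 := by linarith [R.one_lt_b]
  rw [R.l_sq, R.g_eq]
  field_simp
  ring

theorem ProlateRoots.k_pos (R : ProlateRoots b h l g r₁ r₂) :
    0 < b * (2 * h - l ^ 2) - g := by
  rw [R.k_eq]
  have := R.one_lt_b; have := R.h_pos; have := R.r₁_le; have := R.r₂_lt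
  have h1 : 0 < b - r₁ := by linarith
  have h2 : 0 < b - r₂ := by linarith
  have h3 : 0 < b - 1 := by linarith
  positivity

/-- The separation variable as a function of `u = ℓ₁₄`. -/
noncomputable def sepVar (b k u : ℝ) : ℝ := b * u ^ 2 / (k + u ^ 2)

theorem b_sub_sepVar {k : ℝ} (hk : 0 < k) (u : ℝ) : b - sepVar b k u = b * k / (k + u ^ 2) := by
  have : k + u ^ 2 ≠ 0 := by positivity
  unfold sepVar; field_simp; ring

theorem sq_mul_b_sub_sepVar {k : ℝ} (hk : 0 < k) (u : ℝ) :
    u ^ 2 * (b - sepVar b k u) = k * sepVar b k u := by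
  rw [b_sub_sepVar hk]; unfold sepVar; ring

theorem sepVar_lt {k : ℝ} (hb : 0 < b) (hk : 0 < k) (u : ℝ) : sepVar b k u < b := by
  have := b_sub_sepVar (b := b) hk u
  have h2 : 0 < b * k / (k + u ^ 2) := by positivity
  linarith

/-- The values `u = ℓ₁₄`, `w = ℓ₁₂ℓ₂₄ + ℓ₁₃ℓ₃₄`, `A = ℓ₁₂² + ℓ₁₃²`, `B = ℓ₂₄² + ℓ₃₄²` at a point of
the fibre over a regular value. -/
structure OrbitValues (b h l g u w A B : ℝ) : Prop where
  a_nonneg : 0 ≤ A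
  b_nonneg : 0 ≤ B
  g_eq : b * A + u ^ 2 = g
  h_eq : A + B + u ^ 2 + l ^ 2 = 2 * h
  w_sq : w ^ 2 = A * B - u ^ 2 * l ^ 2

variable {u w A B : ℝ}

theorem OrbitValues.b_eq (O : OrbitValues b h l g u w A B) (hb : 0 < b)
    (hk : 0 < b * (2 * h - l ^ 2) - g) :
    B * (b - sepVar b (b * (2 * h - l ^ 2) - g) u)
      = (b * (2 * h - l ^ 2) - g) * (1 - sepVar b (b * (2 * h - l ^ 2) - g) u) := by
  have h1 := sq_mul_b_sub_sepVar (b := b) hk u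
  set k := b * (2 * h - l ^ 2) - g with hkdef
  set s := sepVar b k u
  have h2 : b * B = k - (b - 1) * u ^ 2 := by
    rw [hkdef]; linear_combination b * O.h_eq - O.g_eq
  have : b * (B * (b - s)) = b * (k * (1 - s)) := by
    linear_combination (b - s) * h2 - (b - 1) * h1
  exact mul_left_cancel₀ hb.ne' this

theorem OrbitValues.a_eq (O : OrbitValues b h l g u w A B) (hb : 0 < b)
    (hk : 0 < b * (2 * h - l ^ 2) - g) :
    A * (b - sepVar b (b * (2 * h - l ^ 2) - g) u)
      = g - (2 * h - l ^ 2) * sepVar b (b * (2 * h - l ^ 2) - g) u := by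
  have h1 := sq_mul_b_sub_sepVar (b := b) hk u
  set k := b * (2 * h - l ^ 2) - g with hkdef
  set s := sepVar b k u
  have : b * (A * (b - s)) = b * (g - (2 * h - l ^ 2) * s) := by
    rw [hkdef] at h1
    linear_combination (b - s) * O.g_eq - h1
  exact mul_left_cancel₀ hb.ne' this

/-- The separated equation of motion. In w² = AB - u²l² each of A, B and u², multiplied by b - s, is
linear in s, so the right side is quadratic in s; its roots are r₁ and r₂. -/
theorem OrbitValues.w_sq_eq (O : OrbitValues b h l g u w A B) (R : ProlateRoots b h l g r₁ r₂) :
    w ^ 2 * (b - sepVar b (b * (2 * h - l ^ 2) - g) u) ^ 2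
      = 2 * h * (b * (2 * h - l ^ 2) - g) * (r₁ - sepVar b (b * (2 * h - l ^ 2) - g) u)
        * (r₂ - sepVar b (b * (2 * h - l ^ 2) - g) u) := by
  have hb : 0 < b := by linarith [R.one_lt_b]
  have h1 := sq_mul_b_sub_sepVar (b := b) R.k_pos u
  have h2 := O.a_eq hb R.k_pos
  have h3 := O.b_eq hb R.k_pos
  have hk := R.k_eq
  have hb1 : b - 1 ≠ 0 := by linarith [R.one_lt_b]
  set k := b * (2 * h - l ^ 2) - g with hkdef
  set s := sepVar b k u
  have h4 : w ^ 2 * (b - s) ^ 2 = (A * (b - s)) * (B * (b - s)) - (u ^ 2 * (b - s)) * (l ^ 2 * (b - s)) := by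
    rw [O.w_sq]; ring
  rw [h4, h1, h2, h3, hk, R.l_sq, R.g_eq]
  field_simp
  ring

/-- B ≥ 0 gives s ≤ 1, and w² ≥ 0 excludes the open interval between the roots. The only remaining
possibility, s = r₂ = 1, forces l = 0 and g = 2hr₁ < 2h, which contradicts A ≥ 0. -/
theorem OrbitValues.sepVar_le (O : OrbitValues b h l g u w A B) (R : ProlateRoots b h l g r₁ r₂) :
    sepVar b (b * (2 * h - l ^ 2) - g) u ≤ r₁ := by
  have hb : 0 < b := by linarith [R.one_lt_b]
  have h1 := sq_mul_b_sub_sepVar (b := b) R.k_pos u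
  have h2 := O.a_eq hb R.k_pos
  have h3 := O.b_eq hb R.k_pos
  have h4 := O.w_sq_eq R
  have hlt := sepVar_lt hb R.k_pos u
  have hk := R.k_pos
  set k := b * (2 * h - l ^ 2) - g with hkdef
  set s := sepVar b k u
  have hA := O.a_nonneg; have hB := O.b_nonneg
  have hh := R.h_pos
  have hs1 : s ≤ 1 := by
    by_contra hs
    have : 0 ≤ B * (b - s) := mul_nonneg hB (by linarith)
    nlinarith
  by_contra hs
  push Not at hs
  have h5 : 0 ≤ 2 * h * k * ((r₁ - s) * (r₂ - s)) := by
    have : 0 ≤ w ^ 2 * (b - s) ^ 2 := by positivity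
    linarith
  have h6 : 0 ≤ (r₁ - s) * (r₂ - s) := nonneg_of_mul_nonneg_right h5 (by positivity)
  have h7 : r₂ ≤ s := by
    by_contra h7
    nlinarith
  have hs' : s = 1 := le_antisymm hs1 (R.le_r₂.trans h7)
  have hr2 : r₂ = 1 := le_antisymm (h7.trans hs1) R.le_r₂
  have hl : l ^ 2 = 0 := by rw [R.l_sq, hr2]; simp
  have h8 : 0 ≤ A * (b - s) := mul_nonneg hA (by linarith)
  rw [h2, hl, hs', R.g_eq, hr2] at h8
  nlinarith [R.r₁_lt_r₂]

/-- The left side is the factor multiplying u in the equation for w'. Expressed through s and the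
roots it can be matched with the derivative of the angle. -/
theorem OrbitValues.force_eq (O : OrbitValues b h l g u w A B) (R : ProlateRoots b h l g r₁ r₂) :
    b * l ^ 2 + B + (b - 1) * A
      = 2 * h * (r₁ + r₂ - 2 * sepVar b (b * (2 * h - l ^ 2) - g) u)
        - 4 * h * (r₁ - sepVar b (b * (2 * h - l ^ 2) - g) u)
          * (r₂ - sepVar b (b * (2 * h - l ^ 2) - g) u)
          / (b - sepVar b (b * (2 * h - l ^ 2) - g) u) := by
  have hb : 0 < b := by linarith [R.one_lt_b]
  have h2 := O.a_eq hb R.k_pos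
  have h3 := O.b_eq hb R.k_pos
  have hlt := sepVar_lt hb R.k_pos u
  have hk := R.k_eq
  have hb1 : b - 1 ≠ 0 := by linarith [R.one_lt_b]
  set k := b * (2 * h - l ^ 2) - g with hkdef
  set s := sepVar b k u
  have hbs : b - s ≠ 0 := by linarith
  have hA := eq_div_of_mul_eq hbs h2
  have hB := eq_div_of_mul_eq hbs h3
  rw [hA, hB, hk, R.l_sq, R.g_eq]
  field_simp
  ring

end Roots

/-! ### The explicit roots over the regular values -/

section RootFormulas

variable {b h l g : ℝ}

/-- As a sum of two nonnegative terms, the discriminant can vanish only when l = 0 and g = 2h, the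
values where the two roots collide at 1. -/
theorem discrim_pos (hb : 1 < b) (hg : 0 < g) (hg' : g < b * (2 * h - l ^ 2))
    (hne : ¬ (l = 0 ∧ g = 2 * h)) :
    0 < (g + 2 * h + (b - 1) * l ^ 2) ^ 2 - 8 * h * g := by
  have : (g + 2 * h + (b - 1) * l ^ 2) ^ 2 - 8 * h * g
      = (g - 2 * h + (b - 1) * l ^ 2) ^ 2 + 8 * h * (b - 1) * l ^ 2 := by ring
  have hh : 0 < h := by nlinarith [sq_nonneg l]
  have h1 : 0 < b - 1 := by linarith
  rw [this]
  by_cases hl : l = 0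
  · have h2 : g - 2 * h ≠ 0 := fun h2 => hne ⟨hl, by linarith⟩
    subst hl
    have : 0 < (g - 2 * h) ^ 2 := by positivity
    simpa using this
  · positivity

/-- The numerator is a concave quadratic with value -g at 0, (b - 1)l² at 1 and -(b - 1)(b(2h - l²)
- g) at b. These signs place the roots relative to 0, 1 and b. -/
theorem prolateRoots_of_regular (hb : 1 < b) (hg : 0 < g) (hg' : g < b * (2 * h - l ^ 2))
    (hne : ¬ (l = 0 ∧ g = 2 * h)) :
    ProlateRoots b h l g (prolateRoot₁ b h l g) (prolateRoot₂ b h l g) := by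
  have hd := discrim_pos hb hg hg' hne
  have hh : 0 < h := by nlinarith [sq_nonneg l]
  have hsq := Real.sq_sqrt hd.le
  have hpos := Real.sqrt_pos.2 hd
  have hb1 : 0 < b - 1 := by linarith
  unfold prolateRoot₁ prolateRoot₂
  set d := √((g + 2 * h + (b - 1) * l ^ 2) ^ 2 - 8 * h * g) with hdef
  have hbl : 0 ≤ (b - 1) * l ^ 2 := by positivity
  have hhg : 0 < h * g := by positivity
  have hbl' : (b - 1) * l ^ 2 * h ≥ 0 := by positivity
  have hk : 0 < (b - 1) * (b * (2 * h - l ^ 2) - g) * h := by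
    have : 0 < b * (2 * h - l ^ 2) - g := by linarith
    positivity
  have hN1 : (2 * h - g - (b - 1) * l ^ 2) ^ 2 + 8 * h * (b - 1) * l ^ 2 = d ^ 2 := by
    rw [hsq]; ring
  refine ⟨hb, hh, ?_, ?_, ?_, ?_, ?_, ?_, ?_⟩
  · apply div_pos _ (by positivity)
    have : d < g + 2 * h + (b - 1) * l ^ 2 := by
      apply lt_of_pow_lt_pow_left₀ 2 (by positivity)
      rw [hsq]; linarith
    linarith
  · rw [div_le_one (by positivity)]
    have : |2 * h - g - (b - 1) * l ^ 2| ≤ d := by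
      apply abs_le_of_sq_le_sq _ hpos.le
      nlinarith
    linarith [neg_abs_le (2 * h - g - (b - 1) * l ^ 2)]
  · rw [le_div_iff₀ (by positivity)]
    have : |2 * h - g - (b - 1) * l ^ 2| ≤ d := by
      apply abs_le_of_sq_le_sq _ hpos.le
      nlinarith
    linarith [le_abs_self (2 * h - g - (b - 1) * l ^ 2)]
  · rw [div_lt_iff₀ (by positivity)]
    have h4 : 0 ≤ b * (4 * h) - (g + 2 * h + (b - 1) * l ^ 2) := by nlinarith [sq_nonneg l]
    have : d < b * (4 * h) - (g + 2 * h + (b - 1) * l ^ 2) := by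
      apply lt_of_pow_lt_pow_left₀ 2 h4
      rw [hsq]
      nlinarith
    linarith
  · apply div_lt_div_of_pos_right _ (by positivity)
    linarith
  · field_simp
    linear_combination 2 * hsq
  · field_simp
    linear_combination (-2) * hsq

/-- Since (b - 1)l² = 2h(1 - r₁)(r₂ - 1), a root equals 1 only for l = 0. The other root is then
g/(2h), and the side of 2h on which g lies decides which root it is. -/
theorem prolateRoot₁_lt_one_iff {r₁ r₂ : ℝ} (R : ProlateRoots b h l g r₁ r₂) :
    r₁ < 1 ↔ (l ≠ 0 ∨ g < 2 * h) := by
  have hh := R.h_pos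
  have h2 := R.le_r₂
  have hb1 : 0 < b - 1 := by linarith [R.one_lt_b]
  constructor
  · intro h1
    by_cases hl : l = 0
    · right
      have h3 := R.l_eq
      rw [hl] at h3
      have h4 : 2 * h * (1 - r₁) * (r₂ - 1) = 0 := by rw [← h3]; ring
      have h5 : r₂ - 1 = 0 := by
        rcases mul_eq_zero.1 h4 with h6 | h6
        · have : 0 < 2 * h * (1 - r₁) := by
            have : 0 < 1 - r₁ := by linarith
            positivity
          linarith
        · exact h6
      rw [R.g_eq, show r₂ = 1 by linarith]
      nlinarith
    · exact Or.inl hl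
  · intro h1
    refine lt_of_le_of_ne R.r₁_le fun h3 => ?_
    rcases h1 with h1 | h1
    · have h4 : (b - 1) * l ^ 2 = 0 := by rw [R.l_eq, h3]; ring
      have : 0 < (b - 1) * l ^ 2 := by positivity
      linarith
    · rw [R.g_eq, h3] at h1
      nlinarith

theorem one_lt_prolateRoot₂_iff {r₁ r₂ : ℝ} (R : ProlateRoots b h l g r₁ r₂) :
    1 < r₂ ↔ (l ≠ 0 ∨ 2 * h < g) := by
  have hh := R.h_pos
  have h2 := R.le_r₂
  have hb1 : 0 < b - 1 := by linarith [R.one_lt_b]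
  constructor
  · intro h1
    by_cases hl : l = 0
    · right
      have h3 := R.l_eq
      rw [hl] at h3
      have h4 : 2 * h * (r₂ - 1) * (1 - r₁) = 0 := by
        calc _ = 2 * h * (1 - r₁) * (r₂ - 1) := by ring
          _ = 0 := by rw [← h3]; ring
      have h5 : 1 - r₁ = 0 := by
        rcases mul_eq_zero.1 h4 with h6 | h6
        · have : 0 < 2 * h * (r₂ - 1) := by
            have : 0 < r₂ - 1 := by linarith
            positivity
          linarith
        · exact h6
      rw [R.g_eq, show r₁ = 1 by linarith]
      nlinarith
    · exact Or.inl hl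
  · intro h1
    refine lt_of_le_of_ne R.le_r₂ fun h3 => ?_
    rcases h1 with h1 | h1
    · have h4 : (b - 1) * l ^ 2 = 0 := by rw [R.l_eq, ← h3]; ring
      have : 0 < (b - 1) * l ^ 2 := by positivity
      linarith
    · rw [R.g_eq, ← h3] at h1
      nlinarith [R.r₁_le]

end RootFormulas

/-! ### The angle along an orbit -/

section Angle

/-- The speed of the angle `θ`, in which the separation variable is `r₁ sin² θ`. -/
noncomputable def phaseSpeed (b h r₁ r₂ θ : ℝ) : ℝ :=
  2 * √(2 * h) * (√(b - r₁ * Real.sin θ ^ 2) * √(r₂ - r₁ * Real.sin θ ^ 2))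

variable {b h l g r₁ r₂ : ℝ}

theorem ProlateRoots.mul_sin_sq_le (R : ProlateRoots b h l g r₁ r₂) (θ : ℝ) :
    r₁ * Real.sin θ ^ 2 ≤ r₁ := by
  nlinarith [R.r₁_pos, Real.sin_sq_le_one θ]

theorem ProlateRoots.phaseSpeed_pos (R : ProlateRoots b h l g r₁ r₂) (θ : ℝ) :
    0 < phaseSpeed b h r₁ r₂ θ := by
  have h1 := R.mul_sin_sq_le θ
  have := R.h_pos; have := R.r₁_lt_r₂; have := R.r₂_lt
  have h2 : 0 < b - r₁ * Real.sin θ ^ 2 := by linarith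
  have h3 : 0 < r₂ - r₁ * Real.sin θ ^ 2 := by linarith
  unfold phaseSpeed; positivity

theorem continuous_phaseSpeed : Continuous (phaseSpeed b h r₁ r₂) := by
  unfold phaseSpeed; fun_prop

theorem phaseSpeed_periodic : Function.Periodic (phaseSpeed b h r₁ r₂) (2 * Real.pi) := by
  intro θ; simp [phaseSpeed]

/-- The point c + is solves z' = iβz, so a primitive of β that starts at the argument of the initial
point is a global angle. -/
theorem exists_angle_of_unit_circle {c s β : ℝ → ℝ} (hβ : Continuous β)
    (hcs : ∀ t, c t ^ 2 + s t ^ 2 = 1) (hc : ∀ t, HasDerivAt c (-(β t * s t)) t)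
    (hs : ∀ t, HasDerivAt s (β t * c t) t) :
    ∃ Φ : ℝ → ℝ, (∀ t, HasDerivAt Φ (β t) t) ∧
      ∀ t, c t = Real.cos (Φ t) ∧ s t = Real.sin (Φ t) := by
  have hz : ∀ t, HasDerivAt (fun t => (c t : ℂ) + Complex.I * s t)
      (((0 : ℝ) + Complex.I * β t) * ((c t : ℂ) + Complex.I * s t)) t := by
    intro t
    have := (hc t).ofReal_comp.add ((hs t).ofReal_comp.const_mul Complex.I)
    convert! this using 1
    push_cast
    linear_combination (β t * s t : ℂ) * Complex.I_sq
  have hB : ∀ t, HasDerivAt (fun t => (Complex.arg (c 0 + Complex.I * s 0)) + ∫ x in (0 : ℝ)..t, β x)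
      (β t) t := fun t =>
    (intervalIntegral.integral_hasDerivAt_right (hβ.intervalIntegrable _ _)
      (hβ.stronglyMeasurableAtFilter _ _) hβ.continuousAt).const_add _
  refine ⟨_, hB, fun t => ?_⟩
  have h1 := eq_mul_exp_of_hasDerivAt (α := fun _ => 0) continuous_const hB hz t
  simp only [intervalIntegral.integral_zero, Real.exp_zero, Complex.ofReal_one, mul_one,
    intervalIntegral.integral_same, add_zero, add_sub_cancel_left] at h1
  have h2 : ‖(c 0 : ℂ) + Complex.I * s 0‖ = 1 := by
    rw [mul_comm, Complex.norm_add_mul_I, hcs 0, Real.sqrt_one]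
  have h3 := Complex.norm_mul_exp_arg_mul_I ((c 0 : ℂ) + Complex.I * s 0)
  rw [h2, Complex.ofReal_one, one_mul] at h3
  rw [← h3, ← Complex.exp_add, mul_comm Complex.I (s t : ℂ)] at h1
  have h4 : (c t : ℂ) + s t * Complex.I = Complex.exp (((Complex.arg (c 0 + Complex.I * s 0)
      + ∫ x in (0 : ℝ)..t, β x : ℝ) : ℂ) * Complex.I) := by
    rw [h1]; congr 1; push_cast; ring
  have hre := congrArg Complex.re h4
  have him := congrArg Complex.im h4
  rw [Complex.exp_ofReal_mul_I_re] at hre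
  rw [Complex.exp_ofReal_mul_I_im] at him
  simp at hre him
  exact ⟨hre, him⟩

/-- At the turning points s = 0 and s = r₁ the variable s itself is not a good coordinate. The
closed curve traced by (u, w) is smooth there, and a rescaling carries it to the unit circle, on
which the motion is a rotation without zeros of the speed. -/
theorem exists_orbit_angle (R : ProlateRoots b h l g r₁ r₂) {τ : ℝ} {u w A B : ℝ → ℝ}
    (O : ∀ t, OrbitValues b h l g (u t) (w t) (A t) (B t))
    (hu : ∀ t, HasDerivAt u (-(2 * b * τ * w t)) t)
    (hw : ∀ t, HasDerivAt w (2 * u t * τ * (b * l ^ 2 + B t + (b - 1) * A t)) t) :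
    ∃ Φ : ℝ → ℝ, (∀ t, HasDerivAt Φ (τ * phaseSpeed b h r₁ r₂ (Φ t)) t) ∧
      (∀ t, sepVar b (b * (2 * h - l ^ 2) - g) (u t) = r₁ * Real.sin (Φ t) ^ 2) ∧
      ∀ t t', (u t = u t' ∧ w t = w t') ↔ ∃ m : ℤ, Φ t - Φ t' = m * (2 * Real.pi) := by
  have hb : 0 < b := by linarith [R.one_lt_b]
  have hk := R.k_pos
  have hh := R.h_pos
  have hr := R.r₁_pos
  have hle := fun t => (O t).sepVar_le R
  have hwsq := fun t => (O t).w_sq_eq R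
  have hforce := fun t => (O t).force_eq R
  have husq := fun t => sq_mul_b_sub_sepVar (b := b) hk (u t)
  have hbsub := fun t => b_sub_sepVar (b := b) hk (u t)
  set k := b * (2 * h - l ^ 2) - g with hkdef
  set s : ℝ → ℝ := fun t => sepVar b k (u t) with hs
  have hs1 : ∀ t, 0 < b - s t := fun t => by linarith [sepVar_lt hb hk (u t)]
  have hs2 : ∀ t, 0 < r₂ - s t := fun t => by linarith [hle t, R.r₁_lt_r₂]
  set y₁ : ℝ → ℝ := fun t => √(b - s t) with hy₁
  set y₂ : ℝ → ℝ := fun t => √(r₂ - s t) with hy₂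
  set κ := √(k * r₁) with hκ
  set ν := √(2 * h) with hν
  have y₁pos : ∀ t, 0 < y₁ t := fun t => Real.sqrt_pos.2 (hs1 t)
  have y₂pos : ∀ t, 0 < y₂ t := fun t => Real.sqrt_pos.2 (hs2 t)
  have y₁sq : ∀ t, y₁ t ^ 2 = b - s t := fun t => Real.sq_sqrt (hs1 t).le
  have y₂sq : ∀ t, y₂ t ^ 2 = r₂ - s t := fun t => Real.sq_sqrt (hs2 t).le
  have κpos : 0 < κ := Real.sqrt_pos.2 (by positivity)
  have κsq : κ ^ 2 = k * r₁ := Real.sq_sqrt (by positivity)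
  have νpos : 0 < ν := Real.sqrt_pos.2 (by positivity)
  have νsq : ν ^ 2 = 2 * h := Real.sq_sqrt (by positivity)
  have ds : ∀ t, HasDerivAt s (-(4 * τ * u t * w t * y₁ t ^ 4 / k)) t := by
    intro t
    have hden : k + u t ^ 2 ≠ 0 := by positivity
    have h1 := (((hu t).pow 2).const_mul b).div (((hu t).pow 2).const_add k) hden
    convert! h1 using 1
    rw [show y₁ t ^ 4 = (y₁ t ^ 2) ^ 2 by ring, y₁sq, hbsub]
    simp only [Pi.pow_apply]
    field_simp
    push_cast
    ring
  have dy₁ : ∀ t, HasDerivAt y₁ (2 * τ * u t * w t * y₁ t ^ 3 / k) t := by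
    intro t
    convert! ((ds t).const_sub b).sqrt (hs1 t).ne' using 1
    have := (y₁pos t).ne'
    change _ = _ / (2 * y₁ t)
    field_simp
    ring
  have dy₂ : ∀ t, HasDerivAt y₂ (2 * τ * u t * w t * y₁ t ^ 4 / (k * y₂ t)) t := by
    intro t
    convert! ((ds t).const_sub r₂).sqrt (hs2 t).ne' using 1
    have := (y₂pos t).ne'
    change _ = _ / (2 * y₂ t)
    field_simp
    ring
  -- With κ² = kr₁ and ν² = 2h, the relations u²(b - s) = ks and w²(b - s)² = ν²k(r₁ - s)(r₂ - s)
  -- make the two squares (r₁ - s)/r₁ and s/r₁. The sign of the cosine makes Φ increase when τ > 0.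
  obtain ⟨Φ, hΦ, hcs⟩ := exists_angle_of_unit_circle
    (c := fun t => -(w t * y₁ t ^ 2 / (ν * κ * y₂ t))) (s := fun t => u t * y₁ t / κ)
    (β := fun t => τ * (2 * ν * (y₁ t * y₂ t)))
    (by
      have h1 : Continuous y₁ := continuous_iff_continuousAt.2 fun t => (dy₁ t).continuousAt
      have h2 : Continuous y₂ := continuous_iff_continuousAt.2 fun t => (dy₂ t).continuousAt
      fun_prop)
    (fun t => by
      have h1 := (y₁pos t).ne'
      have h2 := (y₂pos t).ne'
      have h3 : (w t * y₁ t ^ 2) ^ 2 = ν ^ 2 * k * (r₁ - s t) * y₂ t ^ 2 := by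
        rw [mul_pow, y₁sq, y₂sq, νsq]; exact hwsq t
      have h4 : (u t * y₁ t) ^ 2 = k * s t := by rw [mul_pow, y₁sq]; exact husq t
      rw [neg_sq, div_pow, div_pow, h3, h4, mul_pow, mul_pow, κsq]
      field_simp
      ring)
    (fun t => by
      have h1 := (y₁pos t).ne'
      have h2 := (y₂pos t).ne'
      have h5 : HasDerivAt (fun t => ν * κ * y₂ t) _ t := (dy₂ t).const_mul (ν * κ)
      have h6 := (((hw t).mul ((dy₁ t).pow 2)).div h5 (by positivity)).neg
      convert! h6 using 1
      have h7 : w t ^ 2 * y₁ t ^ 4 = ν ^ 2 * k * (r₁ - s t) * y₂ t ^ 2 := by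
        rw [show y₁ t ^ 4 = (y₁ t ^ 2) ^ 2 by ring, y₁sq, y₂sq, νsq]; exact hwsq t
      have h8 : b * l ^ 2 + B t + (b - 1) * A t
          = ν ^ 2 * (r₁ + r₂ - 2 * s t) - 2 * ν ^ 2 * (r₁ - s t) * y₂ t ^ 2 / y₁ t ^ 2 := by
        rw [hforce t, y₁sq, y₂sq, νsq]; ring
      simp only [Pi.mul_apply, Pi.pow_apply]
      rw [h8]
      push_cast
      field_simp
      have h9 := y₂sq t
      generalize hX : r₁ - s t = X at *
      have h10 : r₁ + r₂ - 2 * s t = X + y₂ t ^ 2 := by rw [h9, ← hX]; ring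
      rw [h10]
      linear_combination (τ * u t * (2 * y₂ t ^ 2 - y₁ t ^ 2)) * h7)
    (fun t => by
      have h1 := (y₁pos t).ne'
      have h2 := (y₂pos t).ne'
      have h6 := ((hu t).mul (dy₁ t)).div_const κ
      convert! h6 using 1
      have h4 : u t ^ 2 * y₁ t ^ 2 = k * (b - y₁ t ^ 2) := by rw [y₁sq]; linear_combination husq t
      field_simp
      linear_combination (-(τ * w t)) * h4)
  have hsin : ∀ t, s t = r₁ * Real.sin (Φ t) ^ 2 := by
    intro t
    rw [← (hcs t).2, div_pow, κsq, mul_pow, y₁sq, husq t]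
    field_simp
    rfl
  refine ⟨Φ, fun t => ?_, hsin, fun t t' => ?_⟩
  · have : τ * (2 * ν * (y₁ t * y₂ t)) = τ * phaseSpeed b h r₁ r₂ (Φ t) := by
      rw [phaseSpeed, ← hsin t]
    exact this ▸ hΦ t
  · have hexp : (∃ m : ℤ, Φ t - Φ t' = m * (2 * Real.pi)) ↔
        Real.cos (Φ t) = Real.cos (Φ t') ∧ Real.sin (Φ t) = Real.sin (Φ t') := by
      rw [← Real.Angle.cos_coe, ← Real.Angle.cos_coe, ← Real.Angle.sin_coe, ← Real.Angle.sin_coe]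
      constructor
      · rintro ⟨m, hm⟩
        have : (Φ t : Real.Angle) = Φ t' := by
          rw [Real.Angle.angle_eq_iff_two_pi_dvd_sub]
          exact ⟨m, by rw [hm]; ring⟩
        rw [this]; simp
      · rintro ⟨h1, h2⟩
        have := Real.Angle.cos_sin_inj h1 h2
        rw [Real.Angle.angle_eq_iff_two_pi_dvd_sub] at this
        obtain ⟨m, hm⟩ := this
        exact ⟨m, by rw [hm]; ring⟩
    rw [hexp]
    constructor
    · rintro ⟨h1, h2⟩
      rw [← (hcs t).1, ← (hcs t).2, ← (hcs t').1, ← (hcs t').2]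
      have hst : s t = s t' := by simp only [hs, h1]
      simp only [hy₁, hy₂, hst, h1, h2, and_self]
    · rintro ⟨h1, h2⟩
      have hst : s t = s t' := by rw [hsin, hsin, h2]
      have hy1 : y₁ t = y₁ t' := by simp only [hy₁, hst]
      have hy2 : y₂ t = y₂ t' := by simp only [hy₂, hst]
      rw [← (hcs t).1, ← (hcs t').1, hy1, hy2] at h1
      rw [← (hcs t).2, ← (hcs t').2, hy1] at h2
      have := (y₁pos t').ne'
      have := (y₂pos t').ne'
      constructor
      · field_simp at h2
        exact h2
      · field_simp at h1
        linarith

end Angle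

/-! ### Periods of the flow -/

section Periods

/-- The period of `G` along an orbit. -/
noncomputable def periodG (b h r₁ r₂ : ℝ) : ℝ :=
  ∫ θ in (0 : ℝ)..2 * Real.pi, 1 / phaseSpeed b h r₁ r₂ θ

/-- Half the advance of the angle conjugate to `H`, up to normalization. -/
noncomputable def periodH (b h r₁ r₂ : ℝ) : ℝ :=
  ∫ θ in (0 : ℝ)..2 * Real.pi, r₁ * Real.sin θ ^ 2 / phaseSpeed b h r₁ r₂ θ

/-- The rotation number of `ℓ₂₃`, up to normalization. -/
noncomputable def periodL (b h r₁ r₂ : ℝ) : ℝ :=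
  ∫ θ in (0 : ℝ)..2 * Real.pi,
    r₁ * Real.sin θ ^ 2 / (1 - r₁ * Real.sin θ ^ 2) / phaseSpeed b h r₁ r₂ θ

variable {b h l g r₁ r₂ : ℝ}

theorem integral_phaseSpeed_periodic (R : ProlateRoots b h l g r₁ r₂) {q : ℝ → ℝ}
    (hqc : Continuous q) (hq : Function.Periodic q (2 * Real.pi)) (a : ℝ) (m : ℤ) :
    ∫ θ in a..(a + m * (2 * Real.pi)), q θ / phaseSpeed b h r₁ r₂ θ
      = m * ∫ θ in (0 : ℝ)..2 * Real.pi, q θ / phaseSpeed b h r₁ r₂ θ := by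
  have hp : Function.Periodic (fun θ => q θ / phaseSpeed b h r₁ r₂ θ) (2 * Real.pi) :=
    hq.div phaseSpeed_periodic
  have hc : Continuous fun θ => q θ / phaseSpeed b h r₁ r₂ θ :=
    hqc.div continuous_phaseSpeed fun θ => (R.phaseSpeed_pos θ).ne'
  have h1 := hp.intervalIntegral_add_zsmul_eq m a fun _ _ => hc.intervalIntegrable _ _
  simp only [zsmul_eq_mul] at h1
  rw [h1]
  have h2 := hp.intervalIntegral_add_eq a 0
  rw [zero_add] at h2
  rw [h2]

theorem periodG_pos (R : ProlateRoots b h l g r₁ r₂) : 0 < periodG b h r₁ r₂ := by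
  refine intervalIntegral.intervalIntegral_pos_of_pos ?_ (fun θ => ?_) (by positivity)
  · exact (continuous_const.div continuous_phaseSpeed fun θ =>
      (R.phaseSpeed_pos θ).ne').intervalIntegrable _ _
  · have := R.phaseSpeed_pos θ; positivity

/-- Division by `phaseSpeed` turns time integrals of functions of Φ into integrals over the angle,
which over full turns no longer depend on the orbit. -/
theorem hasDerivAt_integral_comp_angle (R : ProlateRoots b h l g r₁ r₂) {τ : ℝ} {Φ : ℝ → ℝ}
    (hΦ : ∀ t, HasDerivAt Φ (τ * phaseSpeed b h r₁ r₂ (Φ t)) t) {q : ℝ → ℝ} (hq : Continuous q)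
    (t : ℝ) :
    HasDerivAt (fun t => ∫ θ in (0 : ℝ)..Φ t, q θ / phaseSpeed b h r₁ r₂ θ) (τ * q (Φ t)) t := by
  have hc : Continuous fun θ => q θ / phaseSpeed b h r₁ r₂ θ :=
    hq.div continuous_phaseSpeed fun θ => (R.phaseSpeed_pos θ).ne'
  have h1 : HasDerivAt (fun x => ∫ θ in (0 : ℝ)..x, q θ / phaseSpeed b h r₁ r₂ θ)
      (q (Φ t) / phaseSpeed b h r₁ r₂ (Φ t)) (Φ t) :=
    intervalIntegral.integral_hasDerivAt_right (hc.intervalIntegrable _ _)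
      (hc.stronglyMeasurableAtFilter _ _) hc.continuousAt
  convert! h1.comp t (hΦ t) using 1
  have := (R.phaseSpeed_pos (Φ t)).ne'
  field_simp

theorem integral_comp_angle_sub (R : ProlateRoots b h l g r₁ r₂) {Φ : ℝ → ℝ} {q : ℝ → ℝ}
    (hq : Continuous q) (hq' : Function.Periodic q (2 * Real.pi)) {m : ℤ}
    (hm : Φ 1 - Φ 0 = m * (2 * Real.pi)) :
    (∫ θ in (0 : ℝ)..Φ 1, q θ / phaseSpeed b h r₁ r₂ θ)
      - (∫ θ in (0 : ℝ)..Φ 0, q θ / phaseSpeed b h r₁ r₂ θ)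
      = m * ∫ θ in (0 : ℝ)..2 * Real.pi, q θ / phaseSpeed b h r₁ r₂ θ := by
  have hc : Continuous fun θ => q θ / phaseSpeed b h r₁ r₂ θ :=
    hq.div continuous_phaseSpeed fun θ => (R.phaseSpeed_pos θ).ne'
  rw [intervalIntegral.integral_interval_sub_left (hc.intervalIntegrable _ _)
    (hc.intervalIntegrable _ _), ← integral_phaseSpeed_periodic R hq hq' (Φ 0) m, ← hm]
  congr 1; ring

/-- With q = 1 the elapsed time times τ is the integral of 1/`phaseSpeed` from Φ 0 to Φ 1. The
integrand is positive, so this integral determines Φ 1. -/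
theorem angle_advance_iff (R : ProlateRoots b h l g r₁ r₂) {τ : ℝ} {Φ : ℝ → ℝ}
    (hΦ : ∀ t, HasDerivAt Φ (τ * phaseSpeed b h r₁ r₂ (Φ t)) t) (m : ℤ) :
    Φ 1 - Φ 0 = m * (2 * Real.pi) ↔ τ = m * periodG b h r₁ r₂ := by
  have hc : Continuous fun θ => 1 / phaseSpeed b h r₁ r₂ θ :=
    continuous_const.div continuous_phaseSpeed fun θ => (R.phaseSpeed_pos θ).ne'
  have hI := fun x y => hc.intervalIntegrable (μ := MeasureTheory.volume) x y
  have h1 := hasDerivAt_integral_comp_angle R hΦ (q := fun _ => 1) continuous_const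
  have h2 : (∫ θ in (0 : ℝ)..Φ 1, 1 / phaseSpeed b h r₁ r₂ θ)
      - (∫ θ in (0 : ℝ)..Φ 0, 1 / phaseSpeed b h r₁ r₂ θ) = τ := by
    have h3 : ∀ t, HasDerivAt (fun t => (∫ θ in (0 : ℝ)..Φ t, 1 / phaseSpeed b h r₁ r₂ θ) - τ * t)
        0 t := by
      intro t
      have := (h1 t).sub ((hasDerivAt_id t).const_mul τ)
      rw [sub_self] at this
      exact this
    have := eq_of_hasDerivAt_zero h3 1 0
    simp only [mul_one, mul_zero, sub_zero] at this
    linarith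
  constructor
  · intro hm
    rw [← h2]
    exact integral_comp_angle_sub R (q := fun _ => 1) continuous_const (fun _ => rfl) hm
  · intro hm
    have h4 := integral_phaseSpeed_periodic R (q := fun _ => 1) continuous_const (fun _ => rfl)
      (Φ 0) m
    rw [intervalIntegral.integral_interval_sub_left (hI _ _) (hI _ _)] at h2
    have h5 : ∫ θ in Φ 1..(Φ 0 + m * (2 * Real.pi)), 1 / phaseSpeed b h r₁ r₂ θ = 0 := by
      rw [← intervalIntegral.integral_interval_sub_left (hI (Φ 0) _) (hI _ _), h4, h2, hm, periodG]
      ring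
    have hpos : ∀ θ, 0 < 1 / phaseSpeed b h r₁ r₂ θ := fun θ => by
      have := R.phaseSpeed_pos θ; positivity
    rcases lt_trichotomy (Φ 1) (Φ 0 + m * (2 * Real.pi)) with h6 | h6 | h6
    · exact absurd h5 (intervalIntegral.intervalIntegral_pos_of_pos (hI _ _) hpos h6).ne'
    · linarith
    · rw [intervalIntegral.integral_symm] at h5
      have := intervalIntegral.intervalIntegral_pos_of_pos (hI _ _) hpos h6
      linarith

/-- Once the moduli are known to agree the growth factor ρ is 1, so the real part of the exponent
never has to be integrated. -/
theorem eq_iff_phase_of_norm_eq {z₀ z₁ : ℂ} {ρ φ : ℝ} (h0 : z₀ ≠ 0) (hρ : 0 < ρ)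
    (h : z₁ = z₀ * (ρ : ℝ) * Complex.exp (Complex.I * (φ : ℝ))) (hn : ‖z₁‖ = ‖z₀‖) :
    z₁ = z₀ ↔ ∃ k : ℤ, φ = k * (2 * Real.pi) := by
  have h1 : ‖Complex.exp (Complex.I * (φ : ℝ))‖ = 1 := by
    rw [mul_comm]; exact Complex.norm_exp_ofReal_mul_I φ
  have h2 : ρ = 1 := by
    rw [h, norm_mul, norm_mul, h1, mul_one, Complex.norm_real, Real.norm_of_nonneg hρ.le] at hn
    have : ‖z₀‖ ≠ 0 := norm_ne_zero_iff.2 h0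
    exact mul_left_cancel₀ this (by rw [hn, mul_one])
  have h3 : z₁ = z₀ ↔ Complex.exp (Complex.I * (φ : ℝ)) = 1 := by
    rw [h, h2, Complex.ofReal_one, mul_one]
    exact mul_eq_left₀ h0
  rw [h3, Complex.exp_eq_one_iff]
  refine exists_congr fun k => ?_
  constructor
  · intro h4
    have h5 := congrArg Complex.im h4
    simpa using h5
  · intro h4
    rw [h4]; push_cast; ring

/-- The rotation of the `(ℓ₁₂, ℓ₁₃)`-plane over one period of `G`. -/
def IsRotation (b h l r₁ r₂ rot : ℝ) : Prop :=
  (r₁ < 1 ∧ rot = 2 * (b - 1) * l * periodL b h r₁ r₂) ∨ (l = 0 ∧ 1 < r₂ ∧ rot = 0)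

end Periods

/-! ### When an orbit closes up after unit time -/

section ReturnMaps

variable {b h l g r₁ r₂ rot : ℝ}

theorem reducedProlateMap_eq_iff {L : Fin 6 → ℝ} :
    reducedProlateMap b L = ![l, g] ↔ L 3 = l ∧ b * L 0 ^ 2 + b * L 1 ^ 2 + L 2 ^ 2 = g := by
  rw [reducedProlateMap]
  constructor
  · intro h; exact ⟨congrFun h 0, congrFun h 1⟩
  · rintro ⟨h1, h2⟩; rw [h1, h2]

theorem cross_eq_of_mem_reducedSpace {L : Fin 6 → ℝ} (hL : L ∈ reducedSpace h) :
    L 0 * L 5 - L 1 * L 4 = -(L 2 * L 3) := by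
  linear_combination (hL.1 - hL.2) / 4

theorem orbitValues_of_mem {L : Fin 6 → ℝ} (hL : L ∈ reducedSpace h)
    (hc : reducedProlateMap b L = ![l, g]) :
    OrbitValues b h l g (L 2) (L 0 * L 4 + L 1 * L 5) (L 0 ^ 2 + L 1 ^ 2) (L 4 ^ 2 + L 5 ^ 2) := by
  obtain ⟨h3, h4⟩ := reducedProlateMap_eq_iff.1 hc
  refine ⟨by positivity, by positivity, by linarith, ?_, ?_⟩
  · rw [← h3]; linear_combination (hL.1 + hL.2) / 2
  · have := cross_eq_of_mem_reducedSpace hL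
    rw [← h3]
    linear_combination (-(L 0 * L 5 - L 1 * L 4) + L 2 * L 3) * this

theorem reducedFlow_invariant {T : Fin 2 → ℝ} {L : ℝ → Fin 6 → ℝ}
    (hL : ∀ t, HasDerivAt L (reducedField b T (L t)) t) (h0 : L 0 ∈ reducedSpace h)
    (hc : reducedProlateMap b (L 0) = ![l, g]) (t : ℝ) :
    L t ∈ reducedSpace h ∧ reducedProlateMap b (L t) = ![l, g] := by
  have hi : ∀ i t, HasDerivAt (fun t => L t i) (reducedField b T (L t) i) t :=
    fun i t => hasDerivAt_pi.1 (hL t) i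
  obtain ⟨h3, h4⟩ := reducedProlateMap_eq_iff.1 hc
  refine ⟨⟨?_, ?_⟩, reducedProlateMap_eq_iff.2 ⟨?_, ?_⟩⟩
  · rw [← h0.1]
    refine eq_of_hasDerivAt_zero (f := fun t => (L t 0 + L t 5) ^ 2 + (L t 1 - L t 4) ^ 2
      + (L t 2 + L t 3) ^ 2) (fun t => ?_) t 0
    convert! ((((hi 0 t).add (hi 5 t)).pow 2).add (((hi 1 t).sub (hi 4 t)).pow 2)).add
      (((hi 2 t).add (hi 3 t)).pow 2) using 1
    simp [reducedField]; ring
  · rw [← h0.2]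
    refine eq_of_hasDerivAt_zero (f := fun t => (L t 0 - L t 5) ^ 2 + (L t 1 + L t 4) ^ 2
      + (L t 2 - L t 3) ^ 2) (fun t => ?_) t 0
    convert! ((((hi 0 t).sub (hi 5 t)).pow 2).add (((hi 1 t).add (hi 4 t)).pow 2)).add
      (((hi 2 t).sub (hi 3 t)).pow 2) using 1
    simp [reducedField]; ring
  · rw [← h3]
    exact eq_of_hasDerivAt_zero (f := fun t => L t 3) (fun t => by
      convert! hi 3 t using 1) t 0
  · rw [← h4]
    refine eq_of_hasDerivAt_zero (f := fun t => b * L t 0 ^ 2 + b * L t 1 ^ 2 + L t 2 ^ 2)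
      (fun t => ?_) t 0
    convert! ((((hi 0 t).pow 2).const_mul b).add (((hi 1 t).pow 2).const_mul b)).add
      ((hi 2 t).pow 2) using 1
    simp [reducedField]; ring

theorem exists_reduced_angle (R : ProlateRoots b h l g r₁ r₂) {T : Fin 2 → ℝ} {L : ℝ → Fin 6 → ℝ}
    (hL : ∀ t, HasDerivAt L (reducedField b T (L t)) t) (h0 : L 0 ∈ reducedSpace h)
    (hc : reducedProlateMap b (L 0) = ![l, g]) :
    ∃ Φ : ℝ → ℝ, (∀ t, HasDerivAt Φ (T 1 * phaseSpeed b h r₁ r₂ (Φ t)) t) ∧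
      (∀ t, sepVar b (b * (2 * h - l ^ 2) - g) (L t 2) = r₁ * Real.sin (Φ t) ^ 2) ∧
      ∀ t t', (L t 2 = L t' 2 ∧ L t 0 * L t 4 + L t 1 * L t 5 = L t' 0 * L t' 4 + L t' 1 * L t' 5) ↔
        ∃ m : ℤ, Φ t - Φ t' = m * (2 * Real.pi) := by
  have hi : ∀ i t, HasDerivAt (fun t => L t i) (reducedField b T (L t) i) t :=
    fun i t => hasDerivAt_pi.1 (hL t) i
  have hinv := reducedFlow_invariant hL h0 hc
  refine exists_orbit_angle R (u := fun t => L t 2) (w := fun t => L t 0 * L t 4 + L t 1 * L t 5)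
    (fun t => orbitValues_of_mem (hinv t).1 (hinv t).2) (fun t => ?_) (fun t => ?_)
  · convert! hi 2 t using 1
    change _ = -(2 * b * T 1 * (L t 4 * L t 0 + L t 5 * L t 1))
    ring
  · convert! ((hi 0 t).mul (hi 4 t)).add ((hi 1 t).mul (hi 5 t)) using 1
    have h1 := cross_eq_of_mem_reducedSpace (hinv t).1
    have h2 := (reducedProlateMap_eq_iff.1 (hinv t).2).1
    simp [reducedField]
    rw [← h2]
    linear_combination (2 * b * T 1 * L t 3) * h1

theorem hasDerivAt_planar {x y : ℝ → ℝ} {α β t : ℝ} (hx : HasDerivAt x (α * x t - β * y t) t)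
    (hy : HasDerivAt y (α * y t + β * x t) t) :
    HasDerivAt (fun t => (x t : ℂ) + Complex.I * y t)
      (((α : ℂ) + Complex.I * (β : ℝ)) * ((x t : ℂ) + Complex.I * y t)) t := by
  convert! hx.ofReal_comp.add (hy.ofReal_comp.const_mul Complex.I) using 1
  push_cast
  linear_combination (β * y t : ℂ) * Complex.I_sq

/-- Return of Φ fixes u and w, hence also A and B. What is left is a common rotation of the planar
vectors (ℓ₁₂, ℓ₁₃) and (ℓ₂₄, ℓ₃₄), and it is enough to follow one of them that never vanishes: the
second where r₁ < 1, the first where l = 0 and r₂ > 1. -/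
theorem reduced_return_iff (R : ProlateRoots b h l g r₁ r₂) (hrot : IsRotation b h l r₁ r₂ rot)
    {T : Fin 2 → ℝ} {L : ℝ → Fin 6 → ℝ}
    (hL : ∀ t, HasDerivAt L (reducedField b T (L t)) t) (h0 : L 0 ∈ reducedSpace h)
    (hc : reducedProlateMap b (L 0) = ![l, g]) :
    L 1 = L 0 ↔ ∃ m k : ℤ, T 1 = m * periodG b h r₁ r₂ ∧ T 0 = k * (2 * Real.pi) - m * rot := by
  have hi : ∀ i t, HasDerivAt (fun t => L t i) (reducedField b T (L t) i) t :=
    fun i t => hasDerivAt_pi.1 (hL t) i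
  have hci : ∀ i, Continuous fun t => L t i := fun i =>
    continuous_iff_continuousAt.2 fun t => (hi i t).continuousAt
  have hinv := reducedFlow_invariant hL h0 hc
  have O := fun t => orbitValues_of_mem (hinv t).1 (hinv t).2
  have hcross := fun t => cross_eq_of_mem_reducedSpace (hinv t).1
  have h3 : ∀ t, L t 3 = l := fun t => (reducedProlateMap_eq_iff.1 (hinv t).2).1
  obtain ⟨Φ, hΦ, hs, huw⟩ := exists_reduced_angle R hL h0 hc
  have hb : 0 < b := by linarith [R.one_lt_b]
  have hk := R.k_pos
  -- the common part of the argument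
  have main : ∀ (v : ℝ → ℂ) (α q : ℝ → ℝ) (ρ : ℝ), Continuous α → Continuous q →
      Function.Periodic q (2 * Real.pi) →
      (∀ t, HasDerivAt v ((α t + Complex.I * (T 0 + ρ * (T 1 * q (Φ t)) : ℝ)) * v t) t) →
      rot = ρ * ∫ θ in (0 : ℝ)..2 * Real.pi, q θ / phaseSpeed b h r₁ r₂ θ →
      v 0 ≠ 0 → (L 1 = L 0 → v 1 = v 0) →
      (L 1 2 = L 0 2 → L 1 0 * L 1 4 + L 1 1 * L 1 5 = L 0 0 * L 0 4 + L 0 1 * L 0 5 →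
        ‖v 1‖ = ‖v 0‖ ∧ (v 1 = v 0 → L 1 = L 0)) →
      (L 1 = L 0 ↔
        ∃ m k : ℤ, T 1 = m * periodG b h r₁ r₂ ∧ T 0 = k * (2 * Real.pi) - m * rot) := by
    intro v α q ρ hα hq hqp hv hρ hv0 hv1 hv2
    have hB : ∀ t, HasDerivAt (fun t => T 0 * t + ρ * ∫ θ in (0 : ℝ)..Φ t,
        q θ / phaseSpeed b h r₁ r₂ θ) (T 0 + ρ * (T 1 * q (Φ t))) t := by
      intro t
      have := ((hasDerivAt_id t).const_mul (T 0)).add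
        ((hasDerivAt_integral_comp_angle R hΦ hq t).const_mul ρ)
      rw [mul_one] at this
      exact this
    have hsol := eq_mul_exp_of_hasDerivAt hα hB hv 1
    have hphase : ∀ m : ℤ, Φ 1 - Φ 0 = m * (2 * Real.pi) →
        ((T 0 * 1 + ρ * ∫ θ in (0 : ℝ)..Φ 1, q θ / phaseSpeed b h r₁ r₂ θ)
        - (T 0 * 0 + ρ * ∫ θ in (0 : ℝ)..Φ 0, q θ / phaseSpeed b h r₁ r₂ θ)) = T 0 + m * rot := by
      intro m hm
      have := integral_comp_angle_sub R hq hqp hm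
      rw [hρ]
      linear_combination ρ * this
    constructor
    · intro hret
      obtain ⟨m, hm⟩ := (huw 1 0).1 ⟨by rw [hret], by rw [hret]⟩
      rw [hphase m hm] at hsol
      have hn : ‖v 1‖ = ‖v 0‖ := by rw [hv1 hret]
      obtain ⟨k, hk⟩ := (eq_iff_phase_of_norm_eq hv0 (Real.exp_pos _) hsol hn).1 (hv1 hret)
      exact ⟨m, k, (angle_advance_iff R hΦ m).1 hm, by linarith⟩
    · rintro ⟨m, k, hm, hk⟩
      have hm' := (angle_advance_iff R hΦ m).2 hm
      rw [hphase m hm'] at hsol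
      obtain ⟨h5, h6⟩ := (huw 1 0).2 ⟨m, hm'⟩
      obtain ⟨h7, h8⟩ := hv2 h5 h6
      exact h8 ((eq_iff_phase_of_norm_eq hv0 (Real.exp_pos _) hsol h7).2 ⟨k, by linarith⟩)
  have nsq : ∀ x y : ℝ, ‖(x : ℂ) + Complex.I * y‖ = √(x ^ 2 + y ^ 2) := fun x y => by
    rw [mul_comm, Complex.norm_add_mul_I]
  have extL : L 1 2 = L 0 2 → L 1 0 = L 0 0 → L 1 1 = L 0 1 → L 1 4 = L 0 4 → L 1 5 = L 0 5 →
      L 1 = L 0 := by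
    intro e2 e0 e1 e4 e5
    funext i
    fin_cases i
    exacts [e0, e1, e2, (h3 1).trans (h3 0).symm, e4, e5]
  have pairEq : ∀ x y x' y' : ℝ, (x : ℂ) + Complex.I * y = x' + Complex.I * y' → x = x' ∧ y = y' := by
    intro x y x' y' h
    have h1 := congrArg Complex.re h
    have h2 := congrArg Complex.im h
    simp at h1 h2
    exact ⟨h1, h2⟩
  rcases hrot with ⟨hr, hrot⟩ | ⟨hl, hr, hrot⟩
  · -- follow `(ℓ₂₄, ℓ₃₄)`
    have hBs := fun t => (O t).b_eq hb hk
    have hsl := fun t => (O t).sepVar_le R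
    have hsb := fun t => sepVar_lt hb hk (L t 2)
    have hus := fun t => sq_mul_b_sub_sepVar (b := b) hk (L t 2)
    have hBpos : ∀ t, 0 < L t 4 ^ 2 + L t 5 ^ 2 := by
      intro t
      have h1 : 0 < (L t 4 ^ 2 + L t 5 ^ 2) * (b - sepVar b (b * (2 * h - l ^ 2) - g) (L t 2)) := by
        rw [hBs t]
        have : 0 < 1 - sepVar b (b * (2 * h - l ^ 2) - g) (L t 2) := by linarith [hsl t]
        positivity
      exact pos_of_mul_pos_left h1 (by linarith [hsb t])
    have hq1 : ∀ θ, 1 - r₁ * Real.sin θ ^ 2 ≠ 0 := fun θ => by linarith [R.mul_sin_sq_le θ]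
    refine main (fun t => (L t 4 : ℂ) + Complex.I * L t 5)
      (fun t => 2 * (b - 1) * T 1 * L t 2 * (L t 0 * L t 4 + L t 1 * L t 5) / (L t 4 ^ 2 + L t 5 ^ 2))
      (fun θ => r₁ * Real.sin θ ^ 2 / (1 - r₁ * Real.sin θ ^ 2)) (2 * (b - 1) * l) ?_ ?_ ?_ ?_ ?_ ?_ ?_ ?_
    · exact Continuous.div (by fun_prop) (by fun_prop) fun t => (hBpos t).ne'
    · exact Continuous.div (by fun_prop) (by fun_prop) hq1
    · intro θ; simp
    · intro t
      -- From u²(b - s) = ks and B(b - s) = k(1 - s) one gets s/(1 - s) = u²/B, the rate of rotation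
      -- of (ℓ₂₄, ℓ₃₄) up to a constant.
      have e1 : r₁ * Real.sin (Φ t) ^ 2 / (1 - r₁ * Real.sin (Φ t) ^ 2)
          = L t 2 ^ 2 / (L t 4 ^ 2 + L t 5 ^ 2) := by
        rw [div_eq_div_iff (hq1 _) (hBpos t).ne', ← hs t]
        have hbs : b - sepVar b (b * (2 * h - l ^ 2) - g) (L t 2) ≠ 0 := by linarith [hsb t]
        apply mul_right_cancel₀ hbs
        linear_combination (sepVar b (b * (2 * h - l ^ 2) - g) (L t 2)) * hBs t
          - (1 - sepVar b (b * (2 * h - l ^ 2) - g) (L t 2)) * hus t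
      rw [e1]
      have hne := (hBpos t).ne'
      have h1 := hcross t
      rw [h3] at h1
      refine hasDerivAt_planar ?_ ?_
      · convert! hi 4 t using 1
        change _ = 2 * (b - 1) * T 1 * L t 2 * L t 0 - T 0 * L t 5
        field_simp
        linear_combination (-(2 * (b - 1) * T 1 * L t 2 * L t 5)) * h1
      · convert! hi 5 t using 1
        change _ = 2 * (b - 1) * T 1 * L t 2 * L t 1 + T 0 * L t 4
        field_simp
        linear_combination (2 * (b - 1) * T 1 * L t 2 * L t 4) * h1
    · rw [hrot, periodL]
    · intro hz
      have h1 : ‖(L 0 4 : ℂ) + Complex.I * L 0 5‖ = 0 := by rw [hz, norm_zero]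
      rw [nsq, Real.sqrt_eq_zero (hBpos 0).le] at h1
      exact (hBpos 0).ne' h1
    · intro hret; simp only [hret]
    · intro e2 ew
      have hBe : L 1 4 ^ 2 + L 1 5 ^ 2 = L 0 4 ^ 2 + L 0 5 ^ 2 := by
        have h1 := (O 1).h_eq; have h2 := (O 0).h_eq
        have h4 := (O 1).g_eq; have h5 := (O 0).g_eq
        have h6 : L 1 0 ^ 2 + L 1 1 ^ 2 = L 0 0 ^ 2 + L 0 1 ^ 2 := by
          apply mul_left_cancel₀ hb.ne'
          rw [e2] at h4
          linarith
        rw [e2] at h1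
        linarith
      refine ⟨by rw [nsq, nsq, hBe], fun hv => ?_⟩
      obtain ⟨e4, e5⟩ := pairEq _ _ _ _ hv
      have c1 := hcross 1; have c0 := hcross 0
      rw [h3, e2, e4, e5] at c1
      rw [h3] at c0
      rw [e4, e5] at ew
      have hne := (hBpos 0).ne'
      -- The vector (ℓ₁₂, ℓ₁₃) is recovered from (ℓ₂₄, ℓ₃₄): their scalar product is w and their
      -- cross product is -ul.
      refine extL e2 ?_ ?_ e4 e5
      · apply mul_right_cancel₀ hne
        linear_combination L 0 4 * ew + L 0 5 * (c1 - c0)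
      · apply mul_right_cancel₀ hne
        linear_combination L 0 5 * ew - L 0 4 * (c1 - c0)
  · -- follow `(ℓ₁₂, ℓ₁₃)`
    have hAs := fun t => (O t).a_eq hb hk
    have hsl := fun t => (O t).sepVar_le R
    have hsb := fun t => sepVar_lt hb hk (L t 2)
    have hg : 2 * h < g := by
      rcases (one_lt_prolateRoot₂_iff R).1 hr with h1 | h1
      · exact absurd hl h1
      · exact h1
    subst hl
    have hApos : ∀ t, 0 < L t 0 ^ 2 + L t 1 ^ 2 := by
      intro t
      have h1 : 0 < (L t 0 ^ 2 + L t 1 ^ 2) * (b - sepVar b (b * (2 * h - 0 ^ 2) - g) (L t 2)) := by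
        rw [hAs t]
        nlinarith [hsl t, R.r₁_le, R.h_pos]
      exact pos_of_mul_pos_left h1 (by linarith [hsb t])
    refine main (fun t => (L t 0 : ℂ) + Complex.I * L t 1)
      (fun t => 2 * T 1 * L t 2 * (L t 0 * L t 4 + L t 1 * L t 5) / (L t 0 ^ 2 + L t 1 ^ 2))
      (fun _ => 0) 0 ?_ continuous_const (fun _ => rfl) ?_ (by simp [hrot]) ?_ ?_ ?_
    · exact Continuous.div (by fun_prop) (by fun_prop) fun t => (hApos t).ne'
    · intro t
      have hne := (hApos t).ne'
      have h1 := hcross t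
      rw [h3, mul_zero, neg_zero] at h1
      refine hasDerivAt_planar ?_ ?_
      · convert! hi 0 t using 1
        change _ = 2 * b * T 1 * L t 3 * L t 1 + 2 * T 1 * L t 4 * L t 2 - T 0 * L t 1
        rw [h3]
        field_simp
        linear_combination (2 * T 1 * L t 2 * L t 1) * h1
      · convert! hi 1 t using 1
        change _ = -(2 * b * T 1 * L t 3 * L t 0) + 2 * T 1 * L t 5 * L t 2 + T 0 * L t 0
        rw [h3]
        field_simp
        linear_combination (-(2 * T 1 * L t 2 * L t 0)) * h1
    · intro hz
      have h1 : ‖(L 0 0 : ℂ) + Complex.I * L 0 1‖ = 0 := by rw [hz, norm_zero]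
      rw [nsq, Real.sqrt_eq_zero (hApos 0).le] at h1
      exact (hApos 0).ne' h1
    · intro hret; simp only [hret]
    · intro e2 ew
      have hAe : L 1 0 ^ 2 + L 1 1 ^ 2 = L 0 0 ^ 2 + L 0 1 ^ 2 := by
        have h4 := (O 1).g_eq; have h5 := (O 0).g_eq
        apply mul_left_cancel₀ hb.ne'
        rw [e2] at h4
        linarith
      refine ⟨by rw [nsq, nsq, hAe], fun hv => ?_⟩
      obtain ⟨e0, e1⟩ := pairEq _ _ _ _ hv
      have c1 := hcross 1; have c0 := hcross 0
      rw [h3, e0, e1] at c1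
      rw [h3] at c0
      rw [e0, e1] at ew
      have hne := (hApos 0).ne'
      refine extL e2 e0 e1 ?_ ?_
      · apply mul_right_cancel₀ hne
        linear_combination L 0 0 * ew - L 0 1 * (c1 - c0)
      · apply mul_right_cancel₀ hne
        linear_combination L 0 1 * ew + L 0 0 * (c1 - c0)

end ReturnMaps

/-! ### Period lattices -/

section PeriodLattices

variable {b h l g r₁ r₂ rot : ℝ}

theorem angMom_antisymm (z : Fin 4 ⊕ Fin 4 → ℝ) (i j : Fin 4) : angMom z j i = -angMom z i j := by
  simp only [angMom]; ring

theorem angMom_congr {z z' : Fin 4 ⊕ Fin 4 → ℝ} (hz : angularMomenta z = angularMomenta z')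
    (i j : Fin 4) : angMom z i j = angMom z' i j := by
  have h0 : angMom z 0 1 = angMom z' 0 1 := congrFun hz 0
  have h1 : angMom z 0 2 = angMom z' 0 2 := congrFun hz 1
  have h2 : angMom z 0 3 = angMom z' 0 3 := congrFun hz 2
  have h3 : angMom z 1 2 = angMom z' 1 2 := congrFun hz 3
  have h4 : angMom z 1 3 = angMom z' 1 3 := congrFun hz 4
  have h5 : angMom z 2 3 = angMom z' 2 3 := congrFun hz 5
  simp only [angMom] at *
  fin_cases i <;> fin_cases j <;> simp <;> linarith

/-- The equations xⱼy₄ - x₄yⱼ = ℓⱼ₄ and 2hx₄xⱼ + y₄yⱼ = Σₖ ℓⱼₖℓ₄ₖ are linear in (xⱼ, yⱼ), and their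
determinant is, up to sign, 2hx₄² + y₄². So the angular momenta together with (x₄, y₄) determine the
point wherever (x₄, y₄) ≠ 0. -/
theorem position_eq {z : Fin 4 ⊕ Fin 4 → ℝ} (hz : z ∈ cotangentS3)
    (hh : ∑ i, z (Sum.inr i) ^ 2 = 2 * h) (j : Fin 4) :
    (2 * h * z (Sum.inl 3) ^ 2 + z (Sum.inr 3) ^ 2) * z (Sum.inl j)
      = z (Sum.inl 3) * (∑ k, angMom z j k * angMom z 3 k) + z (Sum.inr 3) * angMom z j 3 ∧
    (2 * h * z (Sum.inl 3) ^ 2 + z (Sum.inr 3) ^ 2) * z (Sum.inr j)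
      = z (Sum.inr 3) * (∑ k, angMom z j k * angMom z 3 k)
        - 2 * h * z (Sum.inl 3) * angMom z j 3 := by
  obtain ⟨h1, h2⟩ := hz
  have hM : ∑ k, angMom z j k * angMom z 3 k
      = 2 * h * z (Sum.inl j) * z (Sum.inl 3) + z (Sum.inr j) * z (Sum.inr 3) := by
    rw [← hh]
    have h3 : z (Sum.inr j) * z (Sum.inr 3) = z (Sum.inr j) * z (Sum.inr 3)
      * ∑ i, z (Sum.inl i) ^ 2 := by rw [h1, mul_one]
    have h4 : (z (Sum.inl j) * z (Sum.inr 3) + z (Sum.inr j) * z (Sum.inl 3))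
      * ∑ i, z (Sum.inl i) * z (Sum.inr i) = 0 := by rw [h2, mul_zero]
    simp only [Fin.sum_univ_four, angMom] at *
    linear_combination -h3 - h4
  rw [hM]
  simp only [angMom]
  constructor <;> ring

theorem sum_sq_momenta {z : Fin 4 ⊕ Fin 4 → ℝ} (hz : prolateMap b z = ![h, l, g]) :
    ∑ i, z (Sum.inr i) ^ 2 = 2 * h := by
  have : (∑ i, z (Sum.inr i) ^ 2) / 2 = h := congrFun hz 0
  linarith

/-- Over a closed reduced orbit one further phase has to return, that of x₄ + iy₄/√(2h). It never
vanishes, and with the angular momenta it determines the whole point. -/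
theorem prolate_return_iff (R : ProlateRoots b h l g r₁ r₂) (hrot : IsRotation b h l r₁ r₂ rot)
    {T : Fin 3 → ℝ} {γ : ℝ → Fin 4 ⊕ Fin 4 → ℝ} (hγ : ∀ t, HasDerivAt γ (prolateField b T (γ t)) t)
    (hmem : ∀ t, γ t ∈ cotangentS3) (hc : prolateMap b (γ 0) = ![h, l, g]) :
    γ 1 = γ 0 ↔ ∃ m k j : ℤ, T 2 = m * periodG b h r₁ r₂ ∧ T 1 = k * (2 * Real.pi) - m * rot ∧
      T 0 = j * (2 * Real.pi / √(2 * h)) - 2 * m * periodH b h r₁ r₂ := by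
  have hi : ∀ i t, HasDerivAt (fun t => γ t i) (prolateField b T (γ t) i) t :=
    fun i t => hasDerivAt_pi.1 (hγ t) i
  have hci : ∀ i, Continuous fun t => γ t i := fun i =>
    continuous_iff_continuousAt.2 fun t => (hi i t).continuousAt
  have hH : ∀ t, ∑ i, γ t (Sum.inr i) ^ 2 = 2 * h := by
    intro t
    rw [← sum_sq_momenta hc]
    refine eq_of_hasDerivAt_zero (f := fun t => ∑ i, γ t (Sum.inr i) ^ 2) (fun t => ?_) t 0
    have := HasDerivAt.fun_sum (u := Finset.univ) fun i _ => (hi (Sum.inr i) t).pow 2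
    convert! this using 1
    have h := (prolateField_tangent b T (γ t)).2.2
    simp only [Fin.sum_univ_four] at h ⊢
    push_cast
    linear_combination -2 * h
  set L : ℝ → Fin 6 → ℝ := fun t => angularMomenta (γ t) with hLdef
  have hL : ∀ t, HasDerivAt L (reducedField b ![T 1, T 2] (L t)) t := fun t =>
    hasDerivAt_angularMomenta (hγ t)
  have hL0 : L 0 ∈ reducedSpace h := by
    have := angularMomenta_mem (b := b) (hmem 0)
    rwa [hc] at this
  have hcL : reducedProlateMap b (L 0) = ![l, g] := by
    rw [hLdef]; simp only [reducedProlateMap_angularMomenta, hc]; simp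
  have hinv := reducedFlow_invariant hL hL0 hcL
  have O := fun t => orbitValues_of_mem (hinv t).1 (hinv t).2
  have hred := reduced_return_iff R hrot hL hL0 hcL
  obtain ⟨Φ, hΦ, hs, -⟩ := exists_reduced_angle R hL hL0 hcL
  simp only [Matrix.cons_val_zero, Matrix.cons_val_one] at hred hΦ
  have hb : 0 < b := by linarith [R.one_lt_b]
  have hk := R.k_pos
  have hh := R.h_pos
  set ν := √(2 * h) with hν
  have νpos : 0 < ν := Real.sqrt_pos.2 (by positivity)
  have νsq : ν ^ 2 = 2 * h := Real.sq_sqrt (by positivity)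
  -- Q = ℓ₁₄² + ℓ₂₄² + ℓ₃₄² equals 2hx₄² + y₄². It is positive because Q(b - s) = k.
  set Q : ℝ → ℝ := fun t => L t 2 ^ 2 + (L t 4 ^ 2 + L t 5 ^ 2) with hQ
  have hQb : ∀ t, Q t * (b - sepVar b (b * (2 * h - l ^ 2) - g) (L t 2))
      = b * (2 * h - l ^ 2) - g := fun t => by
    linear_combination (O t).b_eq hb hk + sq_mul_b_sub_sepVar (b := b) hk (L t 2)
  have hQpos : ∀ t, 0 < Q t := fun t =>
    pos_of_mul_pos_left ((hQb t).symm ▸ hk) (by linarith [sepVar_lt hb hk (L t 2)])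
  have hQs : ∀ t, L t 2 ^ 2 = r₁ * Real.sin (Φ t) ^ 2 * Q t := fun t => by
    rw [← hs t]
    have hne : b - sepVar b (b * (2 * h - l ^ 2) - g) (L t 2) ≠ 0 := by
      linarith [sepVar_lt hb hk (L t 2)]
    apply mul_right_cancel₀ hne
    rw [sq_mul_b_sub_sepVar hk, mul_assoc, hQb]; ring
  have hQx : ∀ t, 2 * h * γ t (Sum.inl 3) ^ 2 + γ t (Sum.inr 3) ^ 2 = Q t := fun t => by
    obtain ⟨h1, h2⟩ := hmem t
    have h3 : γ t (Sum.inr 3) ^ 2 = γ t (Sum.inr 3) ^ 2 * ∑ i, γ t (Sum.inl i) ^ 2 := by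
      rw [h1, mul_one]
    have h4 : γ t (Sum.inl 3) * γ t (Sum.inr 3) * ∑ i, γ t (Sum.inl i) * γ t (Sum.inr i) = 0 := by
      rw [h2, mul_zero]
    rw [← hH t]
    simp only [hQ, hLdef, angularMomenta, Fin.sum_univ_four, angMom] at *
    simp
    linear_combination h3 + 2 * h4
  set x : ℝ → ℝ := fun t => γ t (Sum.inl 3) with hx
  set y : ℝ → ℝ := fun t => γ t (Sum.inr 3) / ν with hy
  have hxy : ∀ t, x t ^ 2 + y t ^ 2 = Q t / (2 * h) := fun t => by
    rw [← hQx, hx, hy, div_pow, νsq]; field_simp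
  have hpos0 := fun t => position_eq (hmem t) (hH t) 0
  have hM0 : ∀ t, ∑ k, angMom (γ t) 0 k * angMom (γ t) 3 k = -(L t 0 * L t 4 + L t 1 * L t 5) := by
    intro t
    simp [hLdef, angularMomenta, Fin.sum_univ_four, angMom]; ring
  have hdx : ∀ t, HasDerivAt x (T 0 * γ t (Sum.inr 3) + 2 * T 2 * L t 2 * γ t (Sum.inl 0)) t := by
    intro t
    convert! hi (Sum.inl 3) t using 1
    simp [prolateField, (hmem t).1, (hmem t).2, hLdef, angularMomenta]
  have hdy : ∀ t, HasDerivAt y ((-(T 0 * (2 * h) * γ t (Sum.inl 3))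
      + 2 * T 2 * L t 2 * γ t (Sum.inr 0)) / ν) t := by
    intro t
    convert! (hi (Sum.inr 3) t).div_const ν using 1
    simp [prolateField, (hmem t).2, hH, hLdef, angularMomenta]
    ring
  have hsin : Continuous fun θ => r₁ * Real.sin θ ^ 2 := by fun_prop
  -- The components x₁ and y₁ in the equations for x₄ and y₄ are eliminated by means of
  -- `position_eq`. The term u²/Q that appears in the rotation rate is s.
  have hζ : ∀ t, HasDerivAt (fun t => (x t : ℂ) + Complex.I * y t)
      ((((-(2 * T 2 * L t 2 * (L t 0 * L t 4 + L t 1 * L t 5) / Q t) : ℝ) : ℂ)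
        + Complex.I * ((-ν * (T 0 + 2 * (T 2 * (r₁ * Real.sin (Φ t) ^ 2))) : ℝ) : ℂ))
        * ((x t : ℂ) + Complex.I * y t)) t := by
    intro t
    have hne := (hQpos t).ne'
    have e1 : r₁ * Real.sin (Φ t) ^ 2 = L t 2 ^ 2 / Q t := by
      rw [eq_div_iff hne, hQs t]
    have e2 : γ t (Sum.inl 0) = (-(x t * (L t 0 * L t 4 + L t 1 * L t 5))
        + γ t (Sum.inr 3) * L t 2) / Q t := by
      rw [eq_div_iff hne]
      have := (hpos0 t).1
      rw [hM0, hQx] at this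
      rw [mul_comm, this]
      simp [hx, hLdef, angularMomenta]
      ring
    have e3 : γ t (Sum.inr 0) = (-(γ t (Sum.inr 3) * (L t 0 * L t 4 + L t 1 * L t 5))
        - 2 * h * x t * L t 2) / Q t := by
      rw [eq_div_iff hne]
      have := (hpos0 t).2
      rw [hM0, hQx] at this
      rw [mul_comm, this]
      simp [hx, hLdef, angularMomenta]
      ring
    have e4 : γ t (Sum.inr 3) = ν * y t := by rw [hy]; field_simp
    rw [e1]
    refine hasDerivAt_planar ?_ ?_
    · convert! hdx t using 1
      rw [e2, e4]
      field_simp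
      ring
    · convert! hdy t using 1
      rw [e3, e4, ← νsq]
      change _ = (-(T 0 * ν ^ 2 * x t) + _) / ν
      field_simp
      ring
  have hα : Continuous fun t => -(2 * T 2 * L t 2 * (L t 0 * L t 4 + L t 1 * L t 5) / Q t) := by
    have hcL : ∀ i, Continuous fun t => L t i := fun i =>
      continuous_iff_continuousAt.2 fun t => (hasDerivAt_pi.1 (hL t) i).continuousAt
    exact (Continuous.div (by fun_prop) (by fun_prop) fun t => (hQpos t).ne').neg
  have hB : ∀ t, HasDerivAt (fun t => -ν * (T 0 * t + 2 * ∫ θ in (0 : ℝ)..Φ t,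
      r₁ * Real.sin θ ^ 2 / phaseSpeed b h r₁ r₂ θ))
      (-ν * (T 0 + 2 * (T 2 * (r₁ * Real.sin (Φ t) ^ 2)))) t := by
    intro t
    have := (((hasDerivAt_id t).const_mul (T 0)).add
      ((hasDerivAt_integral_comp_angle R hΦ hsin t).const_mul 2)).const_mul (-ν)
    rw [mul_one] at this
    exact this
  have hsol := eq_mul_exp_of_hasDerivAt hα hB hζ 1
  have hphase : ∀ m : ℤ, T 2 = m * periodG b h r₁ r₂ →
      -ν * (T 0 * 1 + 2 * ∫ θ in (0 : ℝ)..Φ 1, r₁ * Real.sin θ ^ 2 / phaseSpeed b h r₁ r₂ θ)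
      - -ν * (T 0 * 0 + 2 * ∫ θ in (0 : ℝ)..Φ 0, r₁ * Real.sin θ ^ 2 / phaseSpeed b h r₁ r₂ θ)
      = -ν * (T 0 + 2 * m * periodH b h r₁ r₂) := by
    intro m hm
    have := integral_comp_angle_sub R hsin (fun θ => by simp) ((angle_advance_iff R hΦ m).2 hm)
    rw [periodH]
    linear_combination (-ν * 2) * this
  have nsq : ∀ t, ‖(x t : ℂ) + Complex.I * y t‖ = √(Q t / (2 * h)) := fun t => by
    rw [mul_comm, Complex.norm_add_mul_I, hxy]
  have hζ0 : (x 0 : ℂ) + Complex.I * y 0 ≠ 0 := by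
    rw [← norm_ne_zero_iff, nsq]
    have := hQpos 0
    positivity
  have hnorm : L 1 = L 0 → ‖(x 1 : ℂ) + Complex.I * y 1‖ = ‖(x 0 : ℂ) + Complex.I * y 0‖ := by
    intro h1; rw [nsq, nsq, hQ]; simp only [h1]
  constructor
  · intro hret
    have hLret : L 1 = L 0 := by simp only [hLdef, hret]
    obtain ⟨m, k, hm, hk'⟩ := hred.1 hLret
    rw [hphase m hm] at hsol
    obtain ⟨j, hj⟩ := (eq_iff_phase_of_norm_eq hζ0 (Real.exp_pos _) hsol (hnorm hLret)).1
      (by simp only [hx, hy, hret])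
    -- The phase is -√(2h) times T₀ + 2m·`periodH`, which reverses the sign of the winding number.
    refine ⟨m, k, -j, hm, hk', ?_⟩
    push_cast
    field_simp
    linear_combination -hj
  · rintro ⟨m, k, j, hm, hk', hj⟩
    have hLret : L 1 = L 0 := hred.2 ⟨m, k, hm, hk'⟩
    rw [hphase m hm] at hsol
    have hζret := (eq_iff_phase_of_norm_eq hζ0 (Real.exp_pos _) hsol (hnorm hLret)).2
      ⟨-j, by rw [hj]; push_cast; field_simp; ring⟩
    have hre := congrArg Complex.re hζret
    have him := congrArg Complex.im hζret
    simp at hre him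
    have e3 : γ 1 (Sum.inl 3) = γ 0 (Sum.inl 3) := hre
    have e3' : γ 1 (Sum.inr 3) = γ 0 (Sum.inr 3) := by
      have : γ 1 (Sum.inr 3) / ν = γ 0 (Sum.inr 3) / ν := him
      field_simp at this
      exact this
    have hne := (hQpos 0).ne'
    have hang := angMom_congr hLret
    funext i
    rcases i with i | i
    · have p1 := (position_eq (hmem 1) (hH 1) i).1
      have p0 := (position_eq (hmem 0) (hH 0) i).1
      simp only [hang, e3, e3'] at p1
      rw [hQx] at p1 p0
      exact mul_left_cancel₀ hne (p1.trans p0.symm)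
    · have p1 := (position_eq (hmem 1) (hH 1) i).2
      have p0 := (position_eq (hmem 0) (hH 0) i).2
      simp only [hang, e3, e3'] at p1
      rw [hQx] at p1 p0
      exact mul_left_cancel₀ hne (p1.trans p0.symm)

/-! ### Regular values -/

theorem exists_reduced_point (hb : 0 < b) (hg : 0 < g) (hg' : g < b * (2 * h - l ^ 2)) :
    ∃ L ∈ reducedSpace h, reducedProlateMap b L = ![l, g] := by
  have h1 : 0 ≤ g / b := by positivity
  have h2 : 0 ≤ (b * (2 * h - l ^ 2) - g) / b := div_nonneg (by linarith) hb.le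
  -- The point with u = 0, A = g/b and B = k/b; only ℓ₁₂, ℓ₂₃ and ℓ₂₄ are allowed to be nonzero.
  refine ⟨![√(g / b), 0, 0, l, √((b * (2 * h - l ^ 2) - g) / b), 0], ⟨?_, ?_⟩, ?_⟩
  · simp [Real.sq_sqrt h1, Real.sq_sqrt h2]; field_simp; ring
  · simp [Real.sq_sqrt h1, Real.sq_sqrt h2]; field_simp; ring
  · simp [reducedProlateMap, Real.sq_sqrt h1]; field_simp

theorem exists_prolate_point (hb : 0 < b) (hg : 0 < g) (hg' : g < b * (2 * h - l ^ 2)) :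
    ∃ z ∈ cotangentS3, prolateMap b z = ![h, l, g] := by
  have h1 : 0 ≤ g / b := by positivity
  have h2 : 0 ≤ (b * (2 * h - l ^ 2) - g) / b := div_nonneg (by linarith) hb.le
  -- A lift of the same angular momenta with x the second basis vector, for which ℓ₁₂ = -y₁, ℓ₂₃ =
  -- y₃ and ℓ₂₄ = y₄.
  refine ⟨Sum.elim ![0, 1, 0, 0] ![-√(g / b), 0, l, √((b * (2 * h - l ^ 2) - g) / b)],
    ⟨?_, ?_⟩, ?_⟩
  · simp [Fin.sum_univ_four]
  · simp [Fin.sum_univ_four]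
  · simp [prolateMap, angMom, Fin.sum_univ_four, Real.sq_sqrt h1, Real.sq_sqrt h2]
    constructor <;> field_simp
    ring

/-- The return condition does not depend on the point of the fibre, so a single point is enough in
one direction. Completeness of the flow gives the other. -/
theorem mem_periodLattice_prolate_iff (R : ProlateRoots b h l g r₁ r₂)
    (hrot : IsRotation b h l r₁ r₂ rot) (hg : 0 < g) (hg' : g < b * (2 * h - l ^ 2))
    {T : Fin 3 → ℝ} :
    T ∈ periodLattice diracMatrix cotangentS3 (prolateMap b) ![h, l, g] ↔
      ∃ m k j : ℤ, T 2 = m * periodG b h r₁ r₂ ∧ T 1 = k * (2 * Real.pi) - m * rot ∧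
        T 0 = j * (2 * Real.pi / √(2 * h)) - 2 * m * periodH b h r₁ r₂ := by
  rw [mem_periodLattice_prolate]
  constructor
  · intro hT
    obtain ⟨z, hz, hzc⟩ := exists_prolate_point (by linarith [R.one_lt_b]) hg hg'
    obtain ⟨γ, h0, h1, hmem, hγ⟩ := hT z hz hzc
    exact (prolate_return_iff R hrot hγ hmem (h0.symm ▸ hzc)).1 (h1.trans h0.symm)
  · intro hT z hz hzc
    obtain ⟨γ, h0, hmem, hγ⟩ := exists_prolateFlow b T hz
    exact ⟨γ, h0, ((prolate_return_iff R hrot hγ hmem (h0.symm ▸ hzc)).2 hT).trans h0, hmem, hγ⟩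

theorem mem_periodLattice_reduced_iff (R : ProlateRoots b h l g r₁ r₂)
    (hrot : IsRotation b h l r₁ r₂ rot) (hg : 0 < g) (hg' : g < b * (2 * h - l ^ 2))
    {T : Fin 2 → ℝ} :
    T ∈ periodLattice liePoissonMatrix (reducedSpace h) (reducedProlateMap b) ![l, g] ↔
      ∃ m k : ℤ, T 1 = m * periodG b h r₁ r₂ ∧ T 0 = k * (2 * Real.pi) - m * rot := by
  rw [mem_periodLattice_reduced]
  constructor
  · intro hT
    obtain ⟨z, hz, hzc⟩ := exists_reduced_point (by linarith [R.one_lt_b]) hg hg'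
    obtain ⟨γ, h0, h1, hγ⟩ := hT z hz hzc
    exact (reduced_return_iff R hrot hγ (h0.symm ▸ hz) (h0.symm ▸ hzc)).1 (h1.trans h0.symm)
  · intro hT z hz hzc
    obtain ⟨γ, h0, hγ⟩ := exists_reducedFlow b T z
    exact ⟨γ, h0, ((reduced_return_iff R hrot hγ (h0.symm ▸ hz) (h0.symm ▸ hzc)).2 hT).trans h0, hγ⟩

end PeriodLattices

/-! ### Regular values -/

section RegularValues

variable {b h l g : ℝ}

/-- The values `(h, l, g)` with `0 < g < b (2 h - l²)` and `(l, g) ≠ (0, 2 h)`. -/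
def IsRegularValue (b h l g : ℝ) : Prop :=
  0 < g ∧ g < b * (2 * h - l ^ 2) ∧ ¬ (l = 0 ∧ g = 2 * h)

theorem linearIndependent_hamVF_reduced_iff {L : Fin 6 → ℝ} :
    LinearIndependent ℝ (fun k => hamVF liePoissonMatrix (fun w => reducedProlateMap b w k) L) ↔
      ∀ T : Fin 2 → ℝ, reducedField b T L = 0 → T = 0 := by
  have h1 : ∀ k, hamVF liePoissonMatrix (fun w => reducedProlateMap b w k) L
      = reducedField b (Pi.single k 1) L := by
    intro k
    rw [← hamVF_reducedProlate]
    congr 1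
    funext w
    simp [Pi.single_apply]
  have h2 : ∀ T : Fin 2 → ℝ, ∑ k, T k • reducedField b (Pi.single k 1) L = reducedField b T L := by
    intro T
    funext i
    fin_cases i <;> simp [reducedField, Fin.sum_univ_two, Pi.single_apply] <;> ring
  rw [Fintype.linearIndependent_iff]
  simp only [h1, h2]
  exact forall₂_congr fun T _ => ⟨fun h => funext h, fun h i => congrFun h i⟩

theorem linearIndependent_hamVF_prolate_iff {z : Fin 4 ⊕ Fin 4 → ℝ} (hz : z ∈ cotangentS3) :
    LinearIndependent ℝ (fun k => hamVF diracMatrix (fun w => prolateMap b w k) z) ↔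
      ∀ T : Fin 3 → ℝ, prolateField b T z = 0 → T = 0 := by
  have h1 : ∀ k, hamVF diracMatrix (fun w => prolateMap b w k) z
      = prolateField b (Pi.single k 1) z := by
    intro k
    rw [← hamVF_prolate b _ hz]
    congr 1
    funext w
    simp [Pi.single_apply]
  have h2 : ∀ T : Fin 3 → ℝ, ∑ k, T k • prolateField b (Pi.single k 1) z = prolateField b T z := by
    intro T
    funext i
    rcases i with i | i <;> fin_cases i <;>
      simp [prolateField, Fin.sum_univ_three, Pi.single_apply] <;> ring
  rw [Fintype.linearIndependent_iff]
  simp only [h1, h2]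
  exact forall₂_congr fun T _ => ⟨fun h => funext h, fun h i => congrFun h i⟩

/-- If the coefficient of G is not zero, a critical point is an equilibrium for (u, w), so w = 0 and
u(bl² + B + (b - 1)A) = 0. Here u = 0 gives AB = 0, that is g = 0 or k = 0, and otherwise A = B = l
= 0, that is g = 2h. If only ℓ₂₃ occurs, a fixed point of its rotation has A = B = 0, which leads to
the same values. -/
theorem reducedField_injective (hb : 1 < b) (hreg : IsRegularValue b h l g) {L : Fin 6 → ℝ}
    (hL : L ∈ reducedSpace h) (hc : reducedProlateMap b L = ![l, g]) {T : Fin 2 → ℝ}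
    (hT : reducedField b T L = 0) : T = 0 := by
  obtain ⟨hg, hg', hne⟩ := hreg
  have O := orbitValues_of_mem hL hc
  have hcross := cross_eq_of_mem_reducedSpace hL
  have h3 := (reducedProlateMap_eq_iff.1 hc).1
  rw [h3] at hcross
  set A := L 0 ^ 2 + L 1 ^ 2 with hA
  set B := L 4 ^ 2 + L 5 ^ 2 with hB
  have hA0 := O.a_nonneg; have hB0 := O.b_nonneg
  have hK : 0 < b * B + (b - 1) * L 2 ^ 2 := by
    have : b * B + (b - 1) * L 2 ^ 2 = b * (2 * h - l ^ 2) - g := by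
      linear_combination b * O.h_eq - O.g_eq
    linarith
  have hcrit : A = 0 → B = 0 → l = 0 → False := by
    intro h1 h2 h4
    refine hne ⟨h4, ?_⟩
    have e1 := O.g_eq; have e2 := O.h_eq
    rw [h1] at e1 e2; rw [h2, h4] at e2
    linarith
  have e0 : 2 * b * T 1 * L 3 * L 1 + 2 * T 1 * L 4 * L 2 - T 0 * L 1 = 0 := congrFun hT 0
  have e1 : -(2 * b * T 1 * L 3 * L 0) + 2 * T 1 * L 5 * L 2 + T 0 * L 0 = 0 := congrFun hT 1
  have e2 : -(2 * b * T 1 * (L 4 * L 0 + L 5 * L 1)) = 0 := congrFun hT 2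
  have e4 : 2 * (b - 1) * T 1 * L 2 * L 0 - T 0 * L 5 = 0 := congrFun hT 4
  have e5 : 2 * (b - 1) * T 1 * L 2 * L 1 + T 0 * L 4 = 0 := congrFun hT 5
  have hT1 : T 1 = 0 := by
    by_contra hT1
    have hw : L 0 * L 4 + L 1 * L 5 = 0 := by
      have h5 : (2 * b * T 1) * (L 0 * L 4 + L 1 * L 5) = 0 := by linear_combination -e2
      have h6 : 2 * b * T 1 ≠ 0 := by
        have : b ≠ 0 := by linarith
        positivity
      exact (mul_eq_zero.1 h5).resolve_left h6
    -- This is the derivative of w along the field, which vanishes because the field does.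
    have hf : 2 * T 1 * (L 2 * (b * l ^ 2 + B + (b - 1) * A)) = 0 := by
      rw [h3] at e0 e1
      linear_combination L 4 * e0 + L 5 * e1 + L 0 * e4 + L 1 * e5
        + (2 * b * T 1 * l) * hcross
    have hf' := (mul_eq_zero.1 hf).resolve_left (by positivity)
    have hwsq := O.w_sq
    rw [hw] at hwsq
    rcases mul_eq_zero.1 hf' with hu | hs
    · have hge := O.g_eq
      rw [hu] at hwsq hK hge
      have hAB : A * B = 0 := by linear_combination -hwsq
      rcases mul_eq_zero.1 hAB with h5 | h5
      · rw [h5] at hge; linarith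
      · rw [h5] at hK; linarith
    · have p1 : 0 ≤ b * l ^ 2 := by have : 0 < b := by linarith
                                    positivity
      have p2 : 0 ≤ (b - 1) * A := mul_nonneg (by linarith) hA0
      have q1 : b * l ^ 2 = 0 := by linarith
      have q2 : (b - 1) * A = 0 := by linarith
      have q3 : B = 0 := by linarith
      have hb0 : b ≠ 0 := by linarith
      have hb1 : b - 1 ≠ 0 := by linarith
      exact hcrit ((mul_eq_zero.1 q2).resolve_left hb1) q3
        (pow_eq_zero_iff two_ne_zero |>.1 ((mul_eq_zero.1 q1).resolve_left hb0))
  have hT0 : T 0 = 0 := by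
    by_contra hT0
    rw [hT1] at e0 e1 e4 e5
    have f0 : L 0 = 0 := by simpa [hT0] using e1
    have f1 : L 1 = 0 := by simpa [hT0] using e0
    have f4 : L 4 = 0 := by simpa [hT0] using e5
    have f5 : L 5 = 0 := by simpa [hT0] using e4
    have hA' : A = 0 := by rw [hA, f0, f1]; ring
    have hB' : B = 0 := by rw [hB, f4, f5]; ring
    rw [f0, f1] at hcross
    have hul : L 2 * l = 0 := by linarith
    rcases mul_eq_zero.1 hul with h5 | h5
    · rw [hB', h5] at hK; linarith
    · exact hcrit hA' hB' h5
  funext i; fin_cases i <;> assumption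

theorem regularValues_reduced (hb : 1 < b) (hh : 0 < h) :
    regularValues liePoissonMatrix (reducedSpace h) (reducedProlateMap b)
      = {c | IsRegularValue b h (c 0) (c 1)} := by
  have hb0 : 0 < b := by linarith
  have hext : ∀ c : Fin 2 → ℝ, c = ![c 0, c 1] := fun c => by
    funext i; fin_cases i <;> rfl
  ext c
  constructor
  · rintro ⟨⟨L, hL, hLc⟩, hind⟩
    rw [hext c] at hLc
    have O := orbitValues_of_mem hL hLc
    obtain ⟨h3, h4⟩ := reducedProlateMap_eq_iff.1 hLc
    have hK : b * (L 4 ^ 2 + L 5 ^ 2) + (b - 1) * L 2 ^ 2 = b * (2 * h - c 0 ^ 2) - c 1 := by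
      linear_combination b * O.h_eq - O.g_eq
    have hb1 : 0 < b - 1 := by linarith
    have hL' := linearIndependent_hamVF_reduced_iff.1 (hind L hL (hLc.trans (hext c).symm))
    refine ⟨?_, ?_, ?_⟩
    · by_contra hg
      have hz : b * L 0 ^ 2 + b * L 1 ^ 2 + L 2 ^ 2 = 0 :=
        le_antisymm (by linarith) (by positivity)
      have p0 : 0 ≤ b * L 0 ^ 2 := by positivity
      have p1 : 0 ≤ b * L 1 ^ 2 := by positivity
      have p2 : 0 ≤ L 2 ^ 2 := by positivity
      have q0 : L 0 = 0 := by
        have : b * L 0 ^ 2 = 0 := by linarith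
        simpa [hb0.ne'] using this
      have q1 : L 1 = 0 := by
        have : b * L 1 ^ 2 = 0 := by linarith
        simpa [hb0.ne'] using this
      have q2 : L 2 = 0 := by
        have : L 2 ^ 2 = 0 := by linarith
        simpa using this
      have := congrFun (hL' ![0, 1] (by
        funext i; fin_cases i <;> simp [reducedField, q0, q1, q2])) 1
      simp at this
    · by_contra hg
      have p0 : 0 ≤ b * (L 4 ^ 2 + L 5 ^ 2) := by positivity
      have p1 : 0 ≤ (b - 1) * L 2 ^ 2 := by positivity
      have q2 : L 2 = 0 := by
        have : (b - 1) * L 2 ^ 2 = 0 := by linarith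
        simpa [hb1.ne'] using this
      have q3 : L 4 ^ 2 + L 5 ^ 2 = 0 := by
        have : b * (L 4 ^ 2 + L 5 ^ 2) = 0 := by linarith
        exact (mul_eq_zero.1 this).resolve_left hb0.ne'
      have q4 : L 4 = 0 := by
        have : L 4 ^ 2 = 0 := by linarith [sq_nonneg (L 4), sq_nonneg (L 5)]
        simpa using this
      have q5 : L 5 = 0 := by
        have : L 5 ^ 2 = 0 := by linarith [sq_nonneg (L 4), sq_nonneg (L 5)]
        simpa using this
      -- On the upper boundary the nonnegative function b(2h - ℓ₂₃²) - G = b(ℓ₂₄² + ℓ₃₄²) + (b -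
      -- 1)ℓ₁₄² vanishes, so it is critical there. Its negative differential supplies the
      -- coefficients.
      have := congrFun (hL' ![2 * b * L 3, 1] (by
        funext i; fin_cases i <;> simp [reducedField, q2, q4, q5])) 1
      simp at this
    · rintro ⟨hl, hg⟩
      -- The fibre over (0, 2h) contains a point at which only ℓ₁₄ is nonzero, and the field of G
      -- vanishes there.
      obtain ⟨ν, hsq⟩ : ∃ ν : ℝ, ν ^ 2 = 2 * h := ⟨_, Real.sq_sqrt (by linarith)⟩
      have hmem : (![0, 0, ν, 0, 0, 0] : Fin 6 → ℝ) ∈ reducedSpace h := by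
        constructor <;> simp [hsq]
      have hval : reducedProlateMap b ![0, 0, ν, 0, 0, 0] = c := by
        rw [hext c, hl, hg]
        simp [reducedProlateMap, hsq]
      have := congrFun (linearIndependent_hamVF_reduced_iff.1 (hind _ hmem hval) ![0, 1] (by
        funext i; fin_cases i <;> simp [reducedField])) 1
      simp at this
  · intro hreg
    refine ⟨?_, fun L hL hLc => linearIndependent_hamVF_reduced_iff.2 fun T hT =>
      reducedField_injective hb hreg hL (hLc.trans (hext c)) hT⟩
    obtain ⟨L, hL, hLc⟩ := exists_reduced_point hb0 hreg.1 hreg.2.1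
    exact ⟨L, hL, hLc.trans (hext c).symm⟩

/-- On T*S³ the geodesic field is the matrix of angular momenta acting on x and on y. In this form
it can be compared term by term with the fields of ℓ₂₃ and G. -/
theorem momenta_eq {z : Fin 4 ⊕ Fin 4 → ℝ} (hz : z ∈ cotangentS3) (i : Fin 4) :
    z (Sum.inr i) = ∑ j, angMom z j i * z (Sum.inl j) ∧
      -(z (Sum.inl i) * ∑ j, z (Sum.inr j) ^ 2) = ∑ j, angMom z j i * z (Sum.inr j) := by
  obtain ⟨h1, h2⟩ := hz
  simp only [angMom, Fin.sum_univ_four] at *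
  constructor
  · linear_combination (-(z (Sum.inr i))) * h1 + z (Sum.inl i) * h2
  · linear_combination -(z (Sum.inr i)) * h2

theorem regularValues_prolate (hb : 1 < b) :
    regularValues diracMatrix cotangentS3 (prolateMap b)
      = {c | IsRegularValue b (c 0) (c 1) (c 2)} := by
  have hb0 : 0 < b := by linarith
  have hext : ∀ c : Fin 3 → ℝ, c = ![c 0, c 1, c 2] := fun c => by
    funext i; fin_cases i <;> rfl
  ext c
  constructor
  · rintro ⟨⟨z, hz, hzc⟩, hind⟩
    have hL := angularMomenta_mem (b := b) hz
    have hLc := reducedProlateMap_angularMomenta b z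
    rw [hzc] at hL hLc
    have O := orbitValues_of_mem hL hLc
    obtain ⟨h3, h4⟩ := reducedProlateMap_eq_iff.1 hLc
    set L := angularMomenta z with hLdef
    have hK : b * (L 4 ^ 2 + L 5 ^ 2) + (b - 1) * L 2 ^ 2 = b * (2 * c 0 - c 1 ^ 2) - c 2 := by
      linear_combination b * O.h_eq - O.g_eq
    have hb1 : 0 < b - 1 := by linarith
    have hz' := (linearIndependent_hamVF_prolate_iff hz).1 (hind z hz hzc)
    refine ⟨?_, ?_, ?_⟩
    · by_contra hg
      have hz0 : b * L 0 ^ 2 + b * L 1 ^ 2 + L 2 ^ 2 = 0 :=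
        le_antisymm (by linarith) (by positivity)
      have p0 : 0 ≤ b * L 0 ^ 2 := by positivity
      have p1 : 0 ≤ b * L 1 ^ 2 := by positivity
      have p2 : 0 ≤ L 2 ^ 2 := by positivity
      have q0 : angMom z 0 1 = 0 := by
        have : b * L 0 ^ 2 = 0 := by linarith
        simpa [hb0.ne', hLdef, angularMomenta] using this
      have q1 : angMom z 0 2 = 0 := by
        have : b * L 1 ^ 2 = 0 := by linarith
        simpa [hb0.ne', hLdef, angularMomenta] using this
      have q2 : angMom z 0 3 = 0 := by
        have : L 2 ^ 2 = 0 := by linarith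
        simpa [hLdef, angularMomenta] using this
      have := congrFun (hz' ![0, 0, 1] (by
        funext i
        rcases i with i | i <;> fin_cases i <;> simp [prolateField, q0, q1, q2])) 2
      simp at this
    · by_contra hg
      have p0 : 0 ≤ b * (L 4 ^ 2 + L 5 ^ 2) := by positivity
      have p1 : 0 ≤ (b - 1) * L 2 ^ 2 := by positivity
      have q2 : angMom z 0 3 = 0 := by
        have : (b - 1) * L 2 ^ 2 = 0 := by linarith
        simpa [hb1.ne', hLdef, angularMomenta] using this
      have q3 : L 4 ^ 2 + L 5 ^ 2 = 0 := by
        have : b * (L 4 ^ 2 + L 5 ^ 2) = 0 := by linarith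
        exact (mul_eq_zero.1 this).resolve_left hb0.ne'
      have q4 : angMom z 1 3 = 0 := by
        have : L 4 ^ 2 = 0 := by linarith [sq_nonneg (L 4), sq_nonneg (L 5)]
        simpa [hLdef, angularMomenta] using this
      have q5 : angMom z 2 3 = 0 := by
        have : L 5 ^ 2 = 0 := by linarith [sq_nonneg (L 4), sq_nonneg (L 5)]
        simpa [hLdef, angularMomenta] using this
      have hy := fun i => (momenta_eq hz i).1
      have hx := fun i => (momenta_eq hz i).2
      have hself : ∀ i, angMom z i i = 0 := fun i => by simp [angMom]
      have hanti := angMom_antisymm z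
      -- The coefficients are those of the differential of G - b(2H - ℓ₂₃²). This function is at
      -- most 0 on T*S³ and vanishes at the point, hence is critical there.
      have := congrFun (hz' ![-(2 * b), 2 * b * angMom z 1 2, 1] (by
        funext i
        have hyi : ∀ i, z (Sum.inr i) * ∑ j, z (Sum.inl j) ^ 2
            - z (Sum.inl i) * ∑ j, z (Sum.inl j) * z (Sum.inr j)
            = ∑ j, angMom z j i * z (Sum.inl j) := fun i => by
          rw [hz.1, hz.2, ← hy i]; ring
        have hxi : ∀ i, z (Sum.inr i) * ∑ j, z (Sum.inl j) * z (Sum.inr j)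
            - z (Sum.inl i) * ∑ j, z (Sum.inr j) ^ 2
            = ∑ j, angMom z j i * z (Sum.inr j) := fun i => by
          rw [hz.2, ← hx i]; ring
        simp only [prolateField, hyi, hxi]
        have a10 := hanti 0 1; have a20 := hanti 0 2; have a30 := hanti 0 3
        have a21 := hanti 1 2; have a31 := hanti 1 3; have a32 := hanti 2 3
        rcases i with i | i <;> fin_cases i <;>
          simp [Fin.sum_univ_four, hself, a10, a20, a30, a21, a31, a32, q2, q4, q5] <;> ring)) 2
      simp at this
    · rintro ⟨hl, hg⟩
      have hh : 0 ≤ 2 * c 0 := by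
        rw [← O.h_eq]
        linarith [O.a_nonneg, O.b_nonneg, sq_nonneg (L 2), sq_nonneg (c 1)]
      obtain ⟨ν, hsq⟩ : ∃ ν : ℝ, ν ^ 2 = 2 * c 0 := ⟨_, Real.sq_sqrt hh⟩
      set z₀ : Fin 4 ⊕ Fin 4 → ℝ := Sum.elim ![1, 0, 0, 0] ![0, 0, 0, ν] with hz₀
      have hmem : z₀ ∈ cotangentS3 := by
        constructor <;> simp [hz₀, Fin.sum_univ_four]
      have hval : prolateMap b z₀ = c := by
        rw [hext c, hl, hg]
        simp [hz₀, prolateMap, Fin.sum_univ_four, angMom, hsq]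
      -- Where only ℓ₁₄ is nonzero, G - 2H is a combination of squares of the vanishing angular
      -- momenta, so its differential is zero.
      have := congrFun ((linearIndependent_hamVF_prolate_iff hmem).1 (hind _ hmem hval)
        ![-2, 0, 1] (by
          funext i
          rcases i with i | i <;> fin_cases i <;>
            simp [hz₀, prolateField, Fin.sum_univ_four, angMom, hsq]
          linarith)) 2
      simp at this
  · intro hreg
    have hh : 0 < c 0 := by nlinarith [hreg.1, hreg.2.1, sq_nonneg (c 1)]
    refine ⟨?_, fun z hz hzc => (linearIndependent_hamVF_prolate_iff hz).2 fun T hT => ?_⟩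
    · obtain ⟨z, hz, hzc⟩ := exists_prolate_point hb0 hreg.1 hreg.2.1
      exact ⟨z, hz, hzc.trans (hext c).symm⟩
    · have hL := angularMomenta_mem (b := b) hz
      have hLc := reducedProlateMap_angularMomenta b z
      rw [hzc] at hL hLc
      -- A zero of the field on T*S³ is a constant integral curve. Its image under the angular
      -- momenta is again constant, hence a zero of the reduced field.
      have hconst : HasDerivAt (fun _ : ℝ => z) (prolateField b T z) 0 := by
        rw [hT]; exact hasDerivAt_const _ _
      have hred := (hasDerivAt_angularMomenta (t := 0) hconst).unique (hasDerivAt_const _ _)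
      have hT' := reducedField_injective hb hreg hL hLc hred
      have hT1 : T 1 = 0 := congrFun hT' 0
      have hT2 : T 2 = 0 := congrFun hT' 1
      have hT0 : T 0 = 0 := by
        by_contra hT0
        have hy : ∀ i, z (Sum.inr i) = 0 := by
          intro i
          have := congrFun hT (Sum.inl i)
          fin_cases i <;> simpa [prolateField, hz.1, hz.2, hT1, hT2, hT0] using this
        have h2 : (∑ i, z (Sum.inr i) ^ 2) / 2 = c 0 := congrFun hzc 0
        simp [hy] at h2
        linarith
      funext i; fin_cases i <;> assumption

end RegularValues

/-! ### The separated action integrals -/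

section SeparatedIntegral

/-- The separated momentum with branch points `0`, `ρ₁`, `ρ₂`, `b` and pole `e`, times `ds/dθ`,
where `s = ρ₁ sin² θ`. -/
noncomputable def sepIntegrand (b e ν ρ₁ ρ₂ θ : ℝ) : ℝ :=
  ν * (ρ₁ * Real.cos θ ^ 2 * (√(ρ₂ - ρ₁ * Real.sin θ ^ 2) / √(b - ρ₁ * Real.sin θ ^ 2))
    / (e - ρ₁ * Real.sin θ ^ 2))

/-- The action integral over a full cycle of the angle `θ`. -/
noncomputable def sepIntegral (b e ν ρ₁ ρ₂ : ℝ) : ℝ :=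
  ∫ θ in (0 : ℝ)..2 * Real.pi, sepIntegrand b e ν ρ₁ ρ₂ θ

variable {b e ν ρ₁ ρ₂ : ℝ}

theorem mul_sin_sq_le_self (h1 : 0 < ρ₁) (θ : ℝ) : ρ₁ * Real.sin θ ^ 2 ≤ ρ₁ := by
  nlinarith [Real.sin_sq_le_one θ]

theorem continuous_sepIntegrand (h1 : 0 < ρ₁) (h3 : ρ₁ < b) (h4 : ρ₁ < e) :
    Continuous (sepIntegrand b e ν ρ₁ ρ₂) := by
  have hb : ∀ θ, √(b - ρ₁ * Real.sin θ ^ 2) ≠ 0 := fun θ => by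
    have := mul_sin_sq_le_self h1 θ
    exact (Real.sqrt_pos.2 (by linarith)).ne'
  have he : ∀ θ, e - ρ₁ * Real.sin θ ^ 2 ≠ 0 := fun θ => by
    have := mul_sin_sq_le_self h1 θ
    linarith
  unfold sepIntegrand
  fun_prop (disch := first | exact hb | exact he | skip)

/-- Under s = ρ₁ sin² θ the Jacobian cancels the inverse square root at s = 0 and smooths the square
root at s = ρ₁. The interval of integration no longer depends on the parameters. -/
theorem integral_sqrt_eq_integral_sepIntegrand (hν : 0 ≤ ν) (h1 : 0 < ρ₁) (h2 : ρ₁ < ρ₂)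
    (h3 : ρ₁ < b) (h4 : ρ₁ < e) :
    ∫ s in (0 : ℝ)..ρ₁, √(ν ^ 2 * ((ρ₁ - s) * (ρ₂ - s)) / (4 * s * (b - s) * (e - s) ^ 2))
      = ∫ θ in (0 : ℝ)..Real.pi / 2, sepIntegrand b e ν ρ₁ ρ₂ θ := by
  have hπ : (0 : ℝ) ≤ Real.pi / 2 := by positivity
  have key := intervalIntegral.integral_comp_mul_deriv_of_deriv_nonneg (a := 0) (b := Real.pi / 2)
    (f := fun θ => ρ₁ * Real.sin θ ^ 2) (f' := fun θ => ρ₁ * (2 * Real.sin θ * Real.cos θ))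
    (g := fun s => √(ν ^ 2 * ((ρ₁ - s) * (ρ₂ - s)) / (4 * s * (b - s) * (e - s) ^ 2)))
    (by fun_prop)
    (fun θ _ => by
      have := ((Real.hasDerivAt_sin θ).pow 2).const_mul ρ₁
      exact this.congr_deriv (by norm_num))
    (fun θ hθ => by
      rw [min_eq_left hπ, max_eq_right hπ] at hθ
      have := Real.sin_pos_of_pos_of_lt_pi hθ.1 (by linarith [hθ.2])
      have := Real.cos_pos_of_mem_Ioo ⟨by linarith [hθ.1], hθ.2⟩
      positivity)
  simp only [Real.sin_zero, Real.sin_pi_div_two, ne_eq, OfNat.ofNat_ne_zero, not_false_eq_true,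
    zero_pow, mul_zero, one_pow, mul_one] at key
  rw [← key]
  refine intervalIntegral.integral_congr_Ioo_of_le hπ fun θ hθ => ?_
  have hs := Real.sin_pos_of_pos_of_lt_pi hθ.1 (by linarith [hθ.2])
  have hc := Real.cos_pos_of_mem_Ioo ⟨by linarith [hθ.1], hθ.2⟩
  have hle := mul_sin_sq_le_self h1 θ
  have hB : 0 < b - ρ₁ * Real.sin θ ^ 2 := by linarith
  have hA : 0 < ρ₂ - ρ₁ * Real.sin θ ^ 2 := by linarith
  have hE : 0 < e - ρ₁ * Real.sin θ ^ 2 := by linarith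
  have hcs : ρ₁ - ρ₁ * Real.sin θ ^ 2 = ρ₁ * Real.cos θ ^ 2 := by rw [Real.cos_sq']; ring
  have hval : √(ν ^ 2 * ((ρ₁ - ρ₁ * Real.sin θ ^ 2) * (ρ₂ - ρ₁ * Real.sin θ ^ 2))
      / (4 * (ρ₁ * Real.sin θ ^ 2) * (b - ρ₁ * Real.sin θ ^ 2) * (e - ρ₁ * Real.sin θ ^ 2) ^ 2))
      = ν * Real.cos θ * √(ρ₂ - ρ₁ * Real.sin θ ^ 2)
        / (2 * Real.sin θ * √(b - ρ₁ * Real.sin θ ^ 2) * (e - ρ₁ * Real.sin θ ^ 2)) := by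
    rw [← Real.sqrt_sq (show 0 ≤ ν * Real.cos θ * √(ρ₂ - ρ₁ * Real.sin θ ^ 2)
        / (2 * Real.sin θ * √(b - ρ₁ * Real.sin θ ^ 2) * (e - ρ₁ * Real.sin θ ^ 2)) by positivity),
      hcs]
    congr 1
    rw [div_pow, mul_pow, mul_pow, mul_pow, mul_pow, mul_pow, Real.sq_sqrt hA.le,
      Real.sq_sqrt hB.le]
    field_simp
    ring
  simp only [Function.comp_apply, hval, sepIntegrand]
  have := (Real.sqrt_pos.2 hB).ne'
  field_simp

/-- The integrand depends only on sin² θ and cos² θ. The full cycle is used because exact periodic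
terms integrate to zero over it. -/
theorem sepIntegral_eq_four_mul (h1 : 0 < ρ₁) (h3 : ρ₁ < b) (h4 : ρ₁ < e) :
    sepIntegral b e ν ρ₁ ρ₂ = 4 * ∫ θ in (0 : ℝ)..Real.pi / 2, sepIntegrand b e ν ρ₁ ρ₂ θ := by
  have hc := continuous_sepIntegrand (ν := ν) (ρ₂ := ρ₂) h1 h3 h4
  have hI := fun x y => hc.intervalIntegrable (μ := MeasureTheory.volume) x y
  have e1 : ∫ θ in (0 : ℝ)..Real.pi, sepIntegrand b e ν ρ₁ ρ₂ θ
      = 2 * ∫ θ in (0 : ℝ)..Real.pi / 2, sepIntegrand b e ν ρ₁ ρ₂ θ := by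
    have h := intervalIntegral.integral_comp_sub_left (a := 0) (b := Real.pi / 2)
      (sepIntegrand b e ν ρ₁ ρ₂) Real.pi
    rw [show Real.pi - Real.pi / 2 = Real.pi / 2 by ring, sub_zero] at h
    rw [← intervalIntegral.integral_add_adjacent_intervals (hI 0 (Real.pi / 2)) (hI _ Real.pi),
      ← h, two_mul]
    simp [sepIntegrand]
  have e2 : ∫ θ in Real.pi..2 * Real.pi, sepIntegrand b e ν ρ₁ ρ₂ θ
      = ∫ θ in (0 : ℝ)..Real.pi, sepIntegrand b e ν ρ₁ ρ₂ θ := by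
    have h := intervalIntegral.integral_comp_sub_left (a := 0) (b := Real.pi)
      (sepIntegrand b e ν ρ₁ ρ₂) (2 * Real.pi)
    rw [show 2 * Real.pi - Real.pi = Real.pi by ring, sub_zero] at h
    rw [← h]
    simp [sepIntegrand]
  rw [sepIntegral, ← intervalIntegral.integral_add_adjacent_intervals (hI 0 Real.pi) (hI _ _), e2,
    e1]
  ring

theorem contDiffOn_sepIntegral {E : Type} [NormedAddCommGroup E] [NormedSpace ℝ E] {U : Set E}
    (hU : IsOpen U) {ν ρ₁ ρ₂ : E → ℝ} (hν : ContDiffOn ℝ ∞ ν U) (hρ₁ : ContDiffOn ℝ ∞ ρ₁ U)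
    (hρ₂ : ContDiffOn ℝ ∞ ρ₂ U) (h1 : ∀ c ∈ U, 0 < ρ₁ c) (h2 : ∀ c ∈ U, ρ₁ c < ρ₂ c)
    (h3 : ∀ c ∈ U, ρ₁ c < b) (h4 : ∀ c ∈ U, ρ₁ c < e) :
    ContDiffOn ℝ ∞ (fun p : E × ℝ => sepIntegrand b e (ν p.1) (ρ₁ p.1) (ρ₂ p.1) p.2)
        (U ×ˢ univ) ∧
      ContDiffOn ℝ ∞ (fun c => sepIntegral b e (ν c) (ρ₁ c) (ρ₂ c)) U := by
  have hF : ContDiffOn ℝ ∞ (fun p : E × ℝ => sepIntegrand b e (ν p.1) (ρ₁ p.1) (ρ₂ p.1) p.2)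
      (U ×ˢ univ) := by
    have hm : MapsTo (Prod.fst : E × ℝ → E) (U ×ˢ univ) U := fun p hp => hp.1
    have k0 := hν.comp contDiffOn_fst hm
    have k1 := hρ₁.comp contDiffOn_fst hm
    have k2 := hρ₂.comp contDiffOn_fst hm
    have ks : ContDiffOn ℝ ∞ (fun p : E × ℝ => ρ₁ p.1 * Real.sin p.2 ^ 2) (U ×ˢ univ) :=
      k1.mul ((Real.contDiff_sin.comp contDiff_snd).pow 2).contDiffOn
    have kc : ContDiffOn ℝ ∞ (fun p : E × ℝ => ρ₁ p.1 * Real.cos p.2 ^ 2) (U ×ˢ univ) :=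
      k1.mul ((Real.contDiff_cos.comp contDiff_snd).pow 2).contDiffOn
    have hle : ∀ p ∈ U ×ˢ (univ : Set ℝ), ρ₁ p.1 * Real.sin p.2 ^ 2 ≤ ρ₁ p.1 :=
      fun p hp => mul_sin_sq_le_self (h1 _ hp.1) _
    refine k0.mul ((kc.mul (((k2.sub ks).sqrt fun p hp => ?_).div
      ((contDiffOn_const.sub ks).sqrt fun p hp => ?_) fun p hp => ?_)).div
      (contDiffOn_const.sub ks) fun p hp => ?_)
    · have := hle p hp; have := h2 _ hp.1
      simp only [Function.comp_apply]; linarith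
    · have := hle p hp; have := h3 _ hp.1
      linarith
    · have := hle p hp; have := h3 _ hp.1
      exact (Real.sqrt_pos.2 (by linarith)).ne'
    · have := hle p hp; have := h4 _ hp.1
      linarith
  exact ⟨hF, contDiffOn_intervalIntegral hU hF _ _⟩

/-- The derivative of the integrand of the action along a curve of values is, up to an exact
derivative, the combination of the integrands of the periods. -/
theorem hasDerivAt_sepIntegrand {ν ρ₁ ρ₂ : ℝ → ℝ} {ν' ρ₁' ρ₂' t θ : ℝ} (hν : HasDerivAt ν ν' t)
    (hρ₁ : HasDerivAt ρ₁ ρ₁' t) (hρ₂ : HasDerivAt ρ₂ ρ₂' t) (hν0 : 0 < ν t) (h1 : 0 < ρ₁ t)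
    (h2 : ρ₁ t < ρ₂ t) (h3 : ρ₁ t < b) (h4 : ρ₁ t < 1) {g' h' k' : ℝ}
    (hg' : g' = 2 * ν t * ν' * ρ₁ t * ρ₂ t + ν t ^ 2 * (ρ₁' * ρ₂ t + ρ₁ t * ρ₂'))
    (hh' : h' = ν t * ν')
    (hk' : k' = 2 * ν t * ν' * (1 - ρ₁ t) * (ρ₂ t - 1)
      + ν t ^ 2 * ((1 - ρ₁ t) * ρ₂' - ρ₁' * (ρ₂ t - 1))) :
    ∃ D, HasDerivAt (fun φ => ν t * ρ₁' / 2 * (Real.sin φ * Real.cos φ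
        * (√(ρ₂ t - ρ₁ t * Real.sin φ ^ 2) / √(b - ρ₁ t * Real.sin φ ^ 2))
        / (1 - ρ₁ t * Real.sin φ ^ 2))) D θ ∧
      HasDerivAt (fun t => sepIntegrand b 1 (ν t) (ρ₁ t) (ρ₂ t) θ)
        ((g' - 2 * h' * (ρ₁ t * Real.sin θ ^ 2)
          - k' * (ρ₁ t * Real.sin θ ^ 2 / (1 - ρ₁ t * Real.sin θ ^ 2)))
          / (2 * ν t * (√(b - ρ₁ t * Real.sin θ ^ 2) * √(ρ₂ t - ρ₁ t * Real.sin θ ^ 2))) + D) t := by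
  have hle := mul_sin_sq_le_self h1 θ
  have hB : 0 < b - ρ₁ t * Real.sin θ ^ 2 := by linarith
  have hA : 0 < ρ₂ t - ρ₁ t * Real.sin θ ^ 2 := by linarith
  have hE : 0 < 1 - ρ₁ t * Real.sin θ ^ 2 := by linarith
  have hB' := Real.sqrt_pos.2 hB
  have hA' := Real.sqrt_pos.2 hA
  have hBs := Real.sq_sqrt hB.le
  have hAs := Real.sq_sqrt hA.le
  have hs := (((Real.hasDerivAt_sin θ).pow 2).const_mul (ρ₁ t))
  have dA := (hs.const_sub (ρ₂ t)).sqrt hA.ne'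
  have dB := (hs.const_sub b).sqrt hB.ne'
  have dE := hs.const_sub 1
  -- At fixed θ the point s = ρ₁ sin² θ moves with the parameter. The exact term is the θ-derivative
  -- of p · ∂s/∂t, that is of p · ρ₁' sin² θ; the remaining term is ∂p/∂t at fixed s times ds/dθ.
  have dD := ((((Real.hasDerivAt_sin θ).mul (Real.hasDerivAt_cos θ)).mul
    (dA.div dB hB'.ne')).div dE hE.ne').const_mul (ν t * ρ₁' / 2)
  refine ⟨_, dD, ?_⟩
  have ht := hρ₁.mul_const (Real.sin θ ^ 2)
  have fA := (hρ₂.sub ht).sqrt hA.ne'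
  have fB := (ht.const_sub b).sqrt hB.ne'
  have fE := ht.const_sub 1
  have fD := hν.mul (((hρ₁.mul_const (Real.cos θ ^ 2)).mul (fA.div fB hB'.ne')).div fE hE.ne')
  refine fD.congr_deriv ?_
  simp only [Pi.mul_apply, Pi.div_apply, Pi.sub_apply, Pi.pow_apply]
  rw [hg', hh', hk']
  have hcos := Real.cos_sq' θ
  generalize √(b - ρ₁ t * Real.sin θ ^ 2) = Bq at *
  generalize √(ρ₂ t - ρ₁ t * Real.sin θ ^ 2) = Aq at *
  have hr₂ : ρ₂ t = Aq ^ 2 + ρ₁ t * Real.sin θ ^ 2 := by linarith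
  rw [hr₂]
  clear fA fB fE fD dA dB dE dD hs ht hν hρ₁ hρ₂ hg' hh' hk'
  generalize Real.sin θ = S at *
  generalize Real.cos θ = C at *
  generalize ρ₁ t = r at *
  generalize ν t = n at *
  generalize ρ₂ t = r2 at *
  have hE2 := hE.ne'
  field_simp
  rw [hcos]
  norm_num
  ring

end SeparatedIntegral

/-! ### The actions as functions of the value of the fibration -/

section Actions

variable {b h l g : ℝ}

/-- The regular values at which `r₁ < 1`. -/
def lowerValues (b : ℝ) : Set (Fin 3 → ℝ) :=
  {c | IsRegularValue b (c 0) (c 1) (c 2) ∧ (c 1 ≠ 0 ∨ c 2 < 2 * c 0)}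

/-- The regular values at which `1 < r₂`. -/
def upperValues (b : ℝ) : Set (Fin 3 → ℝ) :=
  {c | IsRegularValue b (c 0) (c 1) (c 2) ∧ (c 1 ≠ 0 ∨ 2 * c 0 < c 2)}

theorem isOpen_isRegularValue (b : ℝ) :
    IsOpen {c : Fin 3 → ℝ | IsRegularValue b (c 0) (c 1) (c 2)} := by
  have h1 : IsOpen {c : Fin 3 → ℝ | 0 < c 2} := isOpen_lt (by fun_prop) (by fun_prop)
  have h2 : IsOpen {c : Fin 3 → ℝ | c 2 < b * (2 * c 0 - c 1 ^ 2)} :=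
    isOpen_lt (by fun_prop) (by fun_prop)
  have h3 : IsClosed {c : Fin 3 → ℝ | c 1 = 0} := isClosed_eq (by fun_prop) (by fun_prop)
  have h4 : IsClosed {c : Fin 3 → ℝ | c 2 = 2 * c 0} := isClosed_eq (by fun_prop) (by fun_prop)
  exact h1.inter (h2.inter (h3.inter h4).isOpen_compl)

theorem isOpen_lowerValues (b : ℝ) : IsOpen (lowerValues b) := by
  have h1 : IsOpen {c : Fin 3 → ℝ | c 1 ≠ 0} := isOpen_ne_fun (by fun_prop) (by fun_prop)
  have h2 : IsOpen {c : Fin 3 → ℝ | c 2 < 2 * c 0} := isOpen_lt (by fun_prop) (by fun_prop)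
  exact (isOpen_isRegularValue b).inter (h1.union h2)

theorem isOpen_upperValues (b : ℝ) : IsOpen (upperValues b) := by
  have h1 : IsOpen {c : Fin 3 → ℝ | c 1 ≠ 0} := isOpen_ne_fun (by fun_prop) (by fun_prop)
  have h2 : IsOpen {c : Fin 3 → ℝ | 2 * c 0 < c 2} := isOpen_lt (by fun_prop) (by fun_prop)
  exact (isOpen_isRegularValue b).inter (h1.union h2)

theorem IsRegularValue.h_pos (hb : 1 < b) (hr : IsRegularValue b h l g) : 0 < h := by
  obtain ⟨h1, h2, -⟩ := hr
  nlinarith [sq_nonneg l]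

theorem IsRegularValue.roots (hb : 1 < b) (hr : IsRegularValue b h l g) :
    ProlateRoots b h l g (prolateRoot₁ b h l g) (prolateRoot₂ b h l g) :=
  prolateRoots_of_regular hb hr.1 hr.2.1 hr.2.2

theorem contDiffOn_prolateRoots (hb : 1 < b) :
    ContDiffOn ℝ ∞ (fun c : Fin 3 → ℝ => √(2 * c 0))
        {c : Fin 3 → ℝ | IsRegularValue b (c 0) (c 1) (c 2)} ∧
      ContDiffOn ℝ ∞ (fun c : Fin 3 → ℝ => prolateRoot₁ b (c 0) (c 1) (c 2))
        {c : Fin 3 → ℝ | IsRegularValue b (c 0) (c 1) (c 2)} ∧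
      ContDiffOn ℝ ∞ (fun c : Fin 3 → ℝ => prolateRoot₂ b (c 0) (c 1) (c 2))
        {c : Fin 3 → ℝ | IsRegularValue b (c 0) (c 1) (c 2)} := by
  have hd : ContDiffOn ℝ ∞ (fun c : Fin 3 → ℝ =>
      √((c 2 + 2 * c 0 + (b - 1) * c 1 ^ 2) ^ 2 - 8 * c 0 * c 2))
      {c : Fin 3 → ℝ | IsRegularValue b (c 0) (c 1) (c 2)} :=
    ContDiffOn.sqrt (ContDiff.contDiffOn (by fun_prop))
      fun c hc => (discrim_pos hb hc.1 hc.2.1 hc.2.2).ne'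
  have hN : ContDiff ℝ ∞ (fun c : Fin 3 → ℝ => c 2 + 2 * c 0 + (b - 1) * c 1 ^ 2) := by fun_prop
  have hD : ContDiff ℝ ∞ (fun c : Fin 3 → ℝ => 4 * c 0) := by fun_prop
  have hne : ∀ c ∈ {c : Fin 3 → ℝ | IsRegularValue b (c 0) (c 1) (c 2)}, 4 * c 0 ≠ 0 :=
    fun c hc => by have := hc.h_pos hb; positivity
  refine ⟨ContDiffOn.sqrt (ContDiff.contDiffOn (by fun_prop)) fun c hc => ?_,
    (hN.contDiffOn.sub hd).div hD.contDiffOn hne, (hN.contDiffOn.add hd).div hD.contDiffOn hne⟩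
  have := hc.h_pos hb
  positivity

theorem prolateMomentum_eq {r₁ r₂ : ℝ} (R : ProlateRoots b h l g r₁ r₂) (s : ℝ) :
    prolateMomentum b h l g s
      = √(√(2 * h) ^ 2 * ((r₁ - s) * (r₂ - s)) / (4 * s * (b - s) * (1 - s) ^ 2)) := by
  have hh := R.h_pos
  rw [prolateMomentum, Real.sq_sqrt (by positivity), ← neg_div_neg_eq]
  congr 2
  · linear_combination (-s) * R.l_eq + (1 - s) * R.g_eq
  · ring

theorem prolateJ₁_eq (R : ProlateRoots b h l g (prolateRoot₁ b h l g) (prolateRoot₂ b h l g))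
    (h1 : prolateRoot₁ b h l g < 1) :
    prolateJ₁ b h l g = (2 * Real.pi)⁻¹
      * sepIntegral b 1 (√(2 * h)) (prolateRoot₁ b h l g) (prolateRoot₂ b h l g) := by
  have hrb : prolateRoot₁ b h l g < b := R.r₁_lt_r₂.trans R.r₂_lt
  rw [prolateJ₁, min_eq_left h1.le, sepIntegral_eq_four_mul R.r₁_pos hrb h1,
    ← integral_sqrt_eq_integral_sepIntegrand (Real.sqrt_nonneg _) R.r₁_pos R.r₁_lt_r₂ hrb h1]
  simp only [← prolateMomentum_eq R]
  field_simp
  ring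

/-- The reflection s ↦ b - s carries the interval from r₂ to b to the one from 0 to b - r₂,
exchanges the branch points 0 and b, and moves the pole to b - 1. -/
theorem prolateJ₃_eq (R : ProlateRoots b h l g (prolateRoot₁ b h l g) (prolateRoot₂ b h l g))
    (h1 : 1 < prolateRoot₂ b h l g) :
    prolateJ₃ b h l g = (2 * Real.pi)⁻¹
      * sepIntegral b (b - 1) (√(2 * h)) (b - prolateRoot₂ b h l g) (b - prolateRoot₁ b h l g) := by
  have k1 : 0 < b - prolateRoot₂ b h l g := sub_pos.2 R.r₂_lt
  have k2 : b - prolateRoot₂ b h l g < b := by linarith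
  have k3 : b - prolateRoot₂ b h l g < b - 1 := by linarith
  have k4 : b - prolateRoot₂ b h l g < b - prolateRoot₁ b h l g := by linarith [R.r₁_lt_r₂]
  rw [prolateJ₃, max_eq_right h1.le, sepIntegral_eq_four_mul k1 k2 k3,
    ← integral_sqrt_eq_integral_sepIntegrand (Real.sqrt_nonneg _) k1 k4 k2 k3]
  have := intervalIntegral.integral_comp_sub_left (a := 0) (b := b - prolateRoot₂ b h l g)
    (prolateMomentum b h l g) b
  rw [sub_sub_cancel, sub_zero] at this
  rw [← this]
  have e : ∀ s, prolateMomentum b h l g (b - s) = √(√(2 * h) ^ 2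
      * ((b - prolateRoot₂ b h l g - s) * (b - prolateRoot₁ b h l g - s))
      / (4 * s * (b - s) * (b - 1 - s) ^ 2)) := fun s => by
    rw [prolateMomentum_eq R]
    congr 2 <;> ring
  simp only [e]
  rw [← mul_assoc, show (2 * Real.pi)⁻¹ * 4 = 2 / Real.pi by field_simp; norm_num]

theorem lowerValues_root (hb : 1 < b) {c : Fin 3 → ℝ} (hc : c ∈ lowerValues b) :
    prolateRoot₁ b (c 0) (c 1) (c 2) < 1 :=
  (prolateRoot₁_lt_one_iff (hc.1.roots hb)).2 hc.2

theorem upperValues_root (hb : 1 < b) {c : Fin 3 → ℝ} (hc : c ∈ upperValues b) :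
    1 < prolateRoot₂ b (c 0) (c 1) (c 2) :=
  (one_lt_prolateRoot₂_iff (hc.1.roots hb)).2 hc.2

theorem contDiffOn_prolateJ₃ (hb : 1 < b) :
    ContDiffOn ℝ ∞ (fun c : Fin 3 → ℝ => prolateJ₃ b (c 0) (c 1) (c 2)) (upperValues b) := by
  have hsub : upperValues b ⊆ {c | IsRegularValue b (c 0) (c 1) (c 2)} := fun _ hc => hc.1
  obtain ⟨k0, k1, k2⟩ := contDiffOn_prolateRoots hb
  have := (contDiffOn_sepIntegral (b := b) (e := b - 1) (isOpen_upperValues b) (k0.mono hsub)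
    (contDiffOn_const.sub (k2.mono hsub)) (contDiffOn_const.sub (k1.mono hsub))
    (fun c hc => sub_pos.2 (hc.1.roots hb).r₂_lt)
    (fun c hc => sub_lt_sub_left (hc.1.roots hb).r₁_lt_r₂ b)
    (fun _ hc => by linarith [(hc.1.roots hb).le_r₂])
    (fun c hc => sub_lt_sub_left (upperValues_root hb hc) b)).2
  exact (contDiffOn_const.mul this).congr fun c hc =>
    prolateJ₃_eq (hc.1.roots hb) (upperValues_root hb hc)

theorem contDiffOn_sepIntegrand_lowerValues (hb : 1 < b) :
    ContDiffOn ℝ ∞ (fun p : (Fin 3 → ℝ) × ℝ => sepIntegrand b 1 (√(2 * p.1 0))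
        (prolateRoot₁ b (p.1 0) (p.1 1) (p.1 2)) (prolateRoot₂ b (p.1 0) (p.1 1) (p.1 2)) p.2)
        (lowerValues b ×ˢ univ) ∧
      ContDiffOn ℝ ∞ (fun c : Fin 3 → ℝ => sepIntegral b 1 (√(2 * c 0))
        (prolateRoot₁ b (c 0) (c 1) (c 2)) (prolateRoot₂ b (c 0) (c 1) (c 2)))
        (lowerValues b) := by
  have hsub : lowerValues b ⊆ {c | IsRegularValue b (c 0) (c 1) (c 2)} := fun _ hc => hc.1
  obtain ⟨k0, k1, k2⟩ := contDiffOn_prolateRoots hb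
  exact contDiffOn_sepIntegral (isOpen_lowerValues b) (k0.mono hsub) (k1.mono hsub)
    (k2.mono hsub) (fun c hc => (hc.1.roots hb).r₁_pos) (fun c hc => (hc.1.roots hb).r₁_lt_r₂)
    (fun c hc => (hc.1.roots hb).r₁_lt_r₂.trans (hc.1.roots hb).r₂_lt)
    fun c hc => lowerValues_root hb hc

theorem contDiffOn_prolateJ₁ (hb : 1 < b) :
    ContDiffOn ℝ ∞ (fun c : Fin 3 → ℝ => prolateJ₁ b (c 0) (c 1) (c 2)) (lowerValues b) :=
  (contDiffOn_const.mul (contDiffOn_sepIntegrand_lowerValues hb).2).congr fun _ hc =>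
    prolateJ₁_eq (hc.1.roots hb) (lowerValues_root hb hc)

/-- The primitive of D is periodic, so D contributes nothing over a full cycle. -/
theorem integral_eq_periods {r₁ r₂ : ℝ} (R : ProlateRoots b h l g r₁ r₂) (h1 : r₁ < 1)
    {x y z w : ℝ} {D : ℝ → ℝ}
    (hD : ∀ θ, HasDerivAt (fun φ => w * (Real.sin φ * Real.cos φ
      * (√(r₂ - r₁ * Real.sin φ ^ 2) / √(b - r₁ * Real.sin φ ^ 2))
      / (1 - r₁ * Real.sin φ ^ 2))) (D θ) θ) :
    ∫ θ in (0 : ℝ)..2 * Real.pi, ((x - 2 * y * (r₁ * Real.sin θ ^ 2)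
        - z * (r₁ * Real.sin θ ^ 2 / (1 - r₁ * Real.sin θ ^ 2)))
        / (2 * √(2 * h) * (√(b - r₁ * Real.sin θ ^ 2) * √(r₂ - r₁ * Real.sin θ ^ 2))) + D θ)
      = x * periodG b h r₁ r₂ - 2 * y * periodH b h r₁ r₂ - z * periodL b h r₁ r₂ := by
  have hA : ∀ θ, r₂ - r₁ * Real.sin θ ^ 2 ≠ 0 := fun θ => by
    have := R.mul_sin_sq_le θ
    have := R.r₁_lt_r₂
    linarith
  have hB : ∀ θ, b - r₁ * Real.sin θ ^ 2 ≠ 0 := fun θ => by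
    have := R.mul_sin_sq_le θ
    have := R.r₁_lt_r₂
    have := R.r₂_lt
    linarith
  have hB' : ∀ θ, √(b - r₁ * Real.sin θ ^ 2) ≠ 0 := fun θ => by
    have := R.mul_sin_sq_le θ
    have := R.r₁_lt_r₂
    have := R.r₂_lt
    exact (Real.sqrt_pos.2 (by linarith)).ne'
  have hE : ∀ θ, 1 - r₁ * Real.sin θ ^ 2 ≠ 0 := fun θ => by
    have := R.mul_sin_sq_le θ
    linarith
  have hDc : Continuous D := by
    have hsm : ContDiff ℝ 1 (fun φ => w * (Real.sin φ * Real.cos φ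
        * (√(r₂ - r₁ * Real.sin φ ^ 2) / √(b - r₁ * Real.sin φ ^ 2))
        / (1 - r₁ * Real.sin φ ^ 2))) := by
      have hs : ContDiff ℝ 1 (fun φ => r₁ * Real.sin φ ^ 2) := by fun_prop
      have hsc : ContDiff ℝ 1 (fun φ => Real.sin φ * Real.cos φ) := by fun_prop
      exact contDiff_const.mul ((hsc.mul (((contDiff_const.sub hs).sqrt hA).div
        ((contDiff_const.sub hs).sqrt hB) hB')).div (contDiff_const.sub hs) hE)
    have := hsm.continuous_deriv le_rfl
    rwa [show deriv _ = D from funext fun θ => (hD θ).deriv] at this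
  have hps := continuous_phaseSpeed (b := b) (h := h) (r₁ := r₁) (r₂ := r₂)
  have hps' : ∀ θ, phaseSpeed b h r₁ r₂ θ ≠ 0 := fun θ => (R.phaseSpeed_pos θ).ne'
  have c1 : Continuous fun θ => 1 / phaseSpeed b h r₁ r₂ θ := continuous_const.div hps hps'
  have c2 : Continuous fun θ => r₁ * Real.sin θ ^ 2 / phaseSpeed b h r₁ r₂ θ :=
    Continuous.div (by fun_prop) hps hps'
  have c3 : Continuous fun θ => r₁ * Real.sin θ ^ 2 / (1 - r₁ * Real.sin θ ^ 2)
      / phaseSpeed b h r₁ r₂ θ :=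
    (Continuous.div (by fun_prop) (by fun_prop) hE).div hps hps'
  have hzero : ∫ θ in (0 : ℝ)..2 * Real.pi, D θ = 0 := by
    rw [intervalIntegral.integral_eq_sub_of_hasDerivAt (fun θ _ => hD θ)
      (hDc.intervalIntegrable _ _)]
    simp
  have hint : ∀ θ, (x - 2 * y * (r₁ * Real.sin θ ^ 2)
        - z * (r₁ * Real.sin θ ^ 2 / (1 - r₁ * Real.sin θ ^ 2)))
        / (2 * √(2 * h) * (√(b - r₁ * Real.sin θ ^ 2) * √(r₂ - r₁ * Real.sin θ ^ 2)))
      = x * (1 / phaseSpeed b h r₁ r₂ θ) - 2 * y * (r₁ * Real.sin θ ^ 2 / phaseSpeed b h r₁ r₂ θ)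
        - z * (r₁ * Real.sin θ ^ 2 / (1 - r₁ * Real.sin θ ^ 2) / phaseSpeed b h r₁ r₂ θ) := by
    intro θ
    rw [phaseSpeed]; ring
  simp only [hint]
  rw [intervalIntegral.integral_add, hzero, intervalIntegral.integral_sub,
    intervalIntegral.integral_sub, intervalIntegral.integral_const_mul,
    intervalIntegral.integral_const_mul, intervalIntegral.integral_const_mul, add_zero, periodG,
    periodH, periodL]
  all_goals exact Continuous.intervalIntegrable (by fun_prop) _ _

/-- The coefficients of v are the components of the lattice vector for one full turn of the orbit
angle, with the other two integers equal to zero. -/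
theorem fderiv_prolateJ₁ (hb : 1 < b) {c : Fin 3 → ℝ} (hc : c ∈ lowerValues b) (v : Fin 3 → ℝ) :
    2 * Real.pi * fderiv ℝ (fun c : Fin 3 → ℝ => prolateJ₁ b (c 0) (c 1) (c 2)) c v
      = v 2 * periodG b (c 0) (prolateRoot₁ b (c 0) (c 1) (c 2)) (prolateRoot₂ b (c 0) (c 1) (c 2))
        - 2 * v 0
          * periodH b (c 0) (prolateRoot₁ b (c 0) (c 1) (c 2)) (prolateRoot₂ b (c 0) (c 1) (c 2))
        - 2 * (b - 1) * c 1 * v 1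
          * periodL b (c 0) (prolateRoot₁ b (c 0) (c 1) (c 2))
            (prolateRoot₂ b (c 0) (c 1) (c 2)) := by
  have hU := isOpen_lowerValues b
  have hnhds : lowerValues b ∈ 𝓝 c := hU.mem_nhds hc
  have hsub : lowerValues b ⊆ {c | IsRegularValue b (c 0) (c 1) (c 2)} := fun _ hc => hc.1
  obtain ⟨k0, k1, k2⟩ := contDiffOn_prolateRoots hb
  obtain ⟨hF, hI⟩ := contDiffOn_sepIntegrand_lowerValues hb
  have hline : HasDerivAt (fun t : ℝ => c + t • v) v 0 := by
    simpa using ((hasDerivAt_id (0 : ℝ)).smul_const v).const_add c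
  have hlc : c + (0 : ℝ) • v = c := by simp
  have hev : ∀ᶠ t in 𝓝 (0 : ℝ), c + t • v ∈ lowerValues b := by
    have := hline.continuousAt
    exact this (by simpa using hnhds)
  have along : ∀ f : (Fin 3 → ℝ) → ℝ,
      ContDiffOn ℝ ∞ f {c : Fin 3 → ℝ | IsRegularValue b (c 0) (c 1) (c 2)} →
      HasDerivAt (fun t : ℝ => f (c + t • v)) (fderiv ℝ f c v) 0 := fun f hf => by
    have h1 : DifferentiableAt ℝ f (c + (0 : ℝ) • v) := by
      rw [hlc]
      exact ((hf.mono hsub).contDiffAt hnhds).differentiableAt (by simp)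
    have := h1.hasFDerivAt.comp_hasDerivAt 0 hline
    rwa [hlc] at this
  have d0 := along _ k0
  have d1 := along _ k1
  have d2 := along _ k2
  set ν' := fderiv ℝ (fun c : Fin 3 → ℝ => √(2 * c 0)) c v
  set ρ₁' := fderiv ℝ (fun c : Fin 3 → ℝ => prolateRoot₁ b (c 0) (c 1) (c 2)) c v
  set ρ₂' := fderiv ℝ (fun c : Fin 3 → ℝ => prolateRoot₂ b (c 0) (c 1) (c 2)) c v
  have hcoord : ∀ i, HasDerivAt (fun t : ℝ => (c + t • v) i) (v i) 0 := fun i =>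
    hasDerivAt_pi.1 hline i
  have hν : ∀ᶠ t in 𝓝 (0 : ℝ), √(2 * (c + t • v) 0) ^ 2 = 2 * (c + t • v) 0 :=
    hev.mono fun t ht => Real.sq_sqrt (by have := ht.1.h_pos hb; positivity)
  have R := hc.1.roots hb
  have hcc := hc.1.h_pos hb
  have hν0 : 0 < √(2 * c 0) := Real.sqrt_pos.2 (by positivity)
  -- Instead of the root formulas, the relations 2h = ν², g = ν²r₁r₂ and (b - 1)l² = ν²(1 - r₁)(r₂ -
  -- 1) are differentiated along the line through c.
  have hh' : v 0 = √(2 * c 0) * ν' := by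
    have e1 := (d0.pow 2).congr_of_eventuallyEq (f₁ := fun t : ℝ => 2 * (c + t • v) 0)
      (hν.mono fun t ht => ht.symm)
    have := e1.unique ((hcoord 0).const_mul 2)
    simp only [hlc, Nat.cast_ofNat, Nat.reduceSub, pow_one] at this
    linarith
  have hg' : v 2 = 2 * √(2 * c 0) * ν' * prolateRoot₁ b (c 0) (c 1) (c 2)
      * prolateRoot₂ b (c 0) (c 1) (c 2) + √(2 * c 0) ^ 2
        * (ρ₁' * prolateRoot₂ b (c 0) (c 1) (c 2) + prolateRoot₁ b (c 0) (c 1) (c 2) * ρ₂') := by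
    have e1 := ((d0.pow 2).mul (d1.mul d2)).congr_of_eventuallyEq
      (f₁ := fun t : ℝ => (c + t • v) 2)
      ((hν.and hev).mono fun t ht => by
        have := (ht.2.1.roots hb).g_eq
        simp only [Pi.mul_apply, Pi.pow_apply]
        rw [ht.1]; linarith)
    have := (hcoord 2).unique e1
    simp only [hlc, Pi.pow_apply, Pi.mul_apply, Nat.cast_ofNat, Nat.reduceSub, pow_one] at this
    rw [this]; ring
  have hk' : 2 * (b - 1) * c 1 * v 1 = 2 * √(2 * c 0) * ν'
      * (1 - prolateRoot₁ b (c 0) (c 1) (c 2)) * (prolateRoot₂ b (c 0) (c 1) (c 2) - 1)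
      + √(2 * c 0) ^ 2 * ((1 - prolateRoot₁ b (c 0) (c 1) (c 2)) * ρ₂'
        - ρ₁' * (prolateRoot₂ b (c 0) (c 1) (c 2) - 1)) := by
    have e1 := ((d0.pow 2).mul ((d1.const_sub 1).mul (d2.sub_const 1))).congr_of_eventuallyEq
      (f₁ := fun t : ℝ => (b - 1) * (c + t • v) 1 ^ 2)
      ((hν.and hev).mono fun t ht => by
        have := (ht.2.1.roots hb).l_eq
        simp only [Pi.mul_apply, Pi.pow_apply]
        rw [ht.1]; linarith)
    have := (((hcoord 1).pow 2).const_mul (b - 1)).unique e1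
    simp only [hlc, Pi.pow_apply, Pi.mul_apply, Nat.cast_ofNat, Nat.reduceSub, pow_one] at this
    linarith
  have hD := fun θ => hasDerivAt_sepIntegrand (b := b) (t := (0 : ℝ)) (θ := θ) d0 d1 d2
    (by simpa [hlc] using hν0) (by simpa only [hlc] using R.r₁_pos)
    (by simpa only [hlc] using R.r₁_lt_r₂)
    (by simpa only [hlc] using R.r₁_lt_r₂.trans R.r₂_lt)
    (by simpa only [hlc] using lowerValues_root hb hc) (by simpa only [hlc] using hg')
    (by simpa only [hlc] using hh') (by simpa only [hlc] using hk')
  simp only [hlc] at hD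
  choose D hP hD using hD
  have hfd := fderiv_intervalIntegral_apply hU hF 0 (2 * Real.pi) hc v hD
  have hJ : fderiv ℝ (fun c : Fin 3 → ℝ => prolateJ₁ b (c 0) (c 1) (c 2)) c v
      = (2 * Real.pi)⁻¹ * fderiv ℝ (fun c : Fin 3 → ℝ => sepIntegral b 1 (√(2 * c 0))
        (prolateRoot₁ b (c 0) (c 1) (c 2)) (prolateRoot₂ b (c 0) (c 1) (c 2))) c v := by
    have : (fun c : Fin 3 → ℝ => prolateJ₁ b (c 0) (c 1) (c 2)) =ᶠ[𝓝 c] fun c : Fin 3 → ℝ =>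
        (2 * Real.pi)⁻¹ * sepIntegral b 1 (√(2 * c 0))
          (prolateRoot₁ b (c 0) (c 1) (c 2)) (prolateRoot₂ b (c 0) (c 1) (c 2)) :=
      Filter.eventually_of_mem hnhds fun c hc =>
        prolateJ₁_eq (hc.1.roots hb) (lowerValues_root hb hc)
    rw [this.fderiv_eq, fderiv_const_mul
      ((hI.contDiffAt hnhds).differentiableAt (by simp)) _]
    simp
  rw [hJ, ← mul_assoc, mul_inv_cancel₀ (by positivity), one_mul]
  refine hfd.trans ?_
  exact integral_eq_periods R (lowerValues_root hb hc) hP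

end Actions

/-! ### The sum of the actions -/

section ActionSum

variable {b h l g r₁ r₂ : ℝ}

theorem pos_of_convex_sin_sq {x y : ℝ} (hx : 0 < x) (hy : 0 < y) (θ : ℝ) :
    0 < x - (x - y) * Real.sin θ ^ 2 := by
  have h1 := Real.sin_sq_add_cos_sq θ
  have : x - (x - y) * Real.sin θ ^ 2 = x * Real.cos θ ^ 2 + y * Real.sin θ ^ 2 := by
    linear_combination (-x) * h1
  rw [this]
  rcases eq_or_ne (Real.sin θ) 0 with h2 | h2
  · have : Real.cos θ ^ 2 = 1 := by rw [h2] at h1; linarith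
    rw [this]; positivity
  · positivity

/-- The integral over the upper gap, transported to the lower gap by the Möbius transformation
that interchanges `0` with `b` and `r₁` with `r₂`. -/
theorem integral_prolateMomentum_upper (R : ProlateRoots b h l g r₁ r₂) (hr₂ : 1 < r₂) :
    ∫ s in r₂..b, prolateMomentum b h l g s
      = ∫ θ in (0 : ℝ)..Real.pi / 2, √(2 * h) * Real.cos θ ^ 2
        * (√(r₂ - r₁ * Real.sin θ ^ 2) / √(b - r₁ * Real.sin θ ^ 2))
        * (r₂ * (b - r₁) * (b - r₂)
          / ((r₂ * (b - 1) - (r₂ * (b - 1) - (r₂ - 1) * (b - r₁)) * Real.sin θ ^ 2)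
            * (r₂ - (r₂ - (b - r₁)) * Real.sin θ ^ 2))) := by
  have hπ : (0 : ℝ) ≤ Real.pi / 2 := by positivity
  have h1 := R.r₁_pos
  have hb1 : 0 < b - 1 := sub_pos.2 R.one_lt_b
  have hbr1 : 0 < b - r₁ := by linarith [R.r₁_lt_r₂, R.r₂_lt]
  have hbr2 : 0 < b - r₂ := sub_pos.2 R.r₂_lt
  have hr₂0 : 0 < r₂ := by linarith
  have hΔ := pos_of_convex_sin_sq hr₂0 hbr1
  have key := intervalIntegral.integral_comp_mul_deriv_of_deriv_nonpos (a := 0) (b := Real.pi / 2)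
    (f := fun θ => r₂ * (b - r₁ * Real.sin θ ^ 2) / (r₂ - (r₂ - (b - r₁)) * Real.sin θ ^ 2))
    (f' := fun θ => -(r₂ * (b - r₁) * (b - r₂) * (2 * Real.sin θ * Real.cos θ)
      / (r₂ - (r₂ - (b - r₁)) * Real.sin θ ^ 2) ^ 2))
    (g := prolateMomentum b h l g)
    (ContinuousOn.div (by fun_prop) (by fun_prop) fun θ _ => (hΔ θ).ne')
    (fun θ _ => by
      have hs := (Real.hasDerivAt_sin θ).pow 2
      have := (((hs.const_mul r₁).const_sub b).const_mul r₂).div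
        ((hs.const_mul (r₂ - (b - r₁))).const_sub r₂) (hΔ θ).ne'
      refine this.congr_deriv ?_
      simp only [Pi.pow_apply, Nat.cast_ofNat, Nat.reduceSub, pow_one]
      have := (hΔ θ).ne'
      field_simp
      ring)
    (fun θ hθ => by
      rw [min_eq_left hπ, max_eq_right hπ] at hθ
      have := Real.sin_pos_of_pos_of_lt_pi hθ.1 (by linarith [hθ.2])
      have := Real.cos_pos_of_mem_Ioo ⟨by linarith [hθ.1], hθ.2⟩
      have := hΔ θ
      rw [neg_nonpos]
      positivity)
  simp only [Real.sin_zero, Real.sin_pi_div_two, ne_eq, OfNat.ofNat_ne_zero, not_false_eq_true,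
    zero_pow, mul_zero, one_pow, mul_one, sub_zero, sub_sub_cancel] at key
  rw [mul_div_cancel_left₀ _ hr₂0.ne', mul_div_cancel_right₀ _ hbr1.ne'] at key
  rw [intervalIntegral.integral_symm, ← key, ← intervalIntegral.integral_neg]
  refine intervalIntegral.integral_congr_Ioo_of_le hπ fun θ hθ => ?_
  have hs := Real.sin_pos_of_pos_of_lt_pi hθ.1 (by linarith [hθ.2])
  have hc := Real.cos_pos_of_mem_Ioo ⟨by linarith [hθ.1], hθ.2⟩
  have hle := R.mul_sin_sq_le θ
  have hB : 0 < b - r₁ * Real.sin θ ^ 2 := by linarith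
  have hA : 0 < r₂ - r₁ * Real.sin θ ^ 2 := by linarith [R.r₁_lt_r₂]
  have hN := pos_of_convex_sin_sq (mul_pos hr₂0 hb1) (mul_pos (sub_pos.2 hr₂) hbr1) θ
  have hD := hΔ θ
  have hcos := Real.cos_sq' θ
  simp only [Function.comp_apply]
  have hval : prolateMomentum b h l g
      (r₂ * (b - r₁ * Real.sin θ ^ 2) / (r₂ - (r₂ - (b - r₁)) * Real.sin θ ^ 2))
      = √(2 * h) * Real.cos θ * √(r₂ - r₁ * Real.sin θ ^ 2)
        * (r₂ - (r₂ - (b - r₁)) * Real.sin θ ^ 2)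
        / (2 * Real.sin θ * √(b - r₁ * Real.sin θ ^ 2)
          * (r₂ * (b - 1) - (r₂ * (b - 1) - (r₂ - 1) * (b - r₁)) * Real.sin θ ^ 2)) := by
    have hN' := hN.ne'
    have hD' := hD.ne'
    rw [prolateMomentum_eq R]
    set Δ := r₂ - (r₂ - (b - r₁)) * Real.sin θ ^ 2 with hΔdef
    set N := r₂ * (b - 1) - (r₂ * (b - 1) - (r₂ - 1) * (b - r₁)) * Real.sin θ ^ 2 with hNdef
    have e1 : r₁ - r₂ * (b - r₁ * Real.sin θ ^ 2) / Δ
        = -((b - r₁) * (r₂ - r₁ * Real.sin θ ^ 2) / Δ) := by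
      field_simp
      rw [hΔdef]; ring
    have e2 : r₂ - r₂ * (b - r₁ * Real.sin θ ^ 2) / Δ
        = -(r₂ * (b - r₂) * Real.cos θ ^ 2 / Δ) := by
      field_simp
      rw [hΔdef, hcos]; ring
    have e3 : b - r₂ * (b - r₁ * Real.sin θ ^ 2) / Δ
        = (b - r₁) * (b - r₂) * Real.sin θ ^ 2 / Δ := by
      field_simp
      rw [hΔdef]; ring
    have e4 : 1 - r₂ * (b - r₁ * Real.sin θ ^ 2) / Δ = -(N / Δ) := by
      field_simp
      rw [hΔdef, hNdef]; ring
    rw [e1, e2, e3, e4, ← Real.sqrt_sq (show 0 ≤ √(2 * h) * Real.cos θ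
      * √(r₂ - r₁ * Real.sin θ ^ 2) * Δ / (2 * Real.sin θ * √(b - r₁ * Real.sin θ ^ 2) * N)
      by positivity)]
    congr 1
    simp only [div_pow, mul_pow, neg_sq]
    rw [Real.sq_sqrt hA.le, Real.sq_sqrt hB.le]
    field_simp
    ring
  rw [hval]
  have := (Real.sqrt_pos.2 hB).ne'
  have := hN.ne'
  field_simp

/-- The two momenta, written in the same angle, add up to an elementary integrand although each is
elliptic. With Y = tan θ · √(b - s)/√(r₂ - s) each arctangent accounts for one kind of pole of the
sum. -/
theorem hasDerivAt_arctan_primitive (R : ProlateRoots b h l g r₁ r₂) (hr₁ : r₁ < 1) (hr₂ : 1 < r₂)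
    {ν k : ℝ} (hν : ν ≠ 0) (hk : k ^ 2 * (b - 1) = ν ^ 2 * ((1 - r₁) * (r₂ - 1))) {θ : ℝ}
    (hθ : θ ∈ Ioo 0 (Real.pi / 2)) :
    HasDerivAt (fun θ => ν * Real.arctan
        (Real.tan θ * (√(b - r₁ * Real.sin θ ^ 2) / √(r₂ - r₁ * Real.sin θ ^ 2)))
        - k * Real.arctan (k / ν
          * (Real.tan θ * (√(b - r₁ * Real.sin θ ^ 2) / √(r₂ - r₁ * Real.sin θ ^ 2)))))
      (sepIntegrand b 1 ν r₁ r₂ θ + ν * Real.cos θ ^ 2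
        * (√(r₂ - r₁ * Real.sin θ ^ 2) / √(b - r₁ * Real.sin θ ^ 2))
        * (r₂ * (b - r₁) * (b - r₂)
          / ((r₂ * (b - 1) - (r₂ * (b - 1) - (r₂ - 1) * (b - r₁)) * Real.sin θ ^ 2)
            * (r₂ - (r₂ - (b - r₁)) * Real.sin θ ^ 2)))) θ := by
  have hc := Real.cos_pos_of_mem_Ioo ⟨by linarith [hθ.1, Real.pi_pos], hθ.2⟩
  have hle := R.mul_sin_sq_le θ
  have hb1 : 0 < b - 1 := sub_pos.2 R.one_lt_b
  have hbr1 : 0 < b - r₁ := by linarith [R.r₁_lt_r₂, R.r₂_lt]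
  have hr₂0 : 0 < r₂ := by linarith
  have hB : 0 < b - r₁ * Real.sin θ ^ 2 := by linarith
  have hA : 0 < r₂ - r₁ * Real.sin θ ^ 2 := by linarith
  have hE : 0 < 1 - r₁ * Real.sin θ ^ 2 := by linarith
  have hN := pos_of_convex_sin_sq (mul_pos hr₂0 hb1) (mul_pos (sub_pos.2 hr₂) hbr1) θ
  have hD := pos_of_convex_sin_sq hr₂0 hbr1 θ
  have hB' := Real.sqrt_pos.2 hB
  have hA' := Real.sqrt_pos.2 hA
  have hBs := Real.sq_sqrt hB.le
  have hAs := Real.sq_sqrt hA.le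
  have hcos := Real.cos_sq' θ
  have hs := ((Real.hasDerivAt_sin θ).pow 2).const_mul r₁
  have dY := (Real.hasDerivAt_tan hc.ne').mul
    (((hs.const_sub b).sqrt hB.ne').div ((hs.const_sub r₂).sqrt hA.ne') hA'.ne')
  have d := (dY.arctan.const_mul ν).sub ((dY.const_mul (k / ν)).arctan.const_mul k)
  refine d.congr_deriv ?_
  simp only [Pi.mul_apply, Pi.div_apply, Pi.pow_apply, Nat.cast_ofNat, Nat.reduceSub, pow_one,
    sepIntegrand, Real.tan_eq_sin_div_cos]
  clear d dY hs
  generalize √(b - r₁ * Real.sin θ ^ 2) = B at *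
  generalize √(r₂ - r₁ * Real.sin θ ^ 2) = A at *
  set N := r₂ * (b - 1) - (r₂ * (b - 1) - (r₂ - 1) * (b - r₁)) * Real.sin θ ^ 2 with hNdef
  set Δ := r₂ - (r₂ - (b - r₁)) * Real.sin θ ^ 2 with hΔdef
  set E := 1 - r₁ * Real.sin θ ^ 2 with hEdef
  -- The factor Δ is the denominator of the Möbius map. In `e2`, E comes from the pole s = 1 and N
  -- from its counterpart for the transported momentum; the condition on k makes the quadratic in
  -- sin² θ factor in this way.
  have e1 : 1 + (Real.sin θ / Real.cos θ * (B / A)) ^ 2 = Δ / (Real.cos θ ^ 2 * A ^ 2) := by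
    field_simp
    rw [hAs, hBs, hcos, hΔdef]; ring
  have e2 : 1 + (k / ν * (Real.sin θ / Real.cos θ * (B / A))) ^ 2
      = E * N / ((b - 1) * (Real.cos θ ^ 2 * A ^ 2)) := by
    have hk' : k ^ 2 / ν ^ 2 = (1 - r₁) * (r₂ - 1) / (b - 1) := by
      field_simp; linarith
    have : (k / ν * (Real.sin θ / Real.cos θ * (B / A))) ^ 2
        = k ^ 2 / ν ^ 2 * (Real.sin θ / Real.cos θ * (B / A)) ^ 2 := by ring
    rw [this, hk']
    field_simp
    rw [hAs, hBs, hcos, hEdef, hNdef]; ring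
  have e3 : k * (k / ν) = ν * ((1 - r₁) * (r₂ - 1)) / (b - 1) := by
    field_simp; linarith
  generalize hY' : 1 / Real.cos θ ^ 2 * (B / A) + _ = Y'
  have e4 : Y' * (Real.cos θ ^ 2 * A ^ 2)
      = ((r₂ - r₁ * Real.sin θ ^ 2) * (b - r₁ * Real.sin θ ^ 2)
        + r₁ * Real.sin θ ^ 2 * (1 - Real.sin θ ^ 2) * (b - r₂)) / (A * B) := by
    have hbr : b - r₂ = B ^ 2 - A ^ 2 := by linarith
    rw [← hY', ← hAs, ← hBs, ← hcos, hbr]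
    field_simp
    ring
  have e5 : ν * (1 / (1 + (Real.sin θ / Real.cos θ * (B / A)) ^ 2) * Y')
      - k * (1 / (1 + (k / ν * (Real.sin θ / Real.cos θ * (B / A))) ^ 2) * (k / ν * Y'))
      = ν * (Y' * (Real.cos θ ^ 2 * A ^ 2)) * (1 / Δ - (1 - r₁) * (r₂ - 1) / (E * N)) := by
    rw [e1, e2]
    have : ∀ q, k * (q * (k / ν * Y')) = q * Y' * (k * (k / ν)) := fun q => by ring
    rw [this, e3]
    field_simp
  rw [e5, e4, hcos]
  have hAs' : A / B = A ^ 2 / (A * B) := by field_simp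
  rw [hAs', hAs]
  field_simp
  rw [hΔdef, hNdef, hEdef]
  ring

/-- On the elliptic curve of p the cycles around the two gaps differ only by loops around the poles
of p ds, so the sum is a sum of residues. Concretely, with k = |l| the arctangents of the primitive
increase from 0 to π/2, and they contribute √(2h) and -|l|. -/
theorem prolateJ₁_add_prolateJ₃ (R : ProlateRoots b h l g (prolateRoot₁ b h l g)
    (prolateRoot₂ b h l g)) (hl : l ≠ 0) :
    prolateJ₁ b h l g + prolateJ₃ b h l g = √(2 * h) - |l| := by
  have hr₁ := (prolateRoot₁_lt_one_iff R).2 (Or.inl hl)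
  have hr₂ := (one_lt_prolateRoot₂_iff R).2 (Or.inl hl)
  rw [prolateJ₁, prolateJ₃, min_eq_left hr₁.le, max_eq_right hr₂.le]
  generalize prolateRoot₁ b h l g = r₁ at *
  generalize prolateRoot₂ b h l g = r₂ at *
  have hπ : (0 : ℝ) < Real.pi / 2 := by positivity
  have hrb : r₁ < b := R.r₁_lt_r₂.trans R.r₂_lt
  have hh := R.h_pos
  have hν : 0 < √(2 * h) := Real.sqrt_pos.2 (by positivity)
  have hk : |l| ^ 2 * (b - 1) = √(2 * h) ^ 2 * ((1 - r₁) * (r₂ - 1)) := by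
    rw [sq_abs, Real.sq_sqrt (by positivity)]
    linarith [R.l_eq]
  have hb1 : 0 < b - 1 := sub_pos.2 R.one_lt_b
  have hbr1 : 0 < b - r₁ := sub_pos.2 hrb
  have hr₂0 : 0 < r₂ := by linarith
  have hA : ∀ θ, 0 < √(r₂ - r₁ * Real.sin θ ^ 2) := fun θ =>
    Real.sqrt_pos.2 (by linarith [R.mul_sin_sq_le θ])
  have hB : ∀ θ, 0 < √(b - r₁ * Real.sin θ ^ 2) := fun θ =>
    Real.sqrt_pos.2 (by linarith [R.mul_sin_sq_le θ])
  have hN := pos_of_convex_sin_sq (mul_pos hr₂0 hb1) (mul_pos (sub_pos.2 hr₂) hbr1)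
  have hD := pos_of_convex_sin_sq hr₂0 hbr1
  have hc₁ := continuous_sepIntegrand (ν := √(2 * h)) (ρ₂ := r₂) R.r₁_pos hrb hr₁
  have hc₂ : Continuous fun θ => √(2 * h) * Real.cos θ ^ 2
      * (√(r₂ - r₁ * Real.sin θ ^ 2) / √(b - r₁ * Real.sin θ ^ 2))
      * (r₂ * (b - r₁) * (b - r₂)
        / ((r₂ * (b - 1) - (r₂ * (b - 1) - (r₂ - 1) * (b - r₁)) * Real.sin θ ^ 2)
          * (r₂ - (r₂ - (b - r₁)) * Real.sin θ ^ 2))) :=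
    (Continuous.mul (by fun_prop) (Continuous.div (by fun_prop) (by fun_prop)
      fun θ => (hB θ).ne')).mul (continuous_const.div (by fun_prop)
        fun θ => (mul_pos (hN θ) (hD θ)).ne')
  have hq : Continuous fun θ => √(b - r₁ * Real.sin θ ^ 2) / √(r₂ - r₁ * Real.sin θ ^ 2) :=
    Continuous.div (by fun_prop) (by fun_prop) fun θ => (hA θ).ne'
  have htop : Tendsto (fun θ => Real.tan θ
      * (√(b - r₁ * Real.sin θ ^ 2) / √(r₂ - r₁ * Real.sin θ ^ 2))) (𝓝[<] (Real.pi / 2)) atTop :=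
    Real.tendsto_tan_pi_div_two.atTop_mul_pos (div_pos (hB (Real.pi / 2)) (hA (Real.pi / 2)))
      (hq.continuousAt.tendsto.mono_left nhdsWithin_le_nhds)
  have harctan := Real.tendsto_arctan_atTop.mono_right nhdsWithin_le_nhds
  have hzero : Tendsto (fun θ => Real.tan θ
      * (√(b - r₁ * Real.sin θ ^ 2) / √(r₂ - r₁ * Real.sin θ ^ 2))) (𝓝[>] 0) (𝓝 0) := by
    have h1 : ContinuousAt (fun θ => Real.tan θ
        * (√(b - r₁ * Real.sin θ ^ 2) / √(r₂ - r₁ * Real.sin θ ^ 2))) 0 :=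
      (Real.continuousAt_tan.2 (by simp)).mul hq.continuousAt
    simpa using h1.tendsto.mono_left nhdsWithin_le_nhds
  have hatan : Tendsto Real.arctan (𝓝 0) (𝓝 0) := by
    simpa using Real.continuous_arctan.tendsto 0
  have hzero' := hzero.const_mul (|l| / √(2 * h))
  rw [mul_zero] at hzero'
  -- One-sided limits are used because the tangent is infinite at π/2; the hypothesis l ≠ 0 makes
  -- the second arctangent tend to π/2 as well.
  have key := intervalIntegral.integral_eq_sub_of_hasDerivAt_of_tendsto hπ
    (fun θ hθ => hasDerivAt_arctan_primitive R hr₁ hr₂ hν.ne' hk hθ)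
    ((hc₁.add hc₂).intervalIntegrable _ _)
    (((hatan.comp hzero).const_mul _).sub ((hatan.comp hzero').const_mul _))
    (((harctan.comp htop).const_mul _).sub
      ((harctan.comp (htop.const_mul_atTop (div_pos (abs_pos.2 hl) hν))).const_mul _))
  rw [intervalIntegral.integral_add (hc₁.intervalIntegrable _ _) (hc₂.intervalIntegrable _ _),
    ← integral_prolateMomentum_upper R hr₂,
    ← integral_sqrt_eq_integral_sepIntegrand hν.le R.r₁_pos R.r₁_lt_r₂ hrb hr₁] at key
  simp only [← prolateMomentum_eq R] at key
  rw [← mul_add, key]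
  field_simp
  ring

end ActionSum

/-! ### Local action variables -/

section LocalActions

variable {b : ℝ} {c : Fin 3 → ℝ} {j : (Fin 3 → ℝ) → ℝ}

theorem actionGrad_apply {n : ℕ} {I : (Fin n → ℝ) → Fin n → ℝ} {c : Fin n → ℝ}
    (hI : DifferentiableAt ℝ I c) (k i : Fin n) :
    actionGrad I c k i = fderiv ℝ (fun c => I c k) c (Pi.single i 1) := by
  have := hasFDerivAt_pi'.1 hI.hasFDerivAt k
  rw [actionGrad, this.fderiv]
  rfl

/-- `j` is near `c` a smooth function such that `2π dj` is a vector of the period lattice with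
minimal positive last component. -/
def IsSepActionAt (b : ℝ) (c : Fin 3 → ℝ) (j : (Fin 3 → ℝ) → ℝ) : Prop :=
  IsRegularValue b (c 0) (c 1) (c 2) ∧ ContDiffAt ℝ ∞ j c ∧ ∃ (rot : ℝ) (n : ℤ),
    IsRotation b (c 0) (c 1) (prolateRoot₁ b (c 0) (c 1) (c 2)) (prolateRoot₂ b (c 0) (c 1) (c 2))
      rot ∧
    ∀ v, 2 * Real.pi * fderiv ℝ j c v
      = v 2 * periodG b (c 0) (prolateRoot₁ b (c 0) (c 1) (c 2)) (prolateRoot₂ b (c 0) (c 1) (c 2))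
        - 2 * v 0
          * periodH b (c 0) (prolateRoot₁ b (c 0) (c 1) (c 2)) (prolateRoot₂ b (c 0) (c 1) (c 2))
        - (rot + n * (2 * Real.pi)) * v 1

theorem IsSepActionAt.congr {j' : (Fin 3 → ℝ) → ℝ} (hj : IsSepActionAt b c j)
    (h : j' =ᶠ[𝓝 c] j) : IsSepActionAt b c j' := by
  obtain ⟨h1, h2, rot, n, h3, h4⟩ := hj
  refine ⟨h1, h2.congr_of_eventuallyEq h, rot, n, h3, ?_⟩
  rwa [h.fderiv_eq]

theorem hasFDerivAt_coord (c : Fin 3 → ℝ) (i : Fin 3) :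
    HasFDerivAt (fun c : Fin 3 → ℝ => c i) (ContinuousLinearMap.proj (R := ℝ) i) c :=
  (ContinuousLinearMap.proj (R := ℝ) (φ := fun _ : Fin 3 => ℝ) i).hasFDerivAt

/-- Adding pl shifts the lattice vector by 2πp in the direction of ℓ₂₃, again a lattice vector; the
shift is absorbed in n. -/
theorem IsSepActionAt.add_int_mul (hj : IsSepActionAt b c j) (p : ℤ) :
    IsSepActionAt b c fun c => j c + p * c 1 := by
  obtain ⟨h1, h2, rot, n, h3, h4⟩ := hj
  refine ⟨h1, h2.add (ContDiff.contDiffAt (by fun_prop)), rot, n - p, h3, fun v => ?_⟩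
  have hd := (h2.differentiableAt (by simp)).hasFDerivAt.add
    ((hasFDerivAt_coord c 1).const_mul (p : ℝ))
  rw [show (fun c => j c + p * c 1) = j + fun c : Fin 3 → ℝ => (p : ℝ) * c 1 from rfl, hd.fderiv]
  simp only [add_apply, smul_apply, ContinuousLinearMap.proj_apply, smul_eq_mul]
  rw [mul_add, h4]
  push_cast
  ring

theorem isSepActionAt_prolateJ₁ (hb : 1 < b) (hc : c ∈ lowerValues b) :
    IsSepActionAt b c fun c => prolateJ₁ b (c 0) (c 1) (c 2) := by
  refine ⟨hc.1, (contDiffOn_prolateJ₁ hb).contDiffAt ((isOpen_lowerValues b).mem_nhds hc), _, 0,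
    Or.inl ⟨lowerValues_root hb hc, rfl⟩, fun v => ?_⟩
  rw [fderiv_prolateJ₁ hb hc]
  push_cast
  ring

theorem eventually_int_mul_eq_abs {ε : ℤ} (hl : c 1 ≠ 0) (hε : ε * c 1 = |c 1|) :
    ∀ᶠ d : Fin 3 → ℝ in 𝓝 c, d 1 ≠ 0 ∧ ε * d 1 = |d 1| := by
  have hcont : ContinuousAt (fun d : Fin 3 → ℝ => d 1) c := (continuous_apply 1).continuousAt
  rcases lt_or_gt_of_ne hl with h | h
  · rw [abs_of_neg h] at hε
    have h1 : (ε : ℝ) = -1 := mul_right_cancel₀ hl (by rw [hε]; ring)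
    filter_upwards [hcont.eventually_lt continuousAt_const h] with d hd
    exact ⟨hd.ne, by rw [h1, abs_of_neg hd]; ring⟩
  · rw [abs_of_pos h] at hε
    have h1 : (ε : ℝ) = 1 := mul_right_cancel₀ hl (by rw [hε]; ring)
    filter_upwards [hcont.eventually_const_lt h] with d hd
    exact ⟨hd.ne', by rw [h1, abs_of_pos hd]; ring⟩

/-- The sign ε is locally constant off l = 0, so the two local actions differ by ±l. That the sign
differs on the two sides is the source of the monodromy. -/
theorem sqrt_sub_prolateJ₃_eventuallyEq (hb : 1 < b) (hc : IsRegularValue b (c 0) (c 1) (c 2))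
    (hl : c 1 ≠ 0) {ε : ℤ} (hε : ε * c 1 = |c 1|) :
    (fun c : Fin 3 → ℝ => √(2 * c 0) - prolateJ₃ b (c 0) (c 1) (c 2))
      =ᶠ[𝓝 c] fun c => prolateJ₁ b (c 0) (c 1) (c 2) + ε * c 1 := by
  filter_upwards [(isOpen_isRegularValue b).mem_nhds hc, eventually_int_mul_eq_abs hl hε]
    with d hd1 hd2
  have := prolateJ₁_add_prolateJ₃ (hd1.roots hb) hd2.1
  rw [hd2.2]
  linarith

theorem exists_int_mul_eq_abs (x : ℝ) : ∃ ε : ℤ, ε * x = |x| := by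
  rcases le_total 0 x with h | h
  · exact ⟨1, by rw [abs_of_nonneg h]; simp⟩
  · exact ⟨-1, by rw [abs_of_nonpos h]; simp⟩

theorem contDiffAt_sqrt_two_mul (hb : 1 < b) (hc : IsRegularValue b (c 0) (c 1) (c 2)) :
    ContDiffAt ℝ ∞ (fun c : Fin 3 → ℝ => √(2 * c 0)) c :=
  (contDiffOn_prolateRoots hb).1.contDiffAt ((isOpen_isRegularValue b).mem_nhds hc)

/-- The third period `periodL` is left out: its integrand has a pole when r₁ = 1, which happens on
the ray l = 0, g > 2h. -/
theorem continuousAt_periods (hb : 1 < b) (hc : IsRegularValue b (c 0) (c 1) (c 2)) :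
    ContinuousAt (fun c : Fin 3 → ℝ => periodG b (c 0) (prolateRoot₁ b (c 0) (c 1) (c 2))
        (prolateRoot₂ b (c 0) (c 1) (c 2))) c ∧
      ContinuousAt (fun c : Fin 3 → ℝ => periodH b (c 0) (prolateRoot₁ b (c 0) (c 1) (c 2))
        (prolateRoot₂ b (c 0) (c 1) (c 2))) c := by
  set U := {c : Fin 3 → ℝ | IsRegularValue b (c 0) (c 1) (c 2)} with hUdef
  have hU : IsOpen U := isOpen_isRegularValue b
  obtain ⟨k0, k1, k2⟩ := contDiffOn_prolateRoots hb
  have hm : MapsTo (Prod.fst : (Fin 3 → ℝ) × ℝ → Fin 3 → ℝ) (U ×ˢ univ) U := fun p hp => hp.1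
  have hsin : ContDiffOn ℝ ∞ (fun p : (Fin 3 → ℝ) × ℝ => Real.sin p.2 ^ 2) (U ×ˢ univ) :=
    ContDiff.contDiffOn (by fun_prop)
  have hs := (k1.comp contDiffOn_fst hm).mul hsin
  have hroots : ∀ p ∈ U ×ˢ (univ : Set ℝ), ProlateRoots b (p.1 0) (p.1 1) (p.1 2)
      (prolateRoot₁ b (p.1 0) (p.1 1) (p.1 2)) (prolateRoot₂ b (p.1 0) (p.1 1) (p.1 2)) :=
    fun p hp => IsRegularValue.roots hb hp.1
  have hf : ContDiffOn ℝ ∞ (fun p : (Fin 3 → ℝ) × ℝ => phaseSpeed b (p.1 0)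
      (prolateRoot₁ b (p.1 0) (p.1 1) (p.1 2)) (prolateRoot₂ b (p.1 0) (p.1 1) (p.1 2)) p.2)
      (U ×ˢ univ) := by
    refine (contDiffOn_const.mul (k0.comp contDiffOn_fst hm)).mul
      (((contDiffOn_const.sub hs).sqrt fun p hp => ?_).mul
        (((k2.comp contDiffOn_fst hm).sub hs).sqrt fun p hp => ?_))
    · have R := hroots p hp
      have := R.mul_sin_sq_le p.2
      simp only [Function.comp_apply]
      linarith [R.r₁_lt_r₂, R.r₂_lt]
    · have R := hroots p hp
      have := R.mul_sin_sq_le p.2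
      simp only [Function.comp_apply]
      linarith [R.r₁_lt_r₂]
  have hf0 := fun p hp => ((hroots p hp).phaseSpeed_pos p.2).ne'
  exact ⟨((contDiffOn_intervalIntegral hU (contDiffOn_const.div hf hf0) 0
      (2 * Real.pi)).continuousOn.continuousAt (hU.mem_nhds hc)),
    ((contDiffOn_intervalIntegral hU (hs.div hf hf0) 0
      (2 * Real.pi)).continuousOn.continuousAt (hU.mem_nhds hc))⟩

theorem prolateJ₃_neg (h l g : ℝ) : prolateJ₃ b h (-l) g = prolateJ₃ b h l g := by
  simp only [prolateJ₃, prolateRoot₂, prolateMomentum, neg_sq]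

/-- Off l = 0 this is J₁ up to ±l. On the ray itself the function is smooth and even in l, which
gives its l-derivative; the other derivatives are limits from l > 0. -/
theorem isSepActionAt_sqrt_sub_prolateJ₃ (hb : 1 < b) (hc : c ∈ upperValues b) :
    IsSepActionAt b c fun c => √(2 * c 0) - prolateJ₃ b (c 0) (c 1) (c 2) := by
  set j : (Fin 3 → ℝ) → ℝ := fun c => √(2 * c 0) - prolateJ₃ b (c 0) (c 1) (c 2) with hj
  have hoff : ∀ c : Fin 3 → ℝ, IsRegularValue b (c 0) (c 1) (c 2) → c 1 ≠ 0 →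
      IsSepActionAt b c j := fun c hc hl => by
    obtain ⟨ε, hε⟩ := exists_int_mul_eq_abs (c 1)
    exact ((isSepActionAt_prolateJ₁ hb ⟨hc, Or.inl hl⟩).add_int_mul ε).congr
      (sqrt_sub_prolateJ₃_eventuallyEq hb hc hl hε)
  by_cases hl : c 1 = 0
  swap
  · exact hoff c hc.1 hl
  have hsm : ContDiffAt ℝ ∞ j c := (contDiffAt_sqrt_two_mul hb hc.1).sub
    ((contDiffOn_prolateJ₃ hb).contDiffAt ((isOpen_upperValues b).mem_nhds hc))
  refine ⟨hc.1, hsm, 0, 0, Or.inr ⟨hl, upperValues_root hb hc, rfl⟩, fun v => ?_⟩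
  have hd : HasFDerivAt j (fderiv ℝ j c) c := (hsm.differentiableAt (by simp)).hasFDerivAt
  have hline : HasDerivAt (fun t : ℝ => c + t • (Pi.single 1 1 : Fin 3 → ℝ)) (Pi.single 1 1) 0 := by
    simpa using ((hasDerivAt_id (0 : ℝ)).smul_const (Pi.single 1 1 : Fin 3 → ℝ)).const_add c
  have hlc : c + (0 : ℝ) • (Pi.single 1 1 : Fin 3 → ℝ) = c := by simp
  -- Since l = 0 at c and j is even in l, its derivative in the l-direction vanishes. This agrees
  -- with the rotation being zero there.
  have hodd : fderiv ℝ j c (Pi.single 1 1) = 0 := by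
    have h1 : HasDerivAt (fun t : ℝ => j (c + t • (Pi.single 1 1 : Fin 3 → ℝ)))
        (fderiv ℝ j c (Pi.single 1 1)) 0 := by
      rw [← hlc] at hd
      have := hd.comp_hasDerivAt 0 hline
      rw [hlc] at this
      exact this
    have h2 : HasDerivAt (fun t : ℝ => j (c + (-t) • (Pi.single 1 1 : Fin 3 → ℝ)))
        (-fderiv ℝ j c (Pi.single 1 1)) 0 := by
      have h3 := h1
      rw [← neg_zero] at h3
      have := h3.scomp (0 : ℝ) (hasDerivAt_neg (0 : ℝ))
      rw [neg_one_smul] at this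
      exact this
    have h4 : (fun t : ℝ => j (c + (-t) • (Pi.single 1 1 : Fin 3 → ℝ)))
        = fun t : ℝ => j (c + t • (Pi.single 1 1 : Fin 3 → ℝ)) := by
      funext t
      simp [hj, hl, prolateJ₃_neg]
    rw [h4] at h2
    linarith [h1.unique h2]
  -- In directions with no l-component the formula does not contain the rotation, so it passes to
  -- the limit by continuity of the two remaining periods.
  have hperp : ∀ w : Fin 3 → ℝ, w 1 = 0 → 2 * Real.pi * fderiv ℝ j c w
      = w 2 * periodG b (c 0) (prolateRoot₁ b (c 0) (c 1) (c 2)) (prolateRoot₂ b (c 0) (c 1) (c 2))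
        - 2 * w 0 * periodH b (c 0) (prolateRoot₁ b (c 0) (c 1) (c 2))
          (prolateRoot₂ b (c 0) (c 1) (c 2)) := fun w hw => by
    obtain ⟨p1, p2⟩ := continuousAt_periods hb hc.1
    have hcont : ContinuousAt (fun d => 2 * Real.pi * fderiv ℝ j d w) c :=
      ((hsm.continuousAt_fderiv (by simp)).clm_apply continuousAt_const).const_mul _
    have hlim : Tendsto (fun t : ℝ => c + t • (Pi.single 1 1 : Fin 3 → ℝ)) (𝓝[>] 0) (𝓝 c) := by
      have := hline.continuousAt.tendsto
      rw [hlc] at this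
      exact this.mono_left nhdsWithin_le_nhds
    have hright := ((p1.const_mul (w 2)).sub (p2.const_mul (2 * w 0))).tendsto.comp hlim
    refine tendsto_nhds_unique (hcont.tendsto.comp hlim) (hright.congr' ?_)
    filter_upwards [self_mem_nhdsWithin,
      hlim.eventually ((isOpen_isRegularValue b).mem_nhds hc.1)] with t ht hreg
    obtain ⟨-, -, rot, n, -, h4⟩ := hoff _ hreg (by simpa [hl] using (ne_of_gt ht))
    simp only [Function.comp_apply, Pi.sub_apply]
    rw [h4 w, hw]
    ring
  have hv : v = (v - v 1 • (Pi.single 1 1 : Fin 3 → ℝ)) + v 1 • (Pi.single 1 1 : Fin 3 → ℝ) := by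
    simp
  conv_lhs => rw [hv]
  rw [map_add, map_smul, hodd, smul_zero, add_zero, hperp _ (by simp)]
  simp

/-- The gradient of j is a lattice vector for one turn of Φ, that of l generates the rotation by
ℓ₂₃, and √(2h) has the normalized geodesic flow as its 2π-periodic flow. The given triple is a
unimodular combination of j, l and √(2h), for any integer q. In this form it covers J₃ = √(2h) - |l|
- J₁ and all continuations. -/
theorem isActionVariables_prolate (hb : 1 < b) {U : Set (Fin 3 → ℝ)} (hU : IsOpen U)
    {I : (Fin 3 → ℝ) → Fin 3 → ℝ}
    (hI : ∀ c ∈ U, ∃ (j : (Fin 3 → ℝ) → ℝ) (q : ℤ), IsSepActionAt b c j ∧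
      I =ᶠ[𝓝 c] fun c => ![j c, c 1, √(2 * c 0) - q * c 1 - j c]) :
    IsActionVariables diracMatrix cotangentS3 (prolateMap b) U I := by
  have hsm : ∀ c ∈ U, ContDiffAt ℝ ∞ I c := fun c hc => by
    obtain ⟨j, q, ⟨hreg, hj, -⟩, hIj⟩ := hI c hc
    refine ContDiffAt.congr_of_eventuallyEq (contDiffAt_pi.2 fun k => ?_) hIj
    fin_cases k
    · exact hj
    · exact ContDiff.contDiffAt (f := fun c : Fin 3 → ℝ => c 1) (by fun_prop)
    · exact ((contDiffAt_sqrt_two_mul hb hreg).sub (ContDiff.contDiffAt (by fun_prop))).sub hj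
  refine ⟨hU, fun c hc => (hsm c hc).contDiffWithinAt, fun c hc => ?_⟩
  have hgrad := actionGrad_apply ((hsm c hc).differentiableAt (by simp))
  obtain ⟨j, q, ⟨hreg, hj, rot, n, hrot, hdj⟩, hIj⟩ := hI c hc
  have R := hreg.roots hb
  have hh := R.h_pos
  have hπ := Real.pi_pos
  have hν : 0 < √(2 * c 0) := Real.sqrt_pos.2 (by positivity)
  have hP := periodG_pos R
  have hlat := fun T => mem_periodLattice_prolate_iff R hrot hreg.1 hreg.2.1 (T := T)
  have hcc : ![c 0, c 1, c 2] = c := by funext i; fin_cases i <;> rfl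
  rw [hcc] at hlat
  generalize periodG b (c 0) _ _ = P at *
  generalize periodH b (c 0) _ _ = S at *
  have hjd := (hj.differentiableAt (by simp)).hasFDerivAt
  have hνd : HasFDerivAt (fun c : Fin 3 → ℝ => √(2 * c 0))
      ((1 / (2 * √(2 * c 0))) • ((2 : ℝ) • ContinuousLinearMap.proj (R := ℝ) (0 : Fin 3))) c :=
    ((hasFDerivAt_coord c 0).const_mul 2).sqrt (by positivity)
  have hrow : ∀ k i, actionGrad I c k i
      = fderiv ℝ (fun c => ![j c, c 1, √(2 * c 0) - q * c 1 - j c] k) c (Pi.single i 1) := by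
    intro k i
    rw [hgrad, Filter.EventuallyEq.fderiv_eq (hIj.mono fun d hd => congrFun hd k)]
  have r0 : ∀ i, 2 * Real.pi * actionGrad I c 0 i = (Pi.single i 1 : Fin 3 → ℝ) 2 * P
      - 2 * (Pi.single i 1 : Fin 3 → ℝ) 0 * S
      - (rot + n * (2 * Real.pi)) * (Pi.single i 1 : Fin 3 → ℝ) 1 := fun i => by
    rw [hrow]; exact hdj _
  have r1 : ∀ i, actionGrad I c 1 i = (Pi.single i 1 : Fin 3 → ℝ) 1 := fun i => by
    rw [hrow]
    exact congrArg (fun L : (Fin 3 → ℝ) →L[ℝ] ℝ => L (Pi.single i 1)) (hasFDerivAt_coord c 1).fderiv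
  have r2 : ∀ i, actionGrad I c 2 i = (Pi.single i 1 : Fin 3 → ℝ) 0 / √(2 * c 0)
      - q * (Pi.single i 1 : Fin 3 → ℝ) 1 - actionGrad I c 0 i := fun i => by
    rw [hrow, hrow]
    have := ((hνd.sub ((hasFDerivAt_coord c 1).const_mul (q : ℝ))).sub hjd).fderiv
    refine (congrArg (fun L : (Fin 3 → ℝ) →L[ℝ] ℝ => L (Pi.single i 1)) this).trans ?_
    simp only [sub_apply, smul_apply, ContinuousLinearMap.proj_apply, smul_eq_mul]
    congr 2
    field_simp
  have c00 := r0 0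
  have c01 := r0 1
  have c02 := r0 2
  have c10 := r1 0
  have c11 := r1 1
  have c12 := r1 2
  have c20 := r2 0
  have c21 := r2 1
  have c22 := r2 2
  clear hνd r0 r2
  generalize √(2 * c 0) = ν at *
  simp at c00 c01 c02 c10 c11 c12 c20 c21 c22
  constructor
  · rw [Fintype.linearIndependent_iff]
    intro y hy
    have e0 := congrFun hy 0
    have e1 := congrFun hy 1
    have e2 := congrFun hy 2
    simp only [Fin.sum_univ_three, Pi.add_apply, Pi.smul_apply, smul_eq_mul, Pi.zero_apply, c10,
      c11, c12, c20, c21, c22] at e0 e1 e2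
    have hg2 : actionGrad I c 0 2 ≠ 0 := fun h0 => by rw [h0] at c02; simp at c02; linarith
    have h02 : y 0 - y 2 = 0 := by
      refine (mul_eq_zero.1 ?_).resolve_right hg2
      linarith
    have hy2 : y 2 = 0 := by
      have : y 2 * (ν)⁻¹ = 0 := by
        linear_combination e0 - actionGrad I c 0 0 * h02
      exact (mul_eq_zero.1 this).resolve_right (inv_ne_zero hν.ne')
    have hy0 : y 0 = 0 := by linarith
    rw [hy2, hy0] at e1
    intro i
    fin_cases i
    · exact hy0
    · simpa using e1
    · exact hy2
  · intro T
    rw [hlat]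
    have expand : ∀ m : Fin 3 → ℤ, T = (2 * Real.pi) • ∑ k, (m k : ℝ) • actionGrad I c k ↔
        T 2 = ((m 0 - m 2 : ℤ) : ℝ) * P ∧
        T 1 = ((m 1 - q * m 2 - n * (m 0 - m 2) : ℤ) : ℝ) * (2 * Real.pi)
          - ((m 0 - m 2 : ℤ) : ℝ) * rot ∧
        T 0 = (m 2 : ℝ) * (2 * Real.pi / ν) - 2 * ((m 0 - m 2 : ℤ) : ℝ) * S := by
      intro m
      have s0 : ((2 * Real.pi) • ∑ k, (m k : ℝ) • actionGrad I c k) 0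
          = (m 2 : ℝ) * (2 * Real.pi / ν) - 2 * ((m 0 - m 2 : ℤ) : ℝ) * S := by
        simp only [Fin.sum_univ_three, Pi.add_apply, Pi.smul_apply, smul_eq_mul, c10, c20]
        push_cast
        linear_combination ((m 0 : ℝ) - m 2) * c00
      have s1 : ((2 * Real.pi) • ∑ k, (m k : ℝ) • actionGrad I c k) 1
          = ((m 1 - q * m 2 - n * (m 0 - m 2) : ℤ) : ℝ) * (2 * Real.pi)
            - ((m 0 - m 2 : ℤ) : ℝ) * rot := by
        simp only [Fin.sum_univ_three, Pi.add_apply, Pi.smul_apply, smul_eq_mul, c11, c21]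
        push_cast
        linear_combination ((m 0 : ℝ) - m 2) * c01
      have s2 : ((2 * Real.pi) • ∑ k, (m k : ℝ) • actionGrad I c k) 2
          = ((m 0 - m 2 : ℤ) : ℝ) * P := by
        simp only [Fin.sum_univ_three, Pi.add_apply, Pi.smul_apply, smul_eq_mul, c12, c22]
        push_cast
        linear_combination ((m 0 : ℝ) - m 2) * c02
      rw [← s0, ← s1, ← s2]
      constructor
      · rintro h
        exact ⟨congrFun h 2, congrFun h 1, congrFun h 0⟩
      · rintro ⟨h2, h1, h0⟩
        funext i
        fin_cases i
        · exact h0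
        · exact h1
        · exact h2
    simp only [expand]
    constructor
    · rintro ⟨m, k, i, h2, h1, h0⟩
      -- The inverse of the unimodular substitution that appears in `expand`.
      refine ⟨![m + i, k + q * i + n * m, i], ?_⟩
      simp only [Matrix.cons_val]
      rw [show m + i - i = m by ring, show k + q * i + n * m - q * i - n * m = k by ring]
      exact ⟨h2, h1, h0⟩
    · rintro ⟨m, h2, h1, h0⟩
      exact ⟨_, _, _, h2, h1, h0⟩

/-- At fixed energy the H-component of the lattice is forgotten, and j restricted to the plane of
energy h together with l gives a basis. -/
theorem isActionVariables_reducedProlate (hb : 1 < b) {h : ℝ} {U : Set (Fin 2 → ℝ)}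
    (hU : IsOpen U) {I : (Fin 2 → ℝ) → Fin 2 → ℝ}
    (hI : ∀ c ∈ U, ∃ j : (Fin 3 → ℝ) → ℝ, IsSepActionAt b ![h, c 0, c 1] j ∧
      I =ᶠ[𝓝 c] fun c => ![j ![h, c 0, c 1], c 0]) :
    IsActionVariables liePoissonMatrix (reducedSpace h) (reducedProlateMap b) U I := by
  have hemb : ContDiff ℝ ∞ fun c : Fin 2 → ℝ => (![h, c 0, c 1] : Fin 3 → ℝ) := by
    rw [contDiff_pi]
    intro i
    fin_cases i
    · exact contDiff_const
    · exact contDiff_apply ℝ ℝ (0 : Fin 2)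
    · exact contDiff_apply ℝ ℝ (1 : Fin 2)
  have hemb' : ∀ c : Fin 2 → ℝ, HasFDerivAt (fun c : Fin 2 → ℝ => (![h, c 0, c 1] : Fin 3 → ℝ))
      (ContinuousLinearMap.pi ![0, ContinuousLinearMap.proj (R := ℝ) (0 : Fin 2),
        ContinuousLinearMap.proj (R := ℝ) (1 : Fin 2)]) c := fun c => by
    rw [hasFDerivAt_pi]
    intro i
    fin_cases i
    · exact hasFDerivAt_const h c
    · exact (ContinuousLinearMap.proj (R := ℝ) (φ := fun _ : Fin 2 => ℝ) 0).hasFDerivAt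
    · exact (ContinuousLinearMap.proj (R := ℝ) (φ := fun _ : Fin 2 => ℝ) 1).hasFDerivAt
  have hsm : ∀ c ∈ U, ContDiffAt ℝ ∞ I c := fun c hc => by
    obtain ⟨j, ⟨hreg, hj, -⟩, hIj⟩ := hI c hc
    refine ContDiffAt.congr_of_eventuallyEq (contDiffAt_pi.2 fun k => ?_) hIj
    fin_cases k
    · exact (ContDiffAt.comp c hj hemb.contDiffAt :
        ContDiffAt ℝ ∞ (j ∘ fun c : Fin 2 → ℝ => ![h, c 0, c 1]) c)
    · exact ContDiff.contDiffAt (f := fun c : Fin 2 → ℝ => c 0) (by fun_prop)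
  refine ⟨hU, fun c hc => (hsm c hc).contDiffWithinAt, fun c hc => ?_⟩
  have hgrad := actionGrad_apply ((hsm c hc).differentiableAt (by simp))
  obtain ⟨j, ⟨hreg, hj, rot, n, hrot, hdj⟩, hIj⟩ := hI c hc
  simp only [Matrix.cons_val] at hreg hrot hdj
  have R := hreg.roots hb
  have hπ := Real.pi_pos
  have hP := periodG_pos R
  have hlat := fun T => mem_periodLattice_reduced_iff R hrot hreg.1 hreg.2.1 (T := T)
  have hcc : ![c 0, c 1] = c := by funext i; fin_cases i <;> rfl
  rw [hcc] at hlat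
  generalize periodG b h _ _ = P at *
  generalize periodH b h _ _ = S at *
  have hjd := (hj.differentiableAt (by simp)).hasFDerivAt
  have hrow : ∀ k i, actionGrad I c k i
      = fderiv ℝ (fun c : Fin 2 → ℝ => ![j ![h, c 0, c 1], c 0] k) c (Pi.single i 1) := by
    intro k i
    rw [hgrad, Filter.EventuallyEq.fderiv_eq (hIj.mono fun d hd => congrFun hd k)]
  have r0 : ∀ i, 2 * Real.pi * actionGrad I c 0 i = (Pi.single i 1 : Fin 2 → ℝ) 1 * P
      - (rot + n * (2 * Real.pi)) * (Pi.single i 1 : Fin 2 → ℝ) 0 := fun i => by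
    rw [hrow, show (fun c : Fin 2 → ℝ => ![j ![h, c 0, c 1], c 0] 0)
      = j ∘ fun c : Fin 2 → ℝ => ![h, c 0, c 1] from rfl, (hjd.comp c (hemb' c)).fderiv,
      ContinuousLinearMap.comp_apply, hdj]
    simp
  have r1 : ∀ i, actionGrad I c 1 i = (Pi.single i 1 : Fin 2 → ℝ) 0 := fun i => by
    rw [hrow]
    exact congrArg (fun L : (Fin 2 → ℝ) →L[ℝ] ℝ => L (Pi.single i 1))
      (ContinuousLinearMap.proj (R := ℝ) (φ := fun _ : Fin 2 => ℝ) 0).hasFDerivAt.fderiv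
  have c00 := r0 0
  have c01 := r0 1
  have c10 := r1 0
  have c11 := r1 1
  simp at c00 c01 c10 c11
  constructor
  · rw [Fintype.linearIndependent_iff]
    intro y hy
    have e0 := congrFun hy 0
    have e1 := congrFun hy 1
    simp only [Fin.sum_univ_two, Pi.add_apply, Pi.smul_apply, smul_eq_mul, Pi.zero_apply, c10,
      c11] at e0 e1
    have hg1 : actionGrad I c 0 1 ≠ 0 := fun h0 => by rw [h0] at c01; simp at c01; linarith
    have hy0 : y 0 = 0 := (mul_eq_zero.1 (by linarith : y 0 * actionGrad I c 0 1 = 0)).resolve_right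
      hg1
    rw [hy0] at e0
    intro i
    fin_cases i
    · exact hy0
    · simpa using e0
  · intro T
    rw [hlat]
    have expand : ∀ m : Fin 2 → ℤ, T = (2 * Real.pi) • ∑ k, (m k : ℝ) • actionGrad I c k ↔
        T 1 = (m 0 : ℝ) * P ∧
        T 0 = ((m 1 - n * m 0 : ℤ) : ℝ) * (2 * Real.pi) - (m 0 : ℝ) * rot := by
      intro m
      have s0 : ((2 * Real.pi) • ∑ k, (m k : ℝ) • actionGrad I c k) 0
          = ((m 1 - n * m 0 : ℤ) : ℝ) * (2 * Real.pi) - (m 0 : ℝ) * rot := by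
        simp only [Fin.sum_univ_two, Pi.add_apply, Pi.smul_apply, smul_eq_mul, c10]
        push_cast
        linear_combination (m 0 : ℝ) * c00
      have s1 : ((2 * Real.pi) • ∑ k, (m k : ℝ) • actionGrad I c k) 1 = (m 0 : ℝ) * P := by
        simp only [Fin.sum_univ_two, Pi.add_apply, Pi.smul_apply, smul_eq_mul, c11]
        linear_combination (m 0 : ℝ) * c01
      rw [← s0, ← s1]
      constructor
      · rintro h
        exact ⟨congrFun h 1, congrFun h 0⟩
      · rintro ⟨h1, h0⟩
        funext i
        fin_cases i
        · exact h0
        · exact h1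
    simp only [expand]
    constructor
    · rintro ⟨m, k, h1, h0⟩
      refine ⟨![m, k + n * m], ?_⟩
      simp only [Matrix.cons_val]
      rw [show k + n * m - n * m = k by ring]
      exact ⟨h1, h0⟩
    · rintro ⟨m, h1, h0⟩
      exact ⟨_, _, h1, h0⟩

end LocalActions

/-! ### Continuation of action variables -/

section Continuation

variable {ι : Type*} [Fintype ι] [DecidableEq ι] {n : ℕ} {B : (ι → ℝ) → Matrix ι ι ℝ}
  {P : Set (ι → ℝ)} {F : (ι → ℝ) → Fin n → ℝ} {U V : Set (Fin n → ℝ)}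
  {I I' E : (Fin n → ℝ) → Fin n → ℝ} {c : Fin n → ℝ}

/-- The Jacobian matrix of `I` at `c`, whose rows are the gradients of the components. -/
noncomputable def actionJacobian (I : (Fin n → ℝ) → Fin n → ℝ) (c : Fin n → ℝ) :
    Matrix (Fin n) (Fin n) ℝ :=
  Matrix.of (actionGrad I c)

theorem IsActionVariables.contDiffAt (hI : IsActionVariables B P F U I) (hc : c ∈ U) :
    ContDiffAt ℝ ∞ I c :=
  hI.2.1.contDiffAt (hI.1.mem_nhds hc)

theorem IsActionVariables.differentiableAt (hI : IsActionVariables B P F U I) (hc : c ∈ U) :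
    DifferentiableAt ℝ I c :=
  (hI.contDiffAt hc).differentiableAt (by simp)

theorem IsActionVariables.isUnit_actionJacobian (hI : IsActionVariables B P F U I) (hc : c ∈ U) :
    IsUnit (actionJacobian I c) :=
  Matrix.linearIndependent_rows_iff_isUnit.1 (hI.2.2 c hc).1

theorem IsActionVariables.continuousAt_actionJacobian (hI : IsActionVariables B P F U I)
    (hc : c ∈ U) : ContinuousAt (actionJacobian I) c := by
  have h1 : ContinuousAt (fderiv ℝ I) c := (hI.contDiffAt hc).continuousAt_fderiv (by simp)
  refine continuousAt_pi.2 fun k => continuousAt_pi.2 fun j => ?_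
  exact (continuous_apply k).continuousAt.comp (h1.clm_apply continuousAt_const)

theorem actionJacobian_mulVec_add (hI : DifferentiableAt ℝ I c) (N : Matrix (Fin n) (Fin n) ℝ)
    (κ : Fin n → ℝ) :
    actionJacobian (fun c => N.mulVec (I c) + κ) c = N * actionJacobian I c := by
  have h1 := ((Matrix.mulVecLin N).toContinuousLinearMap.hasFDerivAt.comp c
    hI.hasFDerivAt).add_const κ
  have h2 : fderiv ℝ (fun c => N.mulVec (I c) + κ) c
      = (Matrix.mulVecLin N).toContinuousLinearMap.comp (fderiv ℝ I c) := h1.fderiv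
  ext k j
  simp only [actionJacobian, Matrix.of_apply, actionGrad, h2]
  rfl

theorem actionJacobian_congr (h : I' =ᶠ[𝓝 c] I) : actionJacobian I' c = actionJacobian I c := by
  ext k j
  simp only [actionJacobian, Matrix.of_apply, actionGrad, h.fderiv_eq]

theorem fderiv_eq_of_actionJacobian_eq (h : actionJacobian I' c = actionJacobian I c) :
    fderiv ℝ I' c = fderiv ℝ I c := by
  ext1 v
  have h1 : ∀ j, fderiv ℝ I' c (Pi.single j 1) = fderiv ℝ I c (Pi.single j 1) := fun j => by
    funext k
    exact congrFun (congrFun h k) j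
  rw [pi_eq_sum_univ' v, map_sum, map_sum]
  simp only [map_smul, h1]

/-- An affine relation with integer matrix between action variables is unique. -/
theorem IsActionVariables.affine_unique (hI : IsActionVariables B P F U I) (hc : c ∈ U)
    {N M : Matrix (Fin n) (Fin n) ℤ} {κ μ : Fin n → ℝ}
    (h : (fun c => (N.map (Int.cast : ℤ → ℝ)).mulVec (I c) + κ) =ᶠ[𝓝 c]
      fun c => (M.map (Int.cast : ℤ → ℝ)).mulVec (I c) + μ) : N = M ∧ κ = μ := by
  have h1 := actionJacobian_congr h
  have hd := hI.differentiableAt hc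
  rw [actionJacobian_mulVec_add hd, actionJacobian_mulVec_add hd] at h1
  have h2 := (hI.isUnit_actionJacobian hc).mul_right_cancel h1
  have h3 : N = M := Matrix.map_injective Int.cast_injective h2
  refine ⟨h3, ?_⟩
  have h4 := h.eq_of_nhds
  simp only [h3] at h4
  exact add_left_cancel h4

/-- Two systems of action variables are related by an affine map with integer linear part. -/
theorem IsActionVariables.exists_affine (hI : IsActionVariables B P F U I)
    (hI' : IsActionVariables B P F V I') (hcU : c ∈ U) (hcV : c ∈ V) :
    ∃ (N : Matrix (Fin n) (Fin n) ℤ) (κ : Fin n → ℝ),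
      I' =ᶠ[𝓝 c] fun c => (N.map (Int.cast : ℤ → ℝ)).mulVec (I c) + κ := by
  have hπ : (2 * Real.pi) ≠ 0 := by positivity
  have hint : ∀ d ∈ U ∩ V, ∃ N : Matrix (Fin n) (Fin n) ℤ,
      actionJacobian I' d = N.map (Int.cast : ℤ → ℝ) * actionJacobian I d := by
    rintro d ⟨hd, hd'⟩
    have hrow : ∀ k, ∃ m : Fin n → ℤ, actionGrad I' d k = ∑ l, (m l : ℝ) • actionGrad I d l := by
      intro k
      -- Each 2π dI'ₖ lies in the period lattice, of which 2π dI is a ℤ-basis.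
      have h1 : (2 * Real.pi) • actionGrad I' d k ∈ periodLattice B P F d :=
        ((hI'.2.2 d hd').2 _).2 ⟨Pi.single k 1, by simp [Pi.single_apply]⟩
      obtain ⟨m, hm⟩ := ((hI.2.2 d hd).2 _).1 h1
      exact ⟨m, smul_right_injective _ hπ hm⟩
    choose m hm using hrow
    refine ⟨Matrix.of m, ?_⟩
    ext k j
    have := congrFun (hm k) j
    simpa [actionJacobian, Matrix.mul_apply] using this
  obtain ⟨N, hN⟩ := hint c ⟨hcU, hcV⟩
  have hcont : ContinuousAt (fun d => actionJacobian I' d * (actionJacobian I d)⁻¹) c := by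
    have h1 := hI.continuousAt_actionJacobian hcU
    have h2 : ContinuousAt (fun d => (actionJacobian I d)⁻¹) c :=
      ContinuousAt.comp (g := Inv.inv) (continuousAt_matrix_inv _
        (NormedRing.inverse_continuousAt
          ((Matrix.isUnit_iff_isUnit_det _).1 (hI.isUnit_actionJacobian hcU)).unit)) h1
    exact (hI'.continuousAt_actionJacobian hcV).mul h2
  have hquot : ∀ d ∈ U ∩ V, ∀ M : Matrix (Fin n) (Fin n) ℤ,
      actionJacobian I' d = M.map (Int.cast : ℤ → ℝ) * actionJacobian I d →
      actionJacobian I' d * (actionJacobian I d)⁻¹ = M.map (Int.cast : ℤ → ℝ) := by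
    intro d hd M hM
    rw [hM, Matrix.mul_assoc, Matrix.mul_nonsing_inv _
      ((Matrix.isUnit_iff_isUnit_det _).1 (hI.isUnit_actionJacobian hd.1)), Matrix.mul_one]
  have hconst : ∀ᶠ d in 𝓝 c,
      actionJacobian I' d = N.map (Int.cast : ℤ → ℝ) * actionJacobian I d := by
    -- The transition matrix is continuous with integer entries. Closer than 1 to its value at c, it
    -- has to be equal to that value.
    have hclose : ∀ᶠ d in 𝓝 c, ∀ k j,
        |(actionJacobian I' d * (actionJacobian I d)⁻¹) k j - (N k j : ℝ)| < 1 := by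
      refine eventually_all.2 fun k => eventually_all.2 fun j => ?_
      have h1 : ContinuousAt (fun d => (actionJacobian I' d * (actionJacobian I d)⁻¹) k j) c :=
        continuousAt_pi.1 (continuousAt_pi.1 hcont k) j
      have h2 := (h1.sub (continuousAt_const (y := (N k j : ℝ)))).abs
      refine h2.eventually_lt continuousAt_const ?_
      simp [hquot c ⟨hcU, hcV⟩ N hN]
    filter_upwards [hclose, (hI.1.inter hI'.1).mem_nhds ⟨hcU, hcV⟩] with d hd hdUV
    obtain ⟨M, hM⟩ := hint d hdUV
    rw [hquot d hdUV M hM] at hd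
    have : M = N := by
      ext k j
      have h1 := hd k j
      rw [Matrix.map_apply, ← Int.cast_sub, ← Int.cast_abs] at h1
      have h2 : |M k j - N k j| < 1 := by exact_mod_cast h1
      linarith [Int.abs_lt_one_iff.1 h2]
    rw [hM, this]
  -- On a ball, which is connected, functions with equal derivatives differ by a constant.
  obtain ⟨ε, hε, hball⟩ := Metric.eventually_nhds_iff_ball.1
    (hconst.and ((hI.1.inter hI'.1).mem_nhds ⟨hcU, hcV⟩))
  have hdiff : ∀ d ∈ Metric.ball c ε,
      DifferentiableAt ℝ (fun c => (N.map (Int.cast : ℤ → ℝ)).mulVec (I c) + (0 : Fin n → ℝ)) d :=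
    fun d hd => ((Matrix.mulVecLin (N.map (Int.cast : ℤ → ℝ))).toContinuousLinearMap.differentiableAt.comp
      d (hI.differentiableAt (hball d hd).2.1)).add_const 0
  obtain ⟨κ, hκ⟩ := Metric.isOpen_ball.exists_eq_add_of_fderiv_eq
    (convex_ball c ε).isPreconnected
    (fun d hd => (hI'.differentiableAt (hball d hd).2.2).differentiableWithinAt)
    (fun d hd => (hdiff d hd).differentiableWithinAt)
    (fun d hd => fderiv_eq_of_actionJacobian_eq (by
      rw [actionJacobian_mulVec_add (hI.differentiableAt (hball d hd).2.1), (hball d hd).1]))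
  refine ⟨N, κ, Filter.eventually_of_mem (Metric.ball_mem_nhds c hε) fun d hd => ?_⟩
  have := hκ hd
  simpa using this

variable {γ : ℝ → Fin n → ℝ} {J K : ℝ → (Fin n → ℝ) → Fin n → ℝ}

/-- An affine relation between two continuations persists along the curve. -/
theorem IsActionContinuation.affine_relation (hJ : IsActionContinuation B P F γ J)
    (hK : IsActionContinuation B P F γ K) (hγ : ContinuousOn γ (Icc 0 1))
    {N : Matrix (Fin n) (Fin n) ℤ} {κ : Fin n → ℝ}
    (h0 : K 0 =ᶠ[𝓝 (γ 0)] fun c => (N.map (Int.cast : ℤ → ℝ)).mulVec (J 0 c) + κ) :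
    K 1 =ᶠ[𝓝 (γ 1)] fun c => (N.map (Int.cast : ℤ → ℝ)).mulVec (J 1 c) + κ := by
  let p : ℝ → Prop := fun t =>
    K t =ᶠ[𝓝 (γ t)] fun c => (N.map (Int.cast : ℤ → ℝ)).mulVec (J t c) + κ
  have key : (p 0 ↔ p 1) := by
    -- Near each t the two continuations satisfy some affine relation (M, μ), which is unique. So
    -- whether the given relation (N, κ) holds is a locally constant property of the parameter.
    refine isPreconnected_Icc.induction₂ (s := Icc (0 : ℝ) 1) (fun s t => p s ↔ p t) ?_
      (fun s t u _ _ _ h1 h2 => h1.trans h2) (fun s t _ _ h => h.symm)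
      (left_mem_Icc.2 zero_le_one) (right_mem_Icc.2 zero_le_one)
    intro t ht
    obtain ⟨U, hU, hJU⟩ := hJ.1 t ht
    obtain ⟨V, hV, hKV⟩ := hK.1 t ht
    obtain ⟨M, μ, hM⟩ := hJU.exists_affine hKV hU hV
    have hnear : ∀ᶠ s in 𝓝[Icc 0 1] t, γ s ∈ U ∧
        K t =ᶠ[𝓝 (γ s)] fun c => (M.map (Int.cast : ℤ → ℝ)).mulVec (J t c) + μ :=
      (hγ t ht).eventually ((hJU.1.eventually_mem hU).and (eventually_eventually_nhds.2 hM))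
    have step : ∀ s, γ s ∈ U → J s =ᶠ[𝓝 (γ s)] J t → K s =ᶠ[𝓝 (γ s)] K t →
        (K t =ᶠ[𝓝 (γ s)] fun c => (M.map (Int.cast : ℤ → ℝ)).mulVec (J t c) + μ) →
        (p s ↔ N = M ∧ κ = μ) := by
      intro s hsU hJs hKs hs
      constructor
      · intro hp
        refine hJU.affine_unique hsU ?_
        filter_upwards [hp, hJs, hKs, hs] with d h1 h2 h3 h4
        rw [← h4, ← h3, h1, h2]
      · rintro ⟨rfl, rfl⟩
        filter_upwards [hJs, hKs, hs] with d h2 h3 h4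
        rw [h3, h4, h2]
    filter_upwards [hnear, hJ.2 t ht, hK.2 t ht] with s hs hJs hKs
    rw [step t hU EventuallyEq.rfl EventuallyEq.rfl hM, step s hs.1 hJs hKs hs.2]
  exact key.1 h0

/-- One explicit continuation is enough: a second one with the same initial germ satisfies the
identity relation with it at the start, hence also at the end. -/
theorem hasActionMonodromy_of_continuation (hJ : IsActionContinuation B P F γ J)
    (hγ : ContinuousOn γ (Icc 0 1)) {A : (Fin n → ℝ) → Fin n → ℝ} {M : Matrix (Fin n) (Fin n) ℤ}
    (h0 : J 0 =ᶠ[𝓝 (γ 0)] A)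
    (h1 : J 1 =ᶠ[𝓝 (γ 1)] fun c => (M.map (Int.cast : ℤ → ℝ)).mulVec (A c)) :
    HasActionMonodromy B P F γ A M := by
  refine ⟨⟨J, hJ, h0⟩, fun K hK hK0 => ?_⟩
  have h2 : K 0 =ᶠ[𝓝 (γ 0)] fun c =>
      ((1 : Matrix (Fin n) (Fin n) ℤ).map (Int.cast : ℤ → ℝ)).mulVec (J 0 c) + 0 := by
    filter_upwards [h0, hK0] with d hd1 hd2
    rw [hd2, hd1, Matrix.map_one _ Int.cast_zero Int.cast_one, Matrix.one_mulVec, add_zero]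
  have h3 := hJ.affine_relation hK hγ h2
  filter_upwards [h1, h3] with d hd1 hd2
  rw [hd2, ← hd1, Matrix.map_one _ Int.cast_zero Int.cast_one, Matrix.one_mulVec, add_zero]

/-- Single-valued action variables I would be the constant continuation. The relation I = N J + κ at
the start gives I = N M J + κ after the loop, so N = N M; as N is invertible over the integers, M =
1. -/
theorem hasNontrivialMonodromy_of_continuation (hJ : IsActionContinuation B P F γ J)
    (hγ : ContinuousOn γ (Icc 0 1)) (hloop : γ 1 = γ 0) {M : Matrix (Fin n) (Fin n) ℤ}
    (hM : M ≠ 1)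
    (h1 : J 1 =ᶠ[𝓝 (γ 0)] fun c => (M.map (Int.cast : ℤ → ℝ)).mulVec (J 0 c)) :
    HasNontrivialMonodromy B P F γ := by
  rintro ⟨U, I, hγU, hI⟩
  have hK : IsActionContinuation B P F γ fun _ => I :=
    ⟨fun t ht => ⟨U, hγU (mem_image_of_mem γ ht), hI⟩,
      fun t _ => Eventually.of_forall fun s => EventuallyEq.rfl⟩
  have h0U : γ 0 ∈ U := hγU (mem_image_of_mem γ (left_mem_Icc.2 zero_le_one))
  obtain ⟨V, hV, hJV⟩ := hJ.1 0 (left_mem_Icc.2 zero_le_one)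
  obtain ⟨N, κ, hN⟩ := hJV.exists_affine hI hV h0U
  obtain ⟨N', κ', hN'⟩ := hI.exists_affine hJV h0U hV
  have h2 := hJ.affine_relation hK hγ hN
  rw [hloop] at h2
  have h3 : (N = N * M) := by
    refine (hJV.affine_unique hV (κ := κ) (μ := κ) ?_).1
    filter_upwards [hN, h2, h1] with d hd1 hd2 hd3
    rw [← hd1, hd2, hd3, Matrix.mulVec_mulVec, ← Matrix.map_mul_intCast]
  have h4 : N' * N = 1 := by
    refine (hJV.affine_unique hV (κ := (N'.map (Int.cast : ℤ → ℝ)).mulVec κ + κ') (μ := 0) ?_).1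
    filter_upwards [hN, hN'] with d hd1 hd2
    rw [Matrix.map_one _ Int.cast_zero Int.cast_one, Matrix.one_mulVec, add_zero,
      Matrix.map_mul_intCast, ← Matrix.mulVec_mulVec, ← add_assoc, ← Matrix.mulVec_add, ← hd1, ← hd2]
  apply hM
  calc M = N' * N * M := by rw [h4, one_mul]
    _ = N' * N := by rw [mul_assoc, ← h3]
    _ = 1 := h4

end Continuation

/-! ### The actions along a loop around the critical values -/

section Loop

variable {b h l g : ℝ} {c : Fin 3 → ℝ}

/-- The branch of the first action at the values `(h, r sin (2πx), 2h + r cos (2πx))`. -/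
noncomputable def loopAction (b x : ℝ) (c : Fin 3 → ℝ) : ℝ :=
  -- Integers x are the crossings of the ray l = 0, g > 2h, where J₁ is not smooth. At x = k the
  -- offset 2k - 1 is the one for which √(2h) - J₃ = J₁ + |l| matches J₁ + 2(k - 1)l at l < 0 and J₁
  -- + 2kl at l > 0.
  if x = ⌊x⌋ then √(2 * c 0) - prolateJ₃ b (c 0) (c 1) (c 2) + (2 * ⌊x⌋ - 1 : ℤ) * c 1
  else prolateJ₁ b (c 0) (c 1) (c 2) + (2 * ⌊x⌋ : ℤ) * c 1

theorem loopAction_add_one (b x : ℝ) (c : Fin 3 → ℝ) :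
    loopAction b (x + 1) c = loopAction b x c + 2 * c 1 := by
  unfold loopAction
  simp only [Int.floor_add_one, Int.cast_add, Int.cast_one, add_left_inj]
  split_ifs <;> push_cast <;> ring

/-- The branch is defined near all values with the given angular variable. -/
theorem exists_isSepActionAt_loopAction (hb : 1 < b) {r x : ℝ} (hr : 0 < r)
    (hc : IsRegularValue b h (r * Real.sin (2 * Real.pi * x)) (2 * h + r * Real.cos (2 * Real.pi * x))) :
    ∃ U : Set (Fin 3 → ℝ), IsOpen U ∧
      ![h, r * Real.sin (2 * Real.pi * x), 2 * h + r * Real.cos (2 * Real.pi * x)] ∈ U ∧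
      ∀ c ∈ U, IsSepActionAt b c (loopAction b x) := by
  by_cases hx : x = ⌊x⌋
  · refine ⟨upperValues b, isOpen_upperValues b, ⟨hc, Or.inr ?_⟩, fun c hc => ?_⟩
    · have : Real.cos (2 * Real.pi * x) = 1 :=
        (Real.cos_eq_one_iff _).2 ⟨⌊x⌋, by rw [← hx]; ring⟩
      simp [this, hr]
    · have := (isSepActionAt_sqrt_sub_prolateJ₃ hb hc).add_int_mul (2 * ⌊x⌋ - 1)
      exact this.congr (Eventually.of_forall fun d => if_pos hx)
  · refine ⟨lowerValues b, isOpen_lowerValues b, ⟨hc, ?_⟩, fun c hc => ?_⟩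
    · by_contra hcon
      simp only [Matrix.cons_val, not_or, not_not, not_lt] at hcon
      have hs : Real.sin (2 * Real.pi * x) = 0 := (mul_eq_zero.1 hcon.1).resolve_left hr.ne'
      have hc0 : 0 ≤ Real.cos (2 * Real.pi * x) := nonneg_of_mul_nonneg_right (by linarith) hr
      have hc1 : Real.cos (2 * Real.pi * x) = 1 := by
        have := Real.sin_sq_add_cos_sq (2 * Real.pi * x)
        rw [hs] at this
        nlinarith
      obtain ⟨n, hn⟩ := (Real.cos_eq_one_iff _).1 hc1
      have hxn : x = n := by
        have := Real.pi_pos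
        have h2 : 2 * Real.pi * (x - n) = 0 := by linarith
        linarith [(mul_eq_zero.1 h2).resolve_left (by positivity)]
      exact hx (by rw [hxn, Int.floor_intCast])
    · have := (isSepActionAt_prolateJ₁ hb hc).add_int_mul (2 * ⌊x⌋)
      exact this.congr (Eventually.of_forall fun d => if_neg hx)

/-- Branches with nearby angular variables agree. -/
theorem eventually_loopAction_eventuallyEq (hb : 1 < b) {S : Set ℝ} {h r x : ℝ → ℝ} {t : ℝ}
    (hx : ContinuousWithinAt x S t) (hr : ∀ s ∈ S, 0 < r s)
    (hreg : ∀ s ∈ S, IsRegularValue b (h s) (r s * Real.sin (2 * Real.pi * x s))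
      (2 * h s + r s * Real.cos (2 * Real.pi * x s))) :
    ∀ᶠ s in 𝓝[S] t, loopAction b (x s)
      =ᶠ[𝓝 ![h s, r s * Real.sin (2 * Real.pi * x s),
        2 * h s + r s * Real.cos (2 * Real.pi * x s)]] loopAction b (x t) := by
  by_cases hxt : x t = ⌊x t⌋
  · set k := ⌊x t⌋ with hk
    have hnear : ∀ᶠ s in 𝓝[S] t, x s ∈ Ioo ((k : ℝ) - 1 / 2) (k + 1 / 2) :=
      hx.eventually (isOpen_Ioo.mem_nhds ⟨by rw [hxt]; linarith, by rw [hxt]; linarith⟩)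
    filter_upwards [hnear, self_mem_nhdsWithin] with s hs hsS
    have hπ := Real.pi_pos
    have hsin : Real.sin (2 * Real.pi * x s) = Real.sin (2 * Real.pi * (x s - k)) := by
      rw [show 2 * Real.pi * (x s - k) = 2 * Real.pi * x s - k * (2 * Real.pi) by ring,
        Real.sin_sub_int_mul_two_pi]
    rcases lt_trichotomy (x s) k with hlt | heq | hgt
    -- Just before the crossing l < 0 and the floor is k - 1; just after it l > 0 and the floor is
    -- k. The jump of the floor is compensated by the change of sign in |l|.
    · have hfl : ⌊x s⌋ = k - 1 := by
        rw [Int.floor_eq_iff]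
        push_cast
        exact ⟨by linarith [hs.1], by linarith⟩
      have hl : r s * Real.sin (2 * Real.pi * x s) < 0 := by
        refine mul_neg_of_pos_of_neg (hr s hsS) ?_
        rw [hsin]
        exact Real.sin_neg_of_neg_of_neg_pi_lt (by nlinarith) (by nlinarith [hs.1])
      have := sqrt_sub_prolateJ₃_eventuallyEq (c := ![h s, r s * Real.sin (2 * Real.pi * x s),
        2 * h s + r s * Real.cos (2 * Real.pi * x s)]) hb (hreg s hsS) hl.ne (ε := -1)
        (by simpa using (abs_of_neg hl).symm)
      filter_upwards [this] with d hd
      have hne : ¬ x s = ⌊x s⌋ := fun h1 => by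
        rw [hfl] at h1; push_cast at h1; linarith [hs.1]
      rw [loopAction, loopAction, if_neg hne, if_pos hxt, ← hk, hd, hfl]
      push_cast
      ring
    · rw [heq, ← hxt]
    · have hfl : ⌊x s⌋ = k := by
        rw [Int.floor_eq_iff]
        exact ⟨hgt.le, by linarith [hs.2]⟩
      have hl : 0 < r s * Real.sin (2 * Real.pi * x s) := by
        refine mul_pos (hr s hsS) ?_
        rw [hsin]
        exact Real.sin_pos_of_pos_of_lt_pi (by nlinarith) (by nlinarith [hs.2])
      have := sqrt_sub_prolateJ₃_eventuallyEq (c := ![h s, r s * Real.sin (2 * Real.pi * x s),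
        2 * h s + r s * Real.cos (2 * Real.pi * x s)]) hb (hreg s hsS) hl.ne' (ε := 1)
        (by simpa using (abs_of_pos hl).symm)
      filter_upwards [this] with d hd
      have hne : ¬ x s = ⌊x s⌋ := fun h1 => by
        rw [hfl] at h1; linarith
      rw [loopAction, loopAction, if_neg hne, if_pos hxt, ← hk, hd, hfl]
      push_cast
      ring
  · have hlt : (⌊x t⌋ : ℝ) < x t := lt_of_le_of_ne (Int.floor_le _) (Ne.symm hxt)
    have hnear : ∀ᶠ s in 𝓝[S] t, x s ∈ Ioo (⌊x t⌋ : ℝ) (⌊x t⌋ + 1) :=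
      hx.eventually (isOpen_Ioo.mem_nhds ⟨hlt, Int.lt_floor_add_one _⟩)
    filter_upwards [hnear] with s hs
    have hfl : ⌊x s⌋ = ⌊x t⌋ := Int.floor_eq_iff.2 ⟨hs.1.le, hs.2⟩
    have hne : ¬ x s = ⌊x s⌋ := fun h1 => by
      rw [hfl] at h1; linarith [hs.1]
    refine Eventually.of_forall fun d => ?_
    rw [loopAction, loopAction, if_neg hne, if_neg hxt, hfl]

end Loop

/-! ### Continuation of the actions along a loop and its monodromy matrix -/

section Monodromy

variable {b : ℝ}

/-- The continuation of the actions along a loop with angular variable `x`. -/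
noncomputable def loopActions (b : ℝ) (q : ℤ) (x : ℝ → ℝ) (t : ℝ) (c : Fin 3 → ℝ) : Fin 3 → ℝ :=
  -- The shift by -2⌊x 0⌋ normalizes the branch to J₁ itself at the initial point when l ≠ 0 there;
  -- q is a fixed integer, the initial sign of l.
  ![loopAction b (x t) c + (-2 * ⌊x 0⌋ : ℤ) * c 1, c 1,
    √(2 * c 0) - q * c 1 - (loopAction b (x t) c + (-2 * ⌊x 0⌋ : ℤ) * c 1)]

/-- The continuation of the actions of the reduced system along a loop with angular variable
`x`. -/
noncomputable def reducedLoopActions (b h : ℝ) (x : ℝ → ℝ) (t : ℝ) (c : Fin 2 → ℝ) : Fin 2 → ℝ :=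
  ![loopAction b (x t) ![h, c 0, c 1] + (-2 * ⌊x 0⌋ : ℤ) * c 0, c 0]

theorem isActionContinuation_loopActions (hb : 1 < b) (q : ℤ) {γ : ℝ → Fin 3 → ℝ} {h r x : ℝ → ℝ}
    (hx : ContinuousOn x (Icc 0 1)) (hr : ∀ t ∈ Icc (0 : ℝ) 1, 0 < r t)
    (hγ : ∀ t ∈ Icc (0 : ℝ) 1, γ t = ![h t, r t * Real.sin (2 * Real.pi * x t),
      2 * h t + r t * Real.cos (2 * Real.pi * x t)])
    (hreg : ∀ t ∈ Icc (0 : ℝ) 1, IsRegularValue b (γ t 0) (γ t 1) (γ t 2)) :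
    IsActionContinuation diracMatrix cotangentS3 (prolateMap b) γ (loopActions b q x) := by
  have hreg' : ∀ t ∈ Icc (0 : ℝ) 1, IsRegularValue b (h t) (r t * Real.sin (2 * Real.pi * x t))
      (2 * h t + r t * Real.cos (2 * Real.pi * x t)) := fun t ht => by
    have := hreg t ht
    rw [hγ t ht] at this
    exact this
  constructor
  · intro t ht
    obtain ⟨U, hU, hmem, hsep⟩ := exists_isSepActionAt_loopAction hb (hr t ht) (hreg' t ht)
    rw [← hγ t ht] at hmem
    exact ⟨U, hmem, isActionVariables_prolate hb hU fun c hc =>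
      ⟨_, q, (hsep c hc).add_int_mul (-2 * ⌊x 0⌋), EventuallyEq.rfl⟩⟩
  · intro t ht
    filter_upwards [eventually_loopAction_eventuallyEq hb (hx t ht) hr hreg', self_mem_nhdsWithin]
      with s hs hsS
    rw [← hγ s hsS] at hs
    filter_upwards [hs] with d hd
    simp only [loopActions, hd]

theorem isActionContinuation_reducedLoopActions (hb : 1 < b) {h : ℝ} {γ : ℝ → Fin 2 → ℝ}
    {r x : ℝ → ℝ} (hx : ContinuousOn x (Icc 0 1)) (hr : ∀ t ∈ Icc (0 : ℝ) 1, 0 < r t)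
    (hγ : ∀ t ∈ Icc (0 : ℝ) 1, γ t = ![r t * Real.sin (2 * Real.pi * x t),
      2 * h + r t * Real.cos (2 * Real.pi * x t)])
    (hreg : ∀ t ∈ Icc (0 : ℝ) 1, IsRegularValue b h (γ t 0) (γ t 1)) :
    IsActionContinuation liePoissonMatrix (reducedSpace h) (reducedProlateMap b) γ
      (reducedLoopActions b h x) := by
  have hreg' : ∀ t ∈ Icc (0 : ℝ) 1, IsRegularValue b h (r t * Real.sin (2 * Real.pi * x t))
      (2 * h + r t * Real.cos (2 * Real.pi * x t)) := fun t ht => by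
    have := hreg t ht
    rw [hγ t ht] at this
    exact this
  have hemb : Continuous fun c : Fin 2 → ℝ => (![h, c 0, c 1] : Fin 3 → ℝ) := by
    refine continuous_pi fun i => ?_
    fin_cases i
    · exact continuous_const
    · exact continuous_apply (0 : Fin 2)
    · exact continuous_apply (1 : Fin 2)
  have hγ' : ∀ t ∈ Icc (0 : ℝ) 1, ![h, γ t 0, γ t 1] = ![h, r t * Real.sin (2 * Real.pi * x t),
      2 * h + r t * Real.cos (2 * Real.pi * x t)] := fun t ht => by
    rw [hγ t ht]; rfl
  constructor
  · intro t ht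
    obtain ⟨U, hU, hmem, hsep⟩ := exists_isSepActionAt_loopAction hb (hr t ht) (hreg' t ht)
    rw [← hγ' t ht] at hmem
    exact ⟨_, hmem, isActionVariables_reducedProlate hb (hU.preimage hemb) fun c hc =>
      ⟨_, (hsep _ hc).add_int_mul (-2 * ⌊x 0⌋), EventuallyEq.rfl⟩⟩
  · intro t ht
    filter_upwards [eventually_loopAction_eventuallyEq hb (h := fun _ => h) (hx t ht) hr hreg',
      self_mem_nhdsWithin] with s hs hsS
    rw [← hγ' s hsS] at hs
    filter_upwards [hemb.continuousAt.eventually hs] with d hd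
    simp only [reducedLoopActions, hd]

theorem loopActions_one (q : ℤ) {x : ℝ → ℝ} (hx : x 1 = x 0 + 1) (c : Fin 3 → ℝ) :
    loopActions b q x 1 c
      = ((!![1, 2, 0; 0, 1, 0; 0, -2, 1] : Matrix (Fin 3) (Fin 3) ℤ).map
        (Int.cast : ℤ → ℝ)).mulVec (loopActions b q x 0 c) := by
  funext i
  fin_cases i <;>
    simp [loopActions, hx, loopAction_add_one, Matrix.mulVec, dotProduct, Fin.sum_univ_three] <;>
    ring

theorem reducedLoopActions_one {h : ℝ} {x : ℝ → ℝ} (hx : x 1 = x 0 + 1) (c : Fin 2 → ℝ) :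
    reducedLoopActions b h x 1 c
      = ((!![1, 2; 0, 1] : Matrix (Fin 2) (Fin 2) ℤ).map
        (Int.cast : ℤ → ℝ)).mulVec (reducedLoopActions b h x 0 c) := by
  funext i
  fin_cases i <;>
    simp [reducedLoopActions, hx, loopAction_add_one, Matrix.mulVec, dotProduct, Fin.sum_univ_two]
  ring

theorem loopAction_of_sin_ne_zero {x : ℝ} (hx : Real.sin (2 * Real.pi * x) ≠ 0)
    (c : Fin 3 → ℝ) :
    loopAction b x c = prolateJ₁ b (c 0) (c 1) (c 2) + (2 * ⌊x⌋ : ℤ) * c 1 := by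
  refine if_neg fun h => hx ?_
  rw [h, show 2 * Real.pi * (⌊x⌋ : ℝ) = ((2 * ⌊x⌋ : ℤ) : ℝ) * Real.pi by push_cast; ring,
    Real.sin_int_mul_pi]

theorem prolateActions_eventuallyEq (hb : 1 < b) {c : Fin 3 → ℝ}
    (hc : IsRegularValue b (c 0) (c 1) (c 2)) (hl : c 1 ≠ 0) {q : ℤ} (hq : q * c 1 = |c 1|) :
    prolateActions b =ᶠ[𝓝 c] fun c => ![prolateJ₁ b (c 0) (c 1) (c 2), c 1,
      √(2 * c 0) - q * c 1 - prolateJ₁ b (c 0) (c 1) (c 2)] := by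
  filter_upwards [sqrt_sub_prolateJ₃_eventuallyEq hb hc hl hq] with d hd
  have : prolateJ₃ b (d 0) (d 1) (d 2)
      = √(2 * d 0) - q * d 1 - prolateJ₁ b (d 0) (d 1) (d 2) := by linarith
  rw [prolateActions, this]

end Monodromy

theorem mainTheorem6 (b : ℝ) (hb : 1 < b) :
    -- the prolate fibration on the cotangent bundle of the three-sphere
    (regularValues diracMatrix cotangentS3 (prolateMap b) =
        {c | 0 < c 2 ∧ c 2 < b * (2 * c 0 - c 1 ^ 2) ∧ ¬ (c 1 = 0 ∧ c 2 = 2 * c 0)} ∧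
      IsActionVariables diracMatrix cotangentS3 (prolateMap b)
        {c | c ∈ regularValues diracMatrix cotangentS3 (prolateMap b) ∧ c 1 ≠ 0}
        (prolateActions b) ∧
      ∀ γ : ℝ → Fin 3 → ℝ, IsClockwiseLoop γ →
        (∀ t ∈ Icc (0 : ℝ) 1, γ t ∈ regularValues diracMatrix cotangentS3 (prolateMap b)) →
        HasNontrivialMonodromy diracMatrix cotangentS3 (prolateMap b) γ ∧
        (γ 0 1 ≠ 0 → HasActionMonodromy diracMatrix cotangentS3 (prolateMap b) γ
          (prolateActions b) !![1, 2, 0; 0, 1, 0; 0, -2, 1])) ∧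
    -- the reduced prolate system on the product of two spheres, at any energy
    (∀ h : ℝ, 0 < h →
      regularValues liePoissonMatrix (reducedSpace h) (reducedProlateMap b) =
        {c | 0 < c 1 ∧ c 1 < b * (2 * h - c 0 ^ 2) ∧ ¬ (c 0 = 0 ∧ c 1 = 2 * h)} ∧
      IsActionVariables liePoissonMatrix (reducedSpace h) (reducedProlateMap b)
        {c | c ∈ regularValues liePoissonMatrix (reducedSpace h) (reducedProlateMap b) ∧ c 0 ≠ 0}
        (reducedProlateActions b h) ∧
      ∀ γ : ℝ → Fin 2 → ℝ, IsReducedClockwiseLoop h γ →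
        (∀ t ∈ Icc (0 : ℝ) 1,
          γ t ∈ regularValues liePoissonMatrix (reducedSpace h) (reducedProlateMap b)) →
        HasNontrivialMonodromy liePoissonMatrix (reducedSpace h) (reducedProlateMap b) γ ∧
        (γ 0 0 ≠ 0 → HasActionMonodromy liePoissonMatrix (reducedSpace h) (reducedProlateMap b) γ
          (reducedProlateActions b h) !![1, 2; 0, 1])) := by
  have h0 : (0 : ℝ) ∈ Icc (0 : ℝ) 1 := left_mem_Icc.2 zero_le_one
  have h1 : (1 : ℝ) ∈ Icc (0 : ℝ) 1 := right_mem_Icc.2 zero_le_one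
  have hπ := Real.pi_pos
  have angle : ∀ θ, 2 * Real.pi * ((Real.pi / 2 - θ) / (2 * Real.pi)) = Real.pi / 2 - θ :=
    fun θ => by field_simp
  constructor
  · refine ⟨regularValues_prolate hb, ?_, ?_⟩
    · rw [regularValues_prolate hb]
      have hopen : IsOpen {c : Fin 3 → ℝ | IsRegularValue b (c 0) (c 1) (c 2) ∧ c 1 ≠ 0} :=
        (isOpen_isRegularValue b).inter (isOpen_ne_fun (f := fun c : Fin 3 → ℝ => c 1)
          (g := fun _ => (0 : ℝ)) (continuous_apply 1) continuous_const)
      refine isActionVariables_prolate hb hopen fun c hc => ?_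
      obtain ⟨q, hq⟩ := exists_int_mul_eq_abs (c 1)
      exact ⟨_, q, isSepActionAt_prolateJ₁ hb ⟨hc.1, Or.inl hc.2⟩,
        prolateActions_eventuallyEq hb hc.1 hc.2 hq⟩
    · rintro γ ⟨h, r, θ, hh, hr, hθ, hγ, hh1, hr1, hθ1⟩ hreg
      rw [regularValues_prolate hb] at hreg
      -- x counts clockwise turns from the ray l = 0, g > 2h, so l = r sin 2πx and g - 2h = r cos
      -- 2πx, and x increases by 1 along the loop.
      set x : ℝ → ℝ := fun t => (Real.pi / 2 - θ t) / (2 * Real.pi) with hxdef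
      have hx : ContinuousOn x (Icc 0 1) := (continuousOn_const.sub hθ).div_const _
      have hx1 : x 1 = x 0 + 1 := by
        simp only [hxdef, hθ1]; field_simp; ring
      have hγx : ∀ t ∈ Icc (0 : ℝ) 1, γ t = ![h t, r t * Real.sin (2 * Real.pi * x t),
          2 * h t + r t * Real.cos (2 * Real.pi * x t)] := fun t ht => by
        rw [(hγ t ht).2, hxdef]
        simp only [angle, Real.sin_pi_div_two_sub, Real.cos_pi_div_two_sub]
      have hγc : ContinuousOn γ (Icc 0 1) := by
        refine ContinuousOn.congr (f := fun t => ![h t, r t * Real.cos (θ t),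
          2 * h t + r t * Real.sin (θ t)]) ?_ fun t ht => (hγ t ht).2
        refine continuousOn_pi.2 fun i => ?_
        fin_cases i
        · exact hh
        · exact hr.mul (Real.continuous_cos.comp_continuousOn hθ)
        · exact (continuousOn_const.mul hh).add (hr.mul (Real.continuous_sin.comp_continuousOn hθ))
      have hloop : γ 1 = γ 0 := by
        rw [(hγ 1 h1).2, (hγ 0 h0).2, hh1, hr1, hθ1, Real.cos_sub_two_pi, Real.sin_sub_two_pi]
      -- If l = 0 at the start, q is just some integer; the continuation exists all the same and
      -- proves non-triviality. Its value matters only for the identification with J₃.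
      obtain ⟨q, hq⟩ := exists_int_mul_eq_abs (γ 0 1)
      have hJ := isActionContinuation_loopActions hb q hx (fun t ht => (hγ t ht).1) hγx hreg
      refine ⟨hasNontrivialMonodromy_of_continuation hJ hγc hloop
        (M := !![1, 2, 0; 0, 1, 0; 0, -2, 1]) (fun hM => ?_)
        (Eventually.of_forall (loopActions_one q hx1)), fun hl => ?_⟩
      · have := congrFun (congrFun hM 0) 1
        simp at this
      · have hsin : Real.sin (2 * Real.pi * x 0) ≠ 0 := fun hs => hl (by rw [hγx 0 h0]; simp [hs])
        have hstart : loopActions b q x 0 =ᶠ[𝓝 (γ 0)] prolateActions b := by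
          filter_upwards [prolateActions_eventuallyEq hb (hreg 0 h0) hl hq] with d hd
          rw [hd, loopActions, loopAction_of_sin_ne_zero hsin]
          push_cast
          congr 1
          · ring
          · congr 2; ring_nf
        refine hasActionMonodromy_of_continuation hJ hγc hstart ?_
        rw [hloop]
        filter_upwards [hstart] with d hd
        rw [loopActions_one q hx1, hd]
  · intro h hh
    refine ⟨regularValues_reduced hb hh, ?_, ?_⟩
    · rw [regularValues_reduced hb hh]
      have hopen : IsOpen {c : Fin 2 → ℝ | IsRegularValue b h (c 0) (c 1) ∧ c 0 ≠ 0} := by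
        have hemb : Continuous fun c : Fin 2 → ℝ => (![h, c 0, c 1] : Fin 3 → ℝ) := by
          refine continuous_pi fun i => ?_
          fin_cases i
          · exact continuous_const
          · exact continuous_apply (0 : Fin 2)
          · exact continuous_apply (1 : Fin 2)
        exact ((isOpen_isRegularValue b).preimage hemb).inter
          (isOpen_ne_fun (f := fun c : Fin 2 → ℝ => c 0) (g := fun _ => (0 : ℝ))
            (continuous_apply 0) continuous_const)
      exact isActionVariables_reducedProlate hb hopen fun c hc =>
        ⟨_, isSepActionAt_prolateJ₁ hb ⟨hc.1, Or.inl hc.2⟩, EventuallyEq.rfl⟩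
    · rintro γ ⟨r, θ, hr, hθ, hγ, hr1, hθ1⟩ hreg
      rw [regularValues_reduced hb hh] at hreg
      set x : ℝ → ℝ := fun t => (Real.pi / 2 - θ t) / (2 * Real.pi) with hxdef
      have hx : ContinuousOn x (Icc 0 1) := (continuousOn_const.sub hθ).div_const _
      have hx1 : x 1 = x 0 + 1 := by
        simp only [hxdef, hθ1]; field_simp; ring
      have hγx : ∀ t ∈ Icc (0 : ℝ) 1, γ t = ![r t * Real.sin (2 * Real.pi * x t),
          2 * h + r t * Real.cos (2 * Real.pi * x t)] := fun t ht => by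
        rw [(hγ t ht).2, hxdef]
        simp only [angle, Real.sin_pi_div_two_sub, Real.cos_pi_div_two_sub]
      have hγc : ContinuousOn γ (Icc 0 1) := by
        refine ContinuousOn.congr (f := fun t => ![r t * Real.cos (θ t),
          2 * h + r t * Real.sin (θ t)]) ?_ fun t ht => (hγ t ht).2
        refine continuousOn_pi.2 fun i => ?_
        fin_cases i
        · exact hr.mul (Real.continuous_cos.comp_continuousOn hθ)
        · exact continuousOn_const.add (hr.mul (Real.continuous_sin.comp_continuousOn hθ))
      have hloop : γ 1 = γ 0 := by
        rw [(hγ 1 h1).2, (hγ 0 h0).2, hr1, hθ1, Real.cos_sub_two_pi, Real.sin_sub_two_pi]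
      have hJ := isActionContinuation_reducedLoopActions hb hx (fun t ht => (hγ t ht).1) hγx hreg
      refine ⟨hasNontrivialMonodromy_of_continuation hJ hγc hloop (M := !![1, 2; 0, 1])
        (fun hM => ?_) (Eventually.of_forall (reducedLoopActions_one hx1)), fun hl => ?_⟩
      · have := congrFun (congrFun hM 0) 1
        simp at this
      · have hsin : Real.sin (2 * Real.pi * x 0) ≠ 0 := fun hs => hl (by rw [hγx 0 h0]; simp [hs])
        have hstart : reducedLoopActions b h x 0 =ᶠ[𝓝 (γ 0)] reducedProlateActions b h := by
          refine Eventually.of_forall fun d => ?_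
          rw [reducedProlateActions, reducedLoopActions, loopAction_of_sin_ne_zero hsin]
          push_cast
          congr 1
          ring
        refine hasActionMonodromy_of_continuation hJ hγc hstart ?_
        filter_upwards [hloop ▸ hstart] with d hd
        rw [reducedLoopActions_one hx1, hd]
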